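/- **Setting.** Let $O\subseteq\mathbb R^d$ be a Borel set, $\mathcal B_b(O)$ the $\delta$-ring of relatively compact Borel subsets of $O$, $(\Omega,\mathcal A,P)$ a probability space, and $L^0(\Omega,P)$ the space of classes of random variables with convergence in probability. An *infinitely divisible random measure* is a map $N\colon\mathcal B_b(O)\to L^0(\Omega,P)$ such that for disjoint $A_1,A_2,\dots\in\mathcal B_b(O)$ the variables $N(A_k)$ are independent, $N(\bigcup_kA_k)=\sum_kN(A_k)$ a.s. whenever $\bigcup_kA_k\in\mathcal B_b(O)$, and each $N(A)$ is infinitely divisible. A *Lévy-valued random measure* is a family $M=(M(t))_{t\ge0}$ of such maps for which $((M(t,A_1),\dots,M(t,A_n)))_{t\ge0}$ is a Lévy process in $\mathbb R^n$ for all $A_1,\dots,A_n\in\mathcal B_b(O)$. Its *characteristics* $(\gamma,\Sigma,\nu)$ are a signed measure $\gamma$ and a measure $\Sigma$ on $\mathcal B_b(O)$ (with $\|\gamma\|_{TV}$ and $\Sigma$ extended to $\sigma$-finite Borel measures on $O$) and a $\sigma$-finite Borel measure $\nu$ on $O\times\mathbb R$, such that $M(1,A)$ has the Lévy triplet $(\gamma(A),\Sigma(A),\nu(A\times\cdot))$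 for all $A\in\mathcal B_b(O)$; triplets refer to the truncation $y\mathbf 1_{B}(y)$, $B=[-1,1]$. The *control measure* is the $\sigma$-finite measure $\lambda(A)=\|\gamma\|_{TV}(A)+\Sigma(A)+\int_{A\times\mathbb R}(y^2\wedge1)\,\nu(dx,dy)$. Let $\rho(x,dy)$ be the disintegration of $\nu$ over $\lambda$ and $$U(u,x)=u\frac{d\gamma}{d\lambda}(x)+u\int_{\mathbb R}y\big(\mathbf 1_B(uy)-\mathbf 1_B(y)\big)\rho(x,dy),$$ $$\Phi_M(u,x)=\sup_{|c|\le1}|U(cu,x)|+u^2\frac{d\Sigma}{d\lambda}(x)+\int_{\mathbb R}(1\wedge|uy|^2)\,\rho(x,dy).$$ $L_M(O,\lambda)$ is the space of $\lambda$-classes $f$ with $\int_O\Phi_M(|f(x)|,x)\,\lambda(dx)<\infty$, where $f_n\to f$ means $\int_O\Phi_M(|f_n-f|(x),x)\,\lambda(dx)\to0$. For a simple function $f=\sum_{k=1}^n\alpha_k\mathbf 1_{A_k}$ with disjoint $A_k\in\mathcal B_b(O)$ put $\int_Af\,dM(t)=\sum_k\alpha_kM(t,A\cap A_k)$. A measurable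 $f\colon O\to\mathbb R$ is *$M$-integrable* if there are simple functions $f_n\to f$ $\lambda$-a.e. such that $\int_Af_n\,dM(t)$ converges in probability for all Borel $A\subseteq O$ and $t\ge0$; then $\int_Af\,dM(t)$ denotes the limit. A *cylindrical Lévy process* in a Banach space $F$ is a family of linear continuous maps $L(t)\colon F^*\to L^0(\Omega,P)$, $t\ge0$, such that $((L(t)f_1,\dots,L(t)f_n))_{t\ge0}$ is a Lévy process in $\mathbb R^n$ for all $f_1,\dots,f_n\in F^*$. Its *cylindrical characteristics* $(a,Q,\mu)$ consist of a map $a\colon F^*\to\mathbb R$ with $a(0)=0$, a positive symmetric operator $Q\colon F^*\to F^{**}$, and a finitely additive $[0,\infty]$-valued measure $\mu$ on the cylinder sets $\{g\in F:(\langle g,f_1\rangle,\dots,\langle g,f_n\rangle)\in C\}$, $C\subseteq\mathbb R^n\setminus\{0\}$ Borel, whose finite-dimensional images are $\sigma$-additive on $\mathbb R^n\setminus\{0\}$ and which satisfies $\int_F(\langle g,f\rangle^2\wedge1)\,\mu(dg)<\infty$ for all $f\in F^*$, such that for each $f\in F^*$ the real Lévy process $L(\cdot)f$ has the triplet $(a(f),\langle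 Qf,f\rangle,\mu\circ\langle f,\cdot\rangle^{-1})$. Moreover $a$ is continuous at every $f$ for which $\mu(|\langle\cdot,f\rangle|=1)=0$. In particular $E\,e^{iL(t)f}=e^{t\Psi_L(f)}$ with $$\Psi_L(f)=ia(f)-\tfrac12\langle Qf,f\rangle+\int_F\big(e^{i\langle g,f\rangle}-1-i\langle g,f\rangle\mathbf 1_B(\langle g,f\rangle)\big)\mu(dg).$$ **Theorem.** Let $M$ be a Lévy-valued random measure on $\mathcal B_b(O)$ with characteristics $(\gamma,\Sigma,\nu)$ and control measure $\lambda$, and let $F$ be a Banach space such that $F^*$ is continuously embedded in $L_M(O,\lambda)$ and the simple functions are dense in $F^*$. Then every $f\in F^*$ is $M$-integrable, the integral does not depend on the approximating sequence, and $$L(t)f:=\int_Of(x)\,M(t,dx),\qquad f\in F^*,\ t\ge0,$$ defines a cylindrical Lévy process $L$ in $F$. It has cylindrical characteristics $(a,Q,\mu)$, and these necessarily satisfy, for every $f\in F^*$: 1. $U(f(\cdot),\cdot)$ is $\lambda$-integrable and $a(f)=\int_OU(f(x),x)\,\lambda(dx)$. If $f\in L^1(O,\|\gamma\|_{TV})$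 and $(x,y)\mapsto f(x)y(\mathbf 1_B(f(x)y)-\mathbf 1_B(y))$ is $\nu$-integrable, this reads $$a(f)=\int_Of(x)\,\gamma(dx)+\int_{O\times\mathbb R}f(x)y\big(\mathbf 1_B(f(x)y)-\mathbf 1_B(y)\big)\,\nu(dx,dy).$$ 2. $f\in L^2(O,\Sigma)$ and $\langle Qf,f\rangle=\int_Of(x)^2\,\Sigma(dx)$. 3. $\mu\circ\langle f,\cdot\rangle^{-1}=\nu\circ\chi_f^{-1}$ on the Borel subsets of $\mathbb R\setminus\{0\}$, where $\chi_f(x,y):=f(x)y$. -/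

import Mathlib

open MeasureTheory ProbabilityTheory Filter Set
open scoped NNReal ENNReal Topology

noncomputable section

namespace CylLevy

/-! ### Real Lévy triplets, infinite divisibility, Lévy processes -/

/-- The indicator function of the closed unit ball of `ℝ`. -/
def ballInd (y : ℝ) : ℝ := if |y| ≤ 1 then 1 else 0

/-- A Lévy measure on `ℝ`. -/
def IsLevyMeasure (m : Measure ℝ) : Prop :=
  m {0} = 0 ∧ ∫⁻ y, ENNReal.ofReal (min 1 (y ^ 2)) ∂m < ∞

/-- The Lévy–Khintchine exponent
`i u b - u² q / 2 + ∫ (exp (i u y) - 1 - i u y 1_{|y| ≤ 1}) m(dy)`. -/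
def levySymbol (b q : ℝ) (m : Measure ℝ) (u : ℝ) : ℂ :=
  Complex.I * u * b - (u : ℂ) ^ 2 * q / 2
    + ∫ y, (Complex.exp (Complex.I * u * y) - 1 - Complex.I * u * y * (ballInd y : ℂ)) ∂m

/-- `μ` is infinitely divisible: for each `n ≥ 1` it is the law of a sum of `n` i.i.d. variables. -/
def IsInfinitelyDivisible (μ : Measure ℝ) : Prop :=
  ∀ n : ℕ, 0 < n → ∃ m : Measure ℝ, IsProbabilityMeasure m ∧
    (Measure.pi fun _ : Fin n => m).map (fun x => ∑ i, x i) = μ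

variable {Ω : Type*} [MeasurableSpace Ω]

/-- A Lévy process in `ℝⁿ`. The random variables below are elements of `L⁰`, so that path
regularity is not part of the definition (there is always a càdlàg modification). -/
structure IsLevyProcess {n : ℕ} (Y : ℝ≥0 → Ω → (Fin n → ℝ)) (P : Measure Ω) : Prop where
  zero : Y 0 =ᵐ[P] 0
  indep : HasIndepIncrements Y P
  stationary : ∀ s t : ℝ≥0, IdentDistrib (fun ω => Y (s + t) ω - Y s ω) (Y t) P P
  stochCont : ∀ t : ℝ≥0, TendstoInMeasure P Y (𝓝 t) (Y t)

/-! ### Lévy-valued random measures -/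

section RandomMeasure

variable {X : Type*} [TopologicalSpace X] [MeasurableSpace X] {P : Measure Ω}

variable (X) in
/-- The `δ`-ring of relatively compact measurable sets. -/
def borelB : Set (Set X) := {A | MeasurableSet A ∧ IsCompact (closure A)}

/-- Infinitely divisible, independently scattered random measures on `borelB X`. The values of `N`
outside `borelB X` are irrelevant. -/
structure IsInfDivRandomMeasure (N : Set X → Ω →ₘ[P] ℝ) : Prop where
  indep : ∀ A : ℕ → Set X, (∀ k, A k ∈ borelB X) → Pairwise (Function.onFun Disjoint A) →
    iIndepFun (fun k => (N (A k) : Ω → ℝ)) P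
  iUnion : ∀ A : ℕ → Set X, (∀ k, A k ∈ borelB X) → Pairwise (Function.onFun Disjoint A) →
    (⋃ k, A k) ∈ borelB X →
    ∀ᵐ ω ∂P, Tendsto (fun n => ∑ k ∈ Finset.range n, N (A k) ω) atTop (𝓝 (N (⋃ k, A k) ω))
  infDiv : ∀ A ∈ borelB X, IsInfinitelyDivisible (P.map (N A))

/-- Lévy-valued random measures `M(t, A)`. -/
structure IsLevyRandomMeasure (M : ℝ≥0 → Set X → Ω →ₘ[P] ℝ) : Prop where
  infDivRandomMeasure : ∀ t, IsInfDivRandomMeasure (M t)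
  levy : ∀ (n : ℕ) (A : Fin n → Set X), (∀ i, A i ∈ borelB X) →
    IsLevyProcess (fun t ω i => M t (A i) ω) P

variable (X) in
/-- A real signed measure on the `δ`-ring `borelB X`, given by its Jordan decomposition: two
mutually singular measures on all measurable sets, finite on `borelB X`. -/
structure LocalSignedMeasure where
  pos : Measure X
  neg : Measure X
  mutuallySingular : pos ⟂ₘ neg
  pos_lt_top : ∀ A ∈ borelB X, pos A < ∞
  neg_lt_top : ∀ A ∈ borelB X, neg A < ∞

namespace LocalSignedMeasure

/-- The value `γ(A)`, for `A ∈ borelB X`. -/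
def value (γ : LocalSignedMeasure X) (A : Set X) : ℝ := (γ.pos A).toReal - (γ.neg A).toReal

/-- The total variation measure. -/
def totalVariation (γ : LocalSignedMeasure X) : Measure X := γ.pos + γ.neg

/-- The integral with respect to `γ`, for functions in `L¹(γ.totalVariation)`. -/
def integral (γ : LocalSignedMeasure X) (f : X → ℝ) : ℝ :=
  ∫ x, f x ∂γ.pos - ∫ x, f x ∂γ.neg

end LocalSignedMeasure

/-- The measure `ν_A = ν(A × ·)`. -/
def sectionMeasure (ν : Measure (X × ℝ)) (A : Set X) : Measure ℝ :=
  (ν.restrict (A ×ˢ univ)).map Prod.snd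

/-- The control measure `λ(A) = ‖γ‖_TV(A) + S(A) + ∫ (y² ∧ 1) ν(A, dy)`. -/
def controlMeasure (γ : LocalSignedMeasure X) (S : Measure X) (ν : Measure (X × ℝ)) : Measure X :=
  γ.totalVariation + S + (ν.withDensity fun z => ENNReal.ofReal (min 1 (z.2 ^ 2))).map Prod.fst

/-- `(γ, S, ν)` are the characteristics of `M`: for each relatively compact `A` the infinitely
divisible random variable `M(1, A)` has the Lévy triplet `(γ(A), S(A), ν_A)`; the measures live on
all measurable sets and are `σ`-finite there. -/
structure IsCharacteristics (M : ℝ≥0 → Set X → Ω →ₘ[P] ℝ) (γ : LocalSignedMeasure X)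
    (S : Measure X) (ν : Measure (X × ℝ)) : Prop where
  sigmaFinite_nu : SigmaFinite ν
  sigmaFinite_control : SigmaFinite (controlMeasure γ S ν)
  lt_top : ∀ A ∈ borelB X, S A < ∞
  levyMeasure : ∀ A ∈ borelB X, IsLevyMeasure (sectionMeasure ν A)
  charFun_eq : ∀ A ∈ borelB X, ∀ u : ℝ, charFun (P.map (M 1 A)) u
    = Complex.exp (levySymbol (γ.value A) (S A).toReal (sectionMeasure ν A) u)

/-! ### The integral of deterministic functions -/

variable (X) in
/-- Simple functions `∑ αₖ 1_{Aₖ}` with disjoint relatively compact measurable sets `Aₖ`. -/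
structure SimpleB where
  n : ℕ
  coeff : Fin n → ℝ
  set : Fin n → Set X
  mem : ∀ k, set k ∈ borelB X
  disj : Pairwise (Function.onFun Disjoint set)

namespace SimpleB

/-- The function `∑ αₖ 1_{Aₖ}`. -/
def toFun (s : SimpleB X) (x : X) : ℝ := ∑ k, (s.set k).indicator (fun _ => s.coeff k) x

/-- `∫_A s(x) M(t, dx) = ∑ αₖ M(t, A ∩ Aₖ)`. -/
def integral (s : SimpleB X) (M : ℝ≥0 → Set X → Ω →ₘ[P] ℝ) (t : ℝ≥0) (A : Set X) : Ω →ₘ[P] ℝ :=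
  ∑ k, s.coeff k • M t (A ∩ s.set k)

end SimpleB

/-- `s` is an admissible approximating sequence for the integral of `f`: it converges to `f`
almost everywhere with respect to the control measure `lam`, and its integrals over each measurable
set converge in probability, for all times. -/
def IsApprox (M : ℝ≥0 → Set X → Ω →ₘ[P] ℝ) (lam : Measure X) (f : X → ℝ)
    (s : ℕ → SimpleB X) : Prop :=
  (∀ᵐ x ∂lam, Tendsto (fun n => (s n).toFun x) atTop (𝓝 (f x))) ∧
  ∀ A : Set X, MeasurableSet A → ∀ t : ℝ≥0, ∃ Z : Ω →ₘ[P] ℝ,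
    TendstoInMeasure P (fun n => ((s n).integral M t A : Ω → ℝ)) atTop Z

/-- `f` is `M`-integrable. -/
def MIntegrable (M : ℝ≥0 → Set X → Ω →ₘ[P] ℝ) (lam : Measure X) (f : X → ℝ) : Prop :=
  Measurable f ∧ ∃ s : ℕ → SimpleB X, IsApprox M lam f s

/-- `Z` is the limit in probability of `∫_A sₙ(x) M(t, dx)` for some admissible sequence `sₙ`. -/
def IsMIntegral (M : ℝ≥0 → Set X → Ω →ₘ[P] ℝ) (lam : Measure X) (t : ℝ≥0) (A : Set X)
    (f : X → ℝ) (Z : Ω →ₘ[P] ℝ) : Prop :=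
  ∃ s : ℕ → SimpleB X, IsApprox M lam f s ∧
    TendstoInMeasure P (fun n => ((s n).integral M t A : Ω → ℝ)) atTop Z

open scoped Classical in
/-- The integral `∫_A f(x) M(t, dx)`. -/
def mIntegral (M : ℝ≥0 → Set X → Ω →ₘ[P] ℝ) (lam : Measure X) (t : ℝ≥0) (A : Set X)
    (f : X → ℝ) : Ω →ₘ[P] ℝ :=
  if h : ∃ Z, IsMIntegral M lam t A f Z then h.choose else 0

/-! ### The Musielak–Orlicz space `L_M` -/

/-- `ρ(x, dy)` is a disintegration of `ν` over `lam`. -/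
def IsDisintegration (ν : Measure (X × ℝ)) (lam : Measure X) (ρ : Kernel X ℝ) : Prop :=
  ∀ h : X × ℝ → ℝ≥0∞, Measurable h → ∫⁻ z, h z ∂ν = ∫⁻ x, ∫⁻ y, h (x, y) ∂ρ x ∂lam

open scoped Classical in
/-- The (`lam`-a.e. unique) disintegration of `ν` over `lam`. -/
def disint (ν : Measure (X × ℝ)) (lam : Measure X) : Kernel X ℝ :=
  if h : ∃ ρ, IsDisintegration ν lam ρ then h.choose else 0

/-- `U(u, x) = u a(x) + u ∫ y (1_{|u y| ≤ 1} - 1_{|y| ≤ 1}) ρ(x, dy)` with `a = dγ/dλ`. -/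
def U (γ : LocalSignedMeasure X) (S : Measure X) (ν : Measure (X × ℝ)) (u : ℝ) (x : X) : ℝ :=
  u * ((γ.pos.rnDeriv (controlMeasure γ S ν) x).toReal
      - (γ.neg.rnDeriv (controlMeasure γ S ν) x).toReal)
    + u * ∫ y, y * (ballInd (u * y) - ballInd y) ∂disint ν (controlMeasure γ S ν) x

/-- `Φ_M(u, x) = sup_{|c| ≤ 1} |U(c u, x)| + u² g(x) + ∫ (1 ∧ |u y|²) ρ(x, dy)` with
`g = dS/dλ`. -/
def Phi (γ : LocalSignedMeasure X) (S : Measure X) (ν : Measure (X × ℝ)) (u : ℝ) (x : X) : ℝ≥0∞ :=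
  (⨆ c ∈ Icc (-1 : ℝ) 1, ENNReal.ofReal |U γ S ν (c * u) x|)
    + ENNReal.ofReal (u ^ 2) * S.rnDeriv (controlMeasure γ S ν) x
    + ∫⁻ y, ENNReal.ofReal (min 1 ((u * y) ^ 2)) ∂disint ν (controlMeasure γ S ν) x

/-- `∫ Φ_M(|f(x)|, x) λ(dx)`. The space `L_M` consists of the classes `f` with finite modular, and
the sets `{h | modular (h - f) < ε}`, `ε > 0`, form a basis of neighbourhoods of `f` in `L_M`. -/
def modular (γ : LocalSignedMeasure X) (S : Measure X) (ν : Measure (X × ℝ))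
    (f : X →ₘ[controlMeasure γ S ν] ℝ) : ℝ≥0∞ :=
  ∫⁻ x, Phi γ S ν |f x| x ∂controlMeasure γ S ν

/-- The linear map `ι` is a continuous embedding of the normed space `V` into `L_M`. -/
structure IsContinuousEmbedding {V : Type*} [NormedAddCommGroup V] [NormedSpace ℝ V]
    (γ : LocalSignedMeasure X) (S : Measure X) (ν : Measure (X × ℝ))
    (ι : V →ₗ[ℝ] (X →ₘ[controlMeasure γ S ν] ℝ)) : Prop where
  injective : Function.Injective ι
  mem : ∀ f, modular γ S ν (ι f) < ∞
  continuous : Tendsto (fun f => modular γ S ν (ι f)) (𝓝 0) (𝓝 0)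

end RandomMeasure

/-! ### Cylindrical Lévy processes -/

section Cylindrical

variable {F : Type*} [NormedAddCommGroup F] [NormedSpace ℝ F]

/-- Cylindrical Lévy processes in `F`: each `L t` is linear and continuous from `F*` to `L⁰`
(with convergence in probability), and the finite-dimensional projections are Lévy processes. -/
structure IsCylindricalLevyProcess {P : Measure Ω}
    (L : ℝ≥0 → StrongDual ℝ F → Ω →ₘ[P] ℝ) : Prop where
  linear : ∀ t, IsLinearMap ℝ (L t)
  continuous : ∀ t f, TendstoInMeasure P (fun h => (L t h : Ω → ℝ)) (𝓝 f) (L t f)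
  levy : ∀ (n : ℕ) (f : Fin n → StrongDual ℝ F), IsLevyProcess (fun t ω i => L t (f i) ω) P

/-- The cylinder set `{g | (⟨g, f₁⟩, …, ⟨g, fₙ⟩) ∈ B}`. -/
def cylinder {n : ℕ} (f : Fin n → StrongDual ℝ F) (B : Set (Fin n → ℝ)) : Set F :=
  {g | (fun i => f i g) ∈ B}

variable (F) in
/-- The cylinder sets with Borel base in `ℝⁿ \ {0}`. -/
def cylinderSets : Set (Set F) :=
  {C | ∃ (n : ℕ) (f : Fin n → StrongDual ℝ F) (B : Set (Fin n → ℝ)),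
    MeasurableSet B ∧ 0 ∉ B ∧ C = cylinder f B}

variable (F) in
/-- A finitely additive `[0, ∞]`-valued measure on the cylinder sets whose images under
finite-dimensional projections are (countably additive) measures on `ℝⁿ \ {0}`. -/
structure CylindricalMeasure where
  content : AddContent ℝ≥0∞ (cylinderSets F)
  iUnion_eq : ∀ (n : ℕ) (f : Fin n → StrongDual ℝ F) (B : ℕ → Set (Fin n → ℝ)),
    (∀ k, MeasurableSet (B k)) → (∀ k, 0 ∉ B k) → Pairwise (Function.onFun Disjoint B) →
    content (cylinder f (⋃ k, B k)) = ∑' k, content (cylinder f (B k))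

/-- The image `μ ∘ ⟨·, f⟩⁻¹` on `ℝ \ {0}`, as a measure on `ℝ` without mass at `0`. -/
def CylindricalMeasure.proj (μ : CylindricalMeasure F) (f : StrongDual ℝ F) : Measure ℝ :=
  Measure.ofMeasurable (fun B _ => μ.content {g | f g ∈ B \ {0}})
    (by simp)
    (by
      intro B hB hd
      have key : ∀ C : Set ℝ, {g : F | f g ∈ C \ {0}}
          = cylinder (fun _ : Fin 1 => f) ((fun v : Fin 1 → ℝ => v 0) ⁻¹' (C \ {0})) :=
        fun C => rfl
      have h := μ.iUnion_eq 1 (fun _ => f)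
        (fun k => (fun v : Fin 1 → ℝ => v 0) ⁻¹' (B k \ {0}))
        (fun k => (measurable_pi_apply 0) ((hB k).diff (measurableSet_singleton 0)))
        (fun k => by simp)
        (fun i j hij => by
          refine Disjoint.preimage _ ?_
          exact (hd hij).mono sdiff_subset sdiff_subset)
      simp only [key]
      rw [← h, iUnion_sdiff, preimage_iUnion])

/-- `(a, Q, μ)` are the cylindrical characteristics of `L`: the real Lévy process `L(·)f` has the
Lévy triplet `(a(f), ⟨Qf, f⟩, μ ∘ ⟨·, f⟩⁻¹)` for each `f`. Because of the jump of the truncation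
function at `|y| = 1`, continuity of `a` is required at those `f` for which `μ ∘ ⟨·, f⟩⁻¹` does
not charge `{-1, 1}`. -/
structure IsCylindricalCharacteristics {P : Measure Ω} (L : ℝ≥0 → StrongDual ℝ F → Ω →ₘ[P] ℝ)
    (a : StrongDual ℝ F → ℝ) (Q : StrongDual ℝ F →L[ℝ] StrongDual ℝ (StrongDual ℝ F))
    (μ : CylindricalMeasure F) : Prop where
  a_zero : a 0 = 0
  a_continuousAt : ∀ f, μ.proj f {-1, 1} = 0 → ContinuousAt a f
  symmetric : ∀ f h, Q f h = Q h f
  nonneg : ∀ f, 0 ≤ Q f f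
  levyMeasure : ∀ f, IsLevyMeasure (μ.proj f)
  charFun_eq : ∀ (t : ℝ≥0) (f : StrongDual ℝ F) (u : ℝ), charFun (P.map (L t f)) u
    = Complex.exp ((t : ℝ) * levySymbol (a f) (Q f f) (μ.proj f) u)

end Cylindrical

end CylLevy

end

open MeasureTheory ProbabilityTheory Filter Set
open scoped NNReal ENNReal Topology

noncomputable section

namespace CylLevy

/-! ### Lévy triplets and their scaling -/

-- Over the control measure λ all characteristics have densities, so near x the random measure M
-- looks like an infinitesimal Lévy variable with a local triplet (dγ/dλ, dΣ/dλ, ρ(x, ·)) and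
-- exponent ψ_x (`exists_isDisintegration`, `isLocalTriplet_density`). Independence over disjoint
-- sets and the Lévy property in time show that, for simple f, the integral of f over A at time t
-- has the exponent u ↦ t ∫_A ψ_x(u f(x)) λ(dx) (`IsDriven.charFun_integral`).
--
-- The estimates rest on one quantity, `tripletSize`: absolute drift plus variance plus ∫ 1 ∧ (v y)²
-- for v times the local variable. It bounds the exponent, |ψ_x(u v)| ≤ 2 (1 + u²) size(v). It is
-- monotone in |v| up to a constant, because rescaling alters the drift by at most a multiple of the
-- jump term. It is dominated by Φ_M. A quadratic bound on an exponent gives a tail bound, so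
-- integrals whose λ-integrated sizes tend to 0 tend to 0 in probability. This yields the integral
-- by dominated convergence along simple sₙ with |sₙ| ≤ 2|f|, and the continuity of f ↦ L(t)f.
-- Arbitrary admissible sequences need not be dominated; independence of the sequence comes from a
-- gliding hump argument that uses convergence over every measurable set
-- (`eq_zero_of_isApprox_zero`). Independence and equality in law survive limits in probability, so
-- L inherits the Lévy property.
--
-- By Fubini the exponent of L(t)f is t times a Lévy–Khintchine exponent with drift ∫ U(f(x), x)
-- λ(dx), variance ∫ f² dΣ and the image of ν under (x, y) ↦ f(x) y off 0 as Lévy measure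
-- (`integral_levySymbol_mul`). Uniqueness of triplets (`levySymbol_injective`) forces these
-- formulas on any cylindrical characteristics.
--
-- Existence of the characteristics needs two more ideas. The cylindrical measure should be the
-- image of ν under (x, y) ↦ y δ_x. Point evaluations need not lie in F, but linear relations among
-- finitely many functionals persist almost everywhere among the corresponding functions, so on
-- finitely many functionals δ_x agrees for almost every x with an element of F
-- (`exists_forall_apply_eq`). Continuity of the drift holds since y ↦ y 1_B(y) is additive up to a
-- defect that is small unless the perturbation is large or f(x) y is near ±1
-- (`continuousAt_drift`).

lemma measurable_ballInd : Measurable ballInd :=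
  Measurable.ite (measurableSet_le (by fun_prop) (by fun_prop)) measurable_const measurable_const

lemma ballInd_of_le {y : ℝ} (h : |y| ≤ 1) : ballInd y = 1 := if_pos h

lemma ballInd_of_lt {y : ℝ} (h : 1 < |y|) : ballInd y = 0 := if_neg (not_le.2 h)

lemma ballInd_neg (y : ℝ) : ballInd (-y) = ballInd y := by simp [ballInd]

lemma min_one_sq_nonneg (y : ℝ) : 0 ≤ min 1 (y ^ 2) := le_min zero_le_one (sq_nonneg y)

lemma min_one_sq_of_le {y : ℝ} (h : |y| ≤ 1) : min 1 (y ^ 2) = y ^ 2 :=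
  min_eq_right ((sq_le_one_iff_abs_le_one y).2 h)

lemma min_one_sq_of_lt {y : ℝ} (h : 1 < |y|) : min 1 (y ^ 2) = 1 :=
  min_eq_left ((one_lt_sq_iff_one_lt_abs y).2 h).le

lemma min_one_sq_mul_le (c y : ℝ) : min 1 ((c * y) ^ 2) ≤ (1 + c ^ 2) * min 1 (y ^ 2) := by
  rcases le_or_gt |y| 1 with h | h
  · rw [min_one_sq_of_le h]
    refine (min_le_right _ _).trans ?_
    nlinarith [sq_nonneg y]
  · rw [min_one_sq_of_lt h]
    refine (min_le_left _ _).trans ?_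
    nlinarith [sq_nonneg c]

/-- The change of the truncated linear term under scaling. -/
lemma abs_mul_ballInd_sub_le (c y : ℝ) :
    |c * y * (ballInd (c * y) - ballInd y)| ≤ (1 + c ^ 2) * min 1 (y ^ 2) := by
  rcases le_or_gt |y| 1 with h | h <;> rcases le_or_gt |c * y| 1 with h' | h'
  · rw [ballInd_of_le h, ballInd_of_le h', sub_self, mul_zero, abs_zero]
    have := min_one_sq_nonneg y
    positivity
  · rw [ballInd_of_le h, ballInd_of_lt h', min_one_sq_of_le h]
    rw [zero_sub, mul_neg, mul_one, abs_neg]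
    nlinarith [sq_abs (c * y), sq_nonneg y]
  · rw [ballInd_of_le h', ballInd_of_lt h, min_one_sq_of_lt h, sub_zero, mul_one, mul_one]
    nlinarith [sq_nonneg c]
  · rw [ballInd_of_lt h, ballInd_of_lt h', sub_self, mul_zero, abs_zero]
    have := min_one_sq_nonneg y
    positivity

/-- The integrand of the Lévy–Khintchine formula. -/
def lkIntegrand (u y : ℝ) : ℂ :=
  Complex.exp (Complex.I * u * y) - 1 - Complex.I * u * y * (ballInd y : ℂ)

lemma measurable_lkIntegrand (u : ℝ) : Measurable (lkIntegrand u) := by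
  have := measurable_ballInd
  unfold lkIntegrand
  fun_prop

@[simp] lemma lkIntegrand_zero (u : ℝ) : lkIntegrand u 0 = 0 := by simp [lkIntegrand]

lemma norm_exp_I_mul (u y : ℝ) : ‖Complex.exp (Complex.I * u * y)‖ = 1 := by
  have : Complex.I * u * y = ((u * y : ℝ) : ℂ) * Complex.I := by push_cast; ring
  rw [this, Complex.norm_exp_ofReal_mul_I]

/-- For |y| ≤ 1 the bound is second order Taylor when |u y| ≤ 1, and otherwise |u y| ≤ (u y)². For
|y| > 1 nothing is compensated and the integrand is at most 2. The growth is only quadratic in u,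
which the tail bounds need. -/
lemma norm_lkIntegrand_le (u y : ℝ) :
    ‖lkIntegrand u y‖ ≤ 2 * (1 + u ^ 2) * min 1 (y ^ 2) := by
  have hn : ‖Complex.I * u * y‖ = |u * y| := by simp [abs_mul]
  have h2 : ‖Complex.exp (Complex.I * u * y) - 1‖ ≤ 2 := by
    refine (norm_sub_le _ _).trans ?_
    rw [norm_exp_I_mul]; norm_num
  have h1 : ‖Complex.exp (Complex.I * u * y) - 1‖ ≤ |u * y| := by
    have := Real.norm_exp_I_mul_ofReal_sub_one_le (x := u * y)
    push_cast at this
    simpa [mul_assoc] using this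
  rcases le_or_gt |y| 1 with h | h
  · rw [lkIntegrand, ballInd_of_le h, min_one_sq_of_le h, Complex.ofReal_one, mul_one]
    rcases le_or_gt |u * y| 1 with h' | h'
    · refine (Complex.norm_exp_sub_one_sub_id_le (hn.le.trans h')).trans ?_
      rw [hn, sq_abs]
      nlinarith [sq_nonneg (u * y), sq_nonneg y]
    · refine (norm_sub_le _ _).trans ?_
      rw [hn]
      nlinarith [sq_abs (u * y), sq_nonneg y]
  · rw [lkIntegrand, ballInd_of_lt h, min_one_sq_of_lt h, Complex.ofReal_zero, mul_zero, sub_zero]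
    nlinarith [sq_nonneg u]

lemma continuous_lkIntegrand (y : ℝ) : Continuous fun u => lkIntegrand u y := by
  unfold lkIntegrand
  fun_prop

section Triplet

variable {m : Measure ℝ}

lemma integrable_min_one_sq_mul (hm : Integrable (fun y : ℝ => min 1 (y ^ 2)) m)
    (c : ℝ) :
    Integrable (fun y : ℝ => min 1 ((c * y) ^ 2)) m := by
  refine (hm.const_mul (1 + c ^ 2)).mono' (by fun_prop) (ae_of_all _ fun y => ?_)
  rw [Real.norm_of_nonneg (min_one_sq_nonneg _)]
  exact min_one_sq_mul_le c y

lemma integrable_mul_ballInd_sub (hm : Integrable (fun y : ℝ => min 1 (y ^ 2)) m)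
    (c v : ℝ) :
    Integrable (fun y : ℝ => c * (v * y) * (ballInd (c * (v * y)) - ballInd (v * y))) m := by
  have := measurable_ballInd
  refine ((integrable_min_one_sq_mul hm v).const_mul (1 + c ^ 2)).mono' (by fun_prop)
    (ae_of_all _ fun y => abs_mul_ballInd_sub_le c (v * y))

lemma integrable_lkIntegrand (hm : Integrable (fun y : ℝ => min 1 (y ^ 2)) m)
    (u v : ℝ) : Integrable (fun y : ℝ => lkIntegrand u (v * y)) m := by
  refine ((integrable_min_one_sq_mul hm v).const_mul (2 * (1 + u ^ 2))).mono'
    ((measurable_lkIntegrand u).comp (by fun_prop)).aestronglyMeasurable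
    (ae_of_all _ fun y => norm_lkIntegrand_le u (v * y))

lemma levySymbol_eq (b q : ℝ) (m : Measure ℝ) (u : ℝ) : levySymbol b q m u
    = Complex.I * u * b - (u : ℂ) ^ 2 * q / 2 + ∫ y, lkIntegrand u y ∂m := rfl

lemma levySymbol_zero (b q : ℝ) (m : Measure ℝ) : levySymbol b q m 0 = 0 := by simp [levySymbol]

/-- The drift of `v Z` for `Z` with drift `b` and Lévy measure `m`. -/
def scaledDrift (b : ℝ) (m : Measure ℝ) (v : ℝ) : ℝ :=
  v * b + v * ∫ y, y * (ballInd (v * y) - ballInd y) ∂m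

lemma scaledDrift_eq (b : ℝ) (m : Measure ℝ) (v : ℝ) :
    scaledDrift b m v = v * b + ∫ y, v * y * (ballInd (v * y) - ballInd y) ∂m := by
  simp only [scaledDrift, ← integral_const_mul, mul_assoc]

@[simp] lemma scaledDrift_zero (b : ℝ) (m : Measure ℝ) : scaledDrift b m 0 = 0 := by
  simp [scaledDrift]

lemma scaledDrift_neg (b : ℝ) (m : Measure ℝ) (v : ℝ) :
    scaledDrift b m (-v) = -scaledDrift b m v := by
  simp only [scaledDrift, neg_mul, ballInd_neg]
  ring

/-- The truncation correction is a cocycle: the change of indicator from y to c v y is the change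
from y to v y plus that from v y to c v y. -/
lemma scaledDrift_mul (hm : Integrable (fun y : ℝ => min 1 (y ^ 2)) m)
    (b c v : ℝ) : scaledDrift b m (c * v) = c * scaledDrift b m v
    + ∫ y, c * (v * y) * (ballInd (c * (v * y)) - ballInd (v * y)) ∂m := by
  have h1 := (integrable_mul_ballInd_sub hm v 1).const_mul c
  simp only [one_mul] at h1
  rw [scaledDrift_eq, scaledDrift_eq, mul_add, add_assoc, ← integral_const_mul,
    ← integral_add h1 (integrable_mul_ballInd_sub hm c v), mul_assoc]
  congr 2 with y
  rw [mul_assoc c v y]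
  ring

/-- The absolute drift alone need not be monotone in |v|; adding the jump term repairs this up to a
constant. -/
lemma abs_scaledDrift_mul_le (hm : Integrable (fun y : ℝ => min 1 (y ^ 2)) m)
    (b c v : ℝ) : |scaledDrift b m (c * v)|
    ≤ |c| * |scaledDrift b m v| + (1 + c ^ 2) * ∫ y, min 1 ((v * y) ^ 2) ∂m := by
  rw [scaledDrift_mul hm, ← abs_mul]
  refine (abs_add_le _ _).trans (add_le_add_right ?_ _)
  rw [← integral_const_mul]
  exact norm_integral_le_of_norm_le ((integrable_min_one_sq_mul hm v).const_mul _)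
    (ae_of_all _ fun y => (Real.norm_eq_abs _).trans_le (abs_mul_ballInd_sub_le c (v * y)))

/-- Multiplication by v replaces the truncation at |y| ≤ 1 by one at |v y| ≤ 1; the difference is
linear in u and is absorbed by the drift. -/
lemma levySymbol_mul (hm : Integrable (fun y : ℝ => min 1 (y ^ 2)) m)
    (b q u v : ℝ) : levySymbol b q m (u * v)
    = Complex.I * u * scaledDrift b m v - (u : ℂ) ^ 2 * (v ^ 2 * q : ℝ) / 2
      + ∫ y, lkIntegrand u (v * y) ∂m := by
  have h1 : Integrable (fun y => ((v * y * (ballInd (v * y) - ballInd y) : ℝ) : ℂ)) m := by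
    have := integrable_mul_ballInd_sub hm v 1
    simp only [one_mul] at this
    exact this.ofReal
  have h2 : ∫ y, lkIntegrand (u * v) y ∂m
      = Complex.I * u * (∫ y, v * y * (ballInd (v * y) - ballInd y) ∂m : ℝ)
        + ∫ y, lkIntegrand u (v * y) ∂m := by
    rw [← integral_complex_ofReal, ← integral_const_mul,
      ← integral_add (h1.const_mul _) (integrable_lkIntegrand hm u v)]
    congr 1 with y
    simp only [lkIntegrand]
    push_cast
    ring_nf
  rw [levySymbol_eq, h2, scaledDrift_eq]
  push_cast
  ring

/-- The size of the triplet of `v Z`, for `Z` with triplet `(b, q, m)`. -/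
def tripletSize (b q : ℝ) (m : Measure ℝ) (v : ℝ) : ℝ :=
  |scaledDrift b m v| + v ^ 2 * q + ∫ y, min 1 ((v * y) ^ 2) ∂m

lemma integral_min_nonneg (m : Measure ℝ) (v : ℝ) : 0 ≤ ∫ y, min 1 ((v * y) ^ 2) ∂m :=
  integral_nonneg fun _ => min_one_sq_nonneg _

lemma tripletSize_nonneg (b : ℝ) {q : ℝ} (hq : 0 ≤ q) (m : Measure ℝ) (v : ℝ) :
    0 ≤ tripletSize b q m v := by
  have := integral_min_nonneg m v
  unfold tripletSize
  positivity

@[simp] lemma tripletSize_zero (b q : ℝ) (m : Measure ℝ) : tripletSize b q m 0 = 0 := by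
  simp [tripletSize]

lemma tripletSize_neg (b q : ℝ) (m : Measure ℝ) (v : ℝ) :
    tripletSize b q m (-v) = tripletSize b q m v := by
  simp [tripletSize, scaledDrift_neg]

lemma tripletSize_abs (b q : ℝ) (m : Measure ℝ) (v : ℝ) :
    tripletSize b q m |v| = tripletSize b q m v := by
  rcases abs_choice v with h | h <;> rw [h]
  exact tripletSize_neg b q m v

/-- The jump term at v is counted twice with weight 1 + c², once for itself and once for the change
of drift; hence the factor 2. -/
lemma tripletSize_mul_le (hm : Integrable (fun y : ℝ => min 1 (y ^ 2)) m)
    (b : ℝ) {q : ℝ} (hq : 0 ≤ q) (c v : ℝ) :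
    tripletSize b q m (c * v) ≤ 2 * (1 + c ^ 2) * tripletSize b q m v := by
  have h1 := abs_scaledDrift_mul_le hm b c v
  have h2 : ∫ y, min 1 ((c * v * y) ^ 2) ∂m ≤ (1 + c ^ 2) * ∫ y, min 1 ((v * y) ^ 2) ∂m := by
    rw [← integral_const_mul]
    refine integral_mono (integrable_min_one_sq_mul hm _)
      ((integrable_min_one_sq_mul hm v).const_mul _) fun y => ?_
    simp only
    rw [mul_assoc]
    exact min_one_sq_mul_le c (v * y)
  have h3 : |c| ≤ 2 * (1 + c ^ 2) := by nlinarith [sq_abs c, sq_nonneg (|c| - 1)]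
  have h4 := mul_le_mul_of_nonneg_right h3 (abs_nonneg (scaledDrift b m v))
  have h5 : 0 ≤ v ^ 2 * q := by positivity
  have h6 : (c * v) ^ 2 * q ≤ 2 * (1 + c ^ 2) * (v ^ 2 * q) := by nlinarith [sq_nonneg c]
  unfold tripletSize
  linarith

/-- This quasi-monotonicity turns |sₙ| ≤ C|f| into an integrable majorant for the sizes. -/
lemma tripletSize_le_of_abs_le (hm : Integrable (fun y : ℝ => min 1 (y ^ 2)) m)
    (b : ℝ) {q : ℝ} (hq : 0 ≤ q) {C v w : ℝ} (h : |v| ≤ C * |w|) :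
    tripletSize b q m v ≤ 2 * (1 + C ^ 2) * tripletSize b q m w := by
  have h0 := tripletSize_nonneg b hq m w
  rcases eq_or_ne w 0 with rfl | hw
  · have : v = 0 := by simpa using h
    subst this
    simp
  · have hw' : 0 < |w| := abs_pos.2 hw
    have hc : |v / w| ≤ C := by rwa [abs_div, div_le_iff₀ hw']
    have := tripletSize_mul_le hm b hq (v / w) w
    rw [div_mul_cancel₀ _ hw] at this
    refine this.trans (mul_le_mul_of_nonneg_right ?_ h0)
    have : (v / w) ^ 2 ≤ C ^ 2 := by
      rw [← sq_abs]
      exact pow_le_pow_left₀ (abs_nonneg _) hc 2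
    linarith

/-- Each part of the exponent is controlled by the matching part of the size; |u|, u² / 2 and the
jump constant are all at most 2 (1 + u²). -/
lemma norm_levySymbol_mul_le (hm : Integrable (fun y : ℝ => min 1 (y ^ 2)) m)
    (b : ℝ) {q : ℝ} (hq : 0 ≤ q) (u v : ℝ) :
    ‖levySymbol b q m (u * v)‖ ≤ 2 * (1 + u ^ 2) * tripletSize b q m v := by
  rw [levySymbol_mul hm]
  have h1 : ‖Complex.I * u * scaledDrift b m v‖ = |u| * |scaledDrift b m v| := by simp
  have h2 : ‖(u : ℂ) ^ 2 * (v ^ 2 * q : ℝ) / 2‖ = u ^ 2 * (v ^ 2 * q) / 2 := by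
    rw [norm_div, norm_mul, norm_pow, Complex.norm_real, Complex.norm_real, Real.norm_eq_abs,
      Real.norm_eq_abs, sq_abs, abs_of_nonneg (show 0 ≤ v ^ 2 * q by positivity)]
    norm_num
  have h3 : ‖∫ y, lkIntegrand u (v * y) ∂m‖
      ≤ 2 * (1 + u ^ 2) * ∫ y, min 1 ((v * y) ^ 2) ∂m := by
    rw [← integral_const_mul]
    exact norm_integral_le_of_norm_le ((integrable_min_one_sq_mul hm v).const_mul _)
      (ae_of_all _ fun y => norm_lkIntegrand_le u (v * y))
  refine (norm_add_le _ _).trans ((add_le_add (norm_sub_le _ _) h3).trans ?_)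
  rw [h1, h2]
  have h3 : |u| ≤ 2 * (1 + u ^ 2) := by nlinarith [sq_abs u, sq_nonneg (|u| - 1)]
  have h4 := mul_le_mul_of_nonneg_right h3 (abs_nonneg (scaledDrift b m v))
  have h5 : 0 ≤ v ^ 2 * q := by positivity
  have h6 : u ^ 2 * (v ^ 2 * q) / 2 ≤ 2 * (1 + u ^ 2) * (v ^ 2 * q) := by nlinarith [sq_nonneg u]
  unfold tripletSize
  linarith

lemma scaledDrift_one (b : ℝ) (m : Measure ℝ) : scaledDrift b m 1 = b := by simp [scaledDrift]

lemma tripletSize_one (b q : ℝ) (m : Measure ℝ) :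
    tripletSize b q m 1 = |b| + q + ∫ y, min 1 (y ^ 2) ∂m := by
  simp [tripletSize, scaledDrift_one]

lemma continuous_levySymbol (hm : Integrable (fun y : ℝ => min 1 (y ^ 2)) m)
    (b q : ℝ) : Continuous (levySymbol b q m) := by
  unfold levySymbol
  refine Continuous.add (by fun_prop) (continuous_iff_continuousAt.2 fun u₀ => ?_)
  refine continuousAt_of_dominated (bound := fun y => 2 * (1 + (|u₀| + 1) ^ 2) * min 1 (y ^ 2))
    (Eventually.of_forall fun u => (measurable_lkIntegrand u).aestronglyMeasurable) ?_
    (hm.const_mul _) (ae_of_all _ fun y => (continuous_lkIntegrand y).continuousAt)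
  filter_upwards [Metric.ball_mem_nhds u₀ one_pos] with u hu
  refine ae_of_all _ fun y => (norm_lkIntegrand_le u y).trans ?_
  refine mul_le_mul_of_nonneg_right ?_ (min_one_sq_nonneg y)
  have h1 : |u| ≤ |u₀| + 1 := by
    rw [Metric.mem_ball, Real.dist_eq] at hu
    have := abs_sub_abs_le_abs_sub u u₀
    linarith
  have h2 : u ^ 2 ≤ (|u₀| + 1) ^ 2 := by
    rw [← sq_abs]
    exact pow_le_pow_left₀ (abs_nonneg _) h1 2
  linarith

lemma tendsto_tripletSize_zero (hm : Integrable (fun y : ℝ => min 1 (y ^ 2)) m)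
    (b q : ℝ) : Tendsto (tripletSize b q m) (𝓝 0) (𝓝 0) := by
  have hb := measurable_ballInd
  have hv : ∀ᶠ v : ℝ in 𝓝 0, |v| ≤ 1 := by
    filter_upwards [Metric.ball_mem_nhds (0 : ℝ) one_pos] with v hv
    rw [Metric.mem_ball, Real.dist_eq, sub_zero] at hv
    exact hv.le
  have h1 : Tendsto (fun v => ∫ y, min 1 ((v * y) ^ 2) ∂m) (𝓝 0) (𝓝 0) := by
    have : (0 : ℝ) = ∫ y, min 1 (((0 : ℝ) * y) ^ 2) ∂m := by simp
    nth_rw 2 [this]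
    refine tendsto_integral_filter_of_dominated_convergence (fun y => (1 + 1 ^ 2) * min 1 (y ^ 2))
      (Eventually.of_forall fun v => by fun_prop) ?_ (hm.const_mul _) (ae_of_all _ fun y => ?_)
    · filter_upwards [hv] with v hv
      refine ae_of_all _ fun y => ?_
      rw [Real.norm_of_nonneg (min_one_sq_nonneg _)]
      refine (min_one_sq_mul_le v y).trans (mul_le_mul_of_nonneg_right ?_ (min_one_sq_nonneg y))
      have := (sq_le_one_iff_abs_le_one v).2 hv
      linarith
    · exact (by fun_prop : Continuous fun v : ℝ => min 1 ((v * y) ^ 2)).tendsto 0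
  have h2 : Tendsto (fun v => ∫ y, v * y * (ballInd (v * y) - ballInd y) ∂m) (𝓝 0) (𝓝 0) := by
    have : (0 : ℝ) = ∫ y, (0 : ℝ) ∂m := by simp
    nth_rw 2 [this]
    refine tendsto_integral_filter_of_dominated_convergence (fun y => (1 + 1 ^ 2) * min 1 (y ^ 2))
      (Eventually.of_forall fun v => by fun_prop) ?_ (hm.const_mul _) (ae_of_all _ fun y => ?_)
    · filter_upwards [hv] with v hv
      refine ae_of_all _ fun y => (abs_mul_ballInd_sub_le v y).trans
        (mul_le_mul_of_nonneg_right ?_ (min_one_sq_nonneg y))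
      have := (sq_le_one_iff_abs_le_one v).2 hv
      linarith
    -- The discontinuity of the indicator does no harm, since the factor v y tends to 0 and the
    -- indicators are bounded.
    · have h3 : Tendsto (fun v : ℝ => 2 * |v * y|) (𝓝 0) (𝓝 0) := by
        have : Continuous fun v : ℝ => 2 * |v * y| := by fun_prop
        simpa using this.tendsto 0
      refine squeeze_zero_norm (fun v => ?_) h3
      rw [norm_mul, Real.norm_eq_abs, Real.norm_eq_abs, mul_comm]
      refine mul_le_mul_of_nonneg_right ?_ (abs_nonneg _)
      simp only [ballInd]
      split_ifs <;> norm_num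
  have h3 : Tendsto (fun v => |scaledDrift b m v|) (𝓝 0) (𝓝 0) := by
    simp only [scaledDrift_eq]
    have h4 : Tendsto (fun v : ℝ => v * b) (𝓝 0) (𝓝 0) := by
      have : Continuous fun v : ℝ => v * b := by fun_prop
      simpa using this.tendsto 0
    simpa using (h4.add h2).abs
  have h4 : Tendsto (fun v : ℝ => v ^ 2 * q) (𝓝 0) (𝓝 0) := by
    have : Continuous fun v : ℝ => v ^ 2 * q := by fun_prop
    simpa using this.tendsto 0
  have h5 := (h3.add h4).add h1
  rw [add_zero, add_zero] at h5
  exact h5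

end Triplet

/-! ### Uniqueness of Lévy triplets -/

lemma IsLevyMeasure.integrable {m : Measure ℝ} (hm : IsLevyMeasure m) :
    Integrable (fun y : ℝ => min 1 (y ^ 2)) m :=
  ⟨by fun_prop, (hasFiniteIntegral_iff_ofReal (ae_of_all _ min_one_sq_nonneg)).2 hm.2⟩

/-- A weight comparable with `y² ∧ 1` near `0` which vanishes only at `0`. -/
def cosWeight (y : ℝ) : ℝ := (1 - Real.cos y) + (1 - Real.cos (Real.pi * y))

lemma measurable_cosWeight : Measurable cosWeight := by unfold cosWeight; fun_prop

lemma cosWeight_nonneg (y : ℝ) : 0 ≤ cosWeight y := by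
  have h1 := Real.cos_le_one y
  have h2 := Real.cos_le_one (Real.pi * y)
  unfold cosWeight
  linarith

lemma cosWeight_zero : cosWeight 0 = 0 := by simp [cosWeight]

/-- Both cosines equal 1, so y is an integer multiple of 2π and of 2; for y ≠ 0 this would make π
rational. -/
lemma eq_zero_of_cosWeight_eq_zero {y : ℝ} (h : cosWeight y = 0) : y = 0 := by
  have h1 := Real.cos_le_one y
  have h2 := Real.cos_le_one (Real.pi * y)
  unfold cosWeight at h
  obtain ⟨k, hk⟩ := (Real.cos_eq_one_iff y).1 (by linarith)
  obtain ⟨l, hl⟩ := (Real.cos_eq_one_iff (Real.pi * y)).1 (by linarith)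
  have hpi := Real.pi_pos
  have hy : y = 2 * l := by
    apply mul_left_cancel₀ hpi.ne'
    linarith
  by_contra hne
  have hk0 : (k : ℝ) ≠ 0 := by
    rintro h0
    rw [h0, zero_mul] at hk
    exact hne hk.symm
  refine irrational_pi ⟨(l : ℚ) / k, ?_⟩
  push_cast
  rw [div_eq_iff hk0]
  linarith

lemma one_sub_cos_le (c y : ℝ) : 1 - Real.cos (c * y) ≤ 2 * (1 + c ^ 2) * min 1 (y ^ 2) := by
  have h1 := Real.one_sub_sq_div_two_le_cos (x := c * y)
  have h2 := Real.neg_one_le_cos (c * y)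
  rcases le_or_gt |y| 1 with h | h
  · rw [min_one_sq_of_le h]
    nlinarith [sq_nonneg y, sq_nonneg (c * y)]
  · rw [min_one_sq_of_lt h]
    nlinarith [sq_nonneg c]

lemma integrable_one_sub_cos {m : Measure ℝ} (hm : Integrable (fun y : ℝ => min 1 (y ^ 2)) m)
    (c : ℝ) : Integrable (fun y => 1 - Real.cos (c * y)) m := by
  refine (hm.const_mul (2 * (1 + c ^ 2))).mono' (by fun_prop) (ae_of_all _ fun y => ?_)
  rw [Real.norm_of_nonneg (sub_nonneg.2 (Real.cos_le_one _))]
  exact one_sub_cos_le c y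

lemma integrable_cosWeight {m : Measure ℝ} (hm : Integrable (fun y : ℝ => min 1 (y ^ 2)) m) :
    Integrable cosWeight m := by
  simpa [cosWeight] using! (integrable_one_sub_cos hm 1).add (integrable_one_sub_cos hm Real.pi)

/-- A second difference in u kills the drift, reduces the Gaussian part to a constant, and leaves
the Fourier transform of the measure (1 - cos(h y)) m(dy). -/
lemma levySymbol_second_difference {m : Measure ℝ}
    (hm : Integrable (fun y : ℝ => min 1 (y ^ 2)) m) (b q u h : ℝ) :
    levySymbol b q m u - (levySymbol b q m (u + h) + levySymbol b q m (u - h)) / 2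
      = (h ^ 2 * q / 2 : ℝ) + ∫ y, Complex.exp (Complex.I * u * y) * (1 - Real.cos (h * y) : ℝ) ∂m := by
  have hi : ∀ u, Integrable (lkIntegrand u) m := fun u => by
    simpa using integrable_lkIntegrand hm u 1
  have key : ∀ y : ℝ, Complex.exp (Complex.I * u * y) * (1 - Real.cos (h * y) : ℝ)
      = lkIntegrand u y - (lkIntegrand (u + h) y + lkIntegrand (u - h) y) / 2 := by
    intro y
    have e1 : Complex.exp (Complex.I * (u + h : ℝ) * y)
        = Complex.exp (Complex.I * u * y) * Complex.exp (h * y * Complex.I) := by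
      rw [← Complex.exp_add]; congr 1; push_cast; ring
    have e2 : Complex.exp (Complex.I * (u - h : ℝ) * y)
        = Complex.exp (Complex.I * u * y) * Complex.exp (-(h * y) * Complex.I) := by
      rw [← Complex.exp_add]; congr 1; push_cast; ring
    simp only [lkIntegrand]
    rw [e1, e2]
    push_cast
    rw [Complex.cos]
    ring
  have hint : ∫ y, Complex.exp (Complex.I * u * y) * (1 - Real.cos (h * y) : ℝ) ∂m
      = ∫ y, lkIntegrand u y ∂m
        - (∫ y, lkIntegrand (u + h) y ∂m + ∫ y, lkIntegrand (u - h) y ∂m) / 2 := by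
    have h1 := integral_sub (hi u) (((hi (u + h)).add (hi (u - h))).div_const 2)
    simp only [Pi.add_apply] at h1
    simp only [key]
    rw [h1, integral_div, integral_add (hi _) (hi _)]
  rw [hint]
  simp only [levySymbol_eq]
  push_cast
  ring

/-- The finite measure which encodes a Lévy triplet up to its drift. -/
def tripletMeasure (q : ℝ) (m : Measure ℝ) : Measure ℝ :=
  ENNReal.ofReal ((1 + Real.pi ^ 2) * q / 2) • Measure.dirac 0
    + m.withDensity fun y => ENNReal.ofReal (cosWeight y)

lemma isFiniteMeasure_withDensity_cosWeight {m : Measure ℝ}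
    (hm : Integrable (fun y : ℝ => min 1 (y ^ 2)) m) :
    IsFiniteMeasure (m.withDensity fun y => ENNReal.ofReal (cosWeight y)) :=
  isFiniteMeasure_withDensity_ofReal (integrable_cosWeight hm).2

/-- Add the second differences with steps 1 and π. One step would not do, as 1 - cos(h y) has zeros
y ≠ 0. The Gaussian constants add up to the mass at 0. -/
lemma charFun_tripletMeasure {m : Measure ℝ} (hm : Integrable (fun y : ℝ => min 1 (y ^ 2)) m)
    (b : ℝ) {q : ℝ} (hq : 0 ≤ q) (u : ℝ) : charFun (tripletMeasure q m) u
      = 2 * levySymbol b q m u - (levySymbol b q m (u + 1) + levySymbol b q m (u - 1)) / 2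
        - (levySymbol b q m (u + Real.pi) + levySymbol b q m (u - Real.pi)) / 2 := by
  have := isFiniteMeasure_withDensity_cosWeight hm
  have hexp : Continuous fun y : ℝ => Complex.exp (u * y * Complex.I) := by fun_prop
  have hb : ∀ (κ : Measure ℝ) [IsFiniteMeasure κ],
      Integrable (fun y : ℝ => Complex.exp (u * y * Complex.I)) κ := fun κ _ =>
    (integrable_const (1 : ℝ)).mono' hexp.aestronglyMeasurable (ae_of_all _ fun y => by
      have := Complex.norm_exp_ofReal_mul_I (u * y)
      push_cast at this
      exact this.le)
  have hfin : IsFiniteMeasure (ENNReal.ofReal ((1 + Real.pi ^ 2) * q / 2) • Measure.dirac (0 : ℝ)) :=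
    Measure.smul_finite _ ENNReal.ofReal_ne_top
  have hc : ∀ c : ℝ, Integrable
      (fun y : ℝ => Complex.exp (Complex.I * u * y) * (1 - Real.cos (c * y) : ℝ)) m := fun c =>
    (integrable_one_sub_cos hm c).mono' (by fun_prop) (ae_of_all _ fun y => by
      rw [norm_mul, norm_exp_I_mul, one_mul, Complex.norm_real,
        Real.norm_of_nonneg (sub_nonneg.2 (Real.cos_le_one _))])
  have h1 := levySymbol_second_difference hm b q u 1
  have h2 := levySymbol_second_difference hm b q u Real.pi
  have h3 : ∫ y, Complex.exp (u * y * Complex.I)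
        ∂(m.withDensity fun y => ENNReal.ofReal (cosWeight y))
      = ∫ y, Complex.exp (Complex.I * u * y) * (1 - Real.cos (1 * y) : ℝ) ∂m
        + ∫ y, Complex.exp (Complex.I * u * y) * (1 - Real.cos (Real.pi * y) : ℝ) ∂m := by
    rw [integral_withDensity_eq_integral_toReal_smul
      measurable_cosWeight.ennreal_ofReal (ae_of_all _ fun _ => ENNReal.ofReal_lt_top),
      ← integral_add (hc 1) (hc Real.pi)]
    congr 1 with y
    rw [ENNReal.toReal_ofReal (cosWeight_nonneg y), Complex.real_smul, cosWeight, one_mul]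
    push_cast
    ring_nf
  rw [charFun_apply_real, tripletMeasure, integral_add_measure (hb _) (hb _),
    integral_smul_measure, integral_dirac, h3,
    ENNReal.toReal_ofReal (by positivity)]
  have e : ((1 + Real.pi ^ 2) * q / 2) • Complex.exp (u * (0 : ℝ) * Complex.I)
      = ((1 ^ 2 * q / 2 : ℝ) : ℂ) + ((Real.pi ^ 2 * q / 2 : ℝ) : ℂ) := by
    simp
    ring
  rw [e]
  linear_combination -h1 - h2

/-- The triplet in the Lévy–Khintchine formula is unique. -/
theorem levySymbol_injective {b₁ b₂ q₁ q₂ : ℝ} {m₁ m₂ : Measure ℝ} (hq₁ : 0 ≤ q₁) (hq₂ : 0 ≤ q₂)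
    (hm₁ : IsLevyMeasure m₁) (hm₂ : IsLevyMeasure m₂)
    (h : ∀ u, levySymbol b₁ q₁ m₁ u = levySymbol b₂ q₂ m₂ u) :
    b₁ = b₂ ∧ q₁ = q₂ ∧ m₁ = m₂ := by
  have hf : ∀ {q : ℝ} {m : Measure ℝ}, IsLevyMeasure m → IsFiniteMeasure (tripletMeasure q m) := by
    intro q m hm
    have := isFiniteMeasure_withDensity_cosWeight hm.integrable
    have : IsFiniteMeasure
        (ENNReal.ofReal ((1 + Real.pi ^ 2) * q / 2) • Measure.dirac (0 : ℝ)) :=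
      Measure.smul_finite _ ENNReal.ofReal_ne_top
    unfold tripletMeasure
    infer_instance
  have hf₁ := hf (q := q₁) hm₁
  have hf₂ := hf (q := q₂) hm₂
  have heq : tripletMeasure q₁ m₁ = tripletMeasure q₂ m₂ := by
    refine Measure.ext_of_charFun (funext fun u => ?_)
    rw [charFun_tripletMeasure hm₁.integrable b₁ hq₁, charFun_tripletMeasure hm₂.integrable b₂ hq₂]
    simp only [h]
  have hzero : ∀ {q : ℝ} {m : Measure ℝ},
      tripletMeasure q m {0} = ENNReal.ofReal ((1 + Real.pi ^ 2) * q / 2) := by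
    intro q m
    rw [tripletMeasure, Measure.add_apply, withDensity_apply _ (measurableSet_singleton 0)]
    simp [cosWeight_zero]
  have hq : q₁ = q₂ := by
    have h0 := congrArg (fun κ : Measure ℝ => κ {0}) heq
    simp only [hzero] at h0
    rw [ENNReal.ofReal_eq_ofReal_iff (by positivity) (by positivity)] at h0
    have : (0 : ℝ) < 1 + Real.pi ^ 2 := by positivity
    have h1 := mul_left_cancel₀ this.ne' (show (1 + Real.pi ^ 2) * q₁ = (1 + Real.pi ^ 2) * q₂ by
      linarith)
    exact h1
  have hw : m₁.withDensity (fun y => ENNReal.ofReal (cosWeight y))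
      = m₂.withDensity fun y => ENNReal.ofReal (cosWeight y) := by
    unfold tripletMeasure at heq
    rw [hq] at heq
    have : IsFiniteMeasure (ENNReal.ofReal ((1 + Real.pi ^ 2) * q₂ / 2) • Measure.dirac (0 : ℝ)) :=
      Measure.smul_finite _ ENNReal.ofReal_ne_top
    ext s hs
    have hs' := congrArg (fun κ : Measure ℝ => κ s) heq
    simp only [Measure.add_apply] at hs'
    exact (ENNReal.add_right_inj (measure_ne_top _ s)).1 hs'
  -- The weight vanishes only at 0, which a Lévy measure does not charge, so the measure is
  -- recovered by dividing the weight out.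
  have hinv : ∀ {m : Measure ℝ}, IsLevyMeasure m →
      (m.withDensity fun y => ENNReal.ofReal (cosWeight y)).withDensity
        (fun y => ENNReal.ofReal (cosWeight y))⁻¹ = m := by
    intro m hm
    refine withDensity_inv_same measurable_cosWeight.ennreal_ofReal ?_
      (ae_of_all _ fun y => ENNReal.ofReal_ne_top)
    have h0 : ∀ᵐ y ∂m, y ≠ 0 := by
      rw [ae_iff]
      simpa using hm.1
    filter_upwards [h0] with y hy
    rw [Ne, ENNReal.ofReal_eq_zero, not_le]
    exact lt_of_le_of_ne (cosWeight_nonneg y) fun h => hy (eq_zero_of_cosWeight_eq_zero h.symm)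
  have hm : m₁ = m₂ := by rw [← hinv hm₁, ← hinv hm₂, hw]
  refine ⟨?_, hq, hm⟩
  -- With equal Gaussian and jump parts, the exponents at u = 1 differ only in the drift.
  have h1 := h 1
  simp only [levySymbol_eq, hq, hm] at h1
  have h2 : Complex.I * (1 : ℝ) * b₁ = Complex.I * (1 : ℝ) * b₂ := by linear_combination h1
  simpa using h2

/-! ### Disintegration of `ν` over the control measure -/

section Disintegration

/-- The weight `y² ∧ 1` with values in `[0, ∞]`. -/
def levyWeight (y : ℝ) : ℝ≥0∞ := ENNReal.ofReal (min 1 (y ^ 2))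

lemma measurable_levyWeight : Measurable levyWeight := by unfold levyWeight; fun_prop

lemma levyWeight_ne_top (y : ℝ) : levyWeight y ≠ ∞ := ENNReal.ofReal_ne_top

lemma levyWeight_ne_zero {y : ℝ} (hy : y ≠ 0) : levyWeight y ≠ 0 := by
  rw [levyWeight, Ne, ENNReal.ofReal_eq_zero, not_le]
  positivity

variable {X : Type*} [MeasurableSpace X]

/-- A measure without mass on `X × {0}` whose `y² ∧ 1`-marginal is dominated by `lam` can be
disintegrated over `lam`. -/
lemma exists_isDisintegration {ν : Measure (X × ℝ)} {lam : Measure X} [SFinite ν] [SigmaFinite lam]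
    (h0 : ν {z | z.2 = 0} = 0) (hle : (ν.withDensity fun z => levyWeight z.2).map Prod.fst ≤ lam) :
    ∃ ρ : Kernel X ℝ, IsDisintegration ν lam ρ := by
  have hw := measurable_levyWeight
  -- A strictly positive integrable g makes the weighted measure g(x) (y² ∧ 1) ν(dx, dy) finite, so
  -- that a conditional kernel exists; both weights are divided out afterwards.
  obtain ⟨g, hgpos, hg, hgint⟩ := exists_pos_lintegral_lt_of_sigmaFinite lam one_ne_zero
  have hg' : Measurable fun x => (g x : ℝ≥0∞) := by fun_prop
  set ν' : Measure (X × ℝ) := (ν.withDensity fun z => levyWeight z.2).withDensity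
    fun z => (g z.1 : ℝ≥0∞) with hν'
  have hfst : ν'.fst = ((ν.withDensity fun z => levyWeight z.2).map Prod.fst).withDensity
      fun x => (g x : ℝ≥0∞) := by
    ext s hs
    rw [Measure.fst_apply hs, hν', withDensity_apply _ (measurable_fst hs), withDensity_apply _ hs,
      setLIntegral_map hs hg' measurable_fst]
  have hfst_le : ν'.fst ≤ lam.withDensity fun x => (g x : ℝ≥0∞) := by
    rw [hfst]
    refine Measure.le_iff.2 fun s hs => ?_
    rw [withDensity_apply _ hs, withDensity_apply _ hs]
    exact lintegral_mono' (Measure.restrict_mono le_rfl hle) le_rfl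
  have hfin : IsFiniteMeasure ν' := by
    refine ⟨?_⟩
    rw [← Measure.fst_univ]
    refine (hfst_le univ).trans_lt ?_
    rw [withDensity_apply _ MeasurableSet.univ, Measure.restrict_univ]
    exact hgint.trans ENNReal.one_lt_top
  have hac : ν'.fst ≪ lam := (Measure.absolutelyContinuous_of_le hfst_le).trans
    (withDensity_absolutelyContinuous _ _)
  set G := ν'.fst.rnDeriv lam with hG
  have hGm : Measurable G := Measure.measurable_rnDeriv _ _
  have hGlam : lam.withDensity G = ν'.fst := Measure.withDensity_rnDeriv_eq _ _ hac
  have hGg : ∀ᵐ x ∂lam, G x ≤ g x := by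
    refine ae_le_of_forall_setLIntegral_le_of_sigmaFinite hGm fun s hs _ => ?_
    rw [← withDensity_apply _ hs, ← withDensity_apply _ hs, hGlam]
    exact hfst_le s
  -- G passes from the first marginal to `lam` and the inverses undo the weights. The minimum with g
  -- changes G only on a null set. The value 0 at y = 0 avoids the infinite inverse weight there and
  -- loses no mass by `h0`.
  let D : X → ℝ → ℝ≥0∞ := fun x y =>
    if y = 0 then 0 else min (G x) (g x) * (g x : ℝ≥0∞)⁻¹ * (levyWeight y)⁻¹
  have hD : Measurable (Function.uncurry D) :=
    Measurable.ite (measurable_snd (measurableSet_singleton (0 : ℝ))) measurable_const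
      (by fun_prop)
  refine ⟨ν'.condKernel.withDensity D, fun h hh => ?_⟩
  have h1 : ∀ x, ∫⁻ y, h (x, y) ∂(ν'.condKernel.withDensity D) x
      = ∫⁻ y, D x y * h (x, y) ∂ν'.condKernel x := fun x =>
    Kernel.lintegral_withDensity _ hD x (by fun_prop)
  let E : X × ℝ → ℝ≥0∞ := fun z =>
    if z.2 = 0 then 0 else (g z.1 : ℝ≥0∞)⁻¹ * (levyWeight z.2)⁻¹ * h z
  have hE : Measurable E :=
    Measurable.ite (measurable_snd (measurableSet_singleton (0 : ℝ))) measurable_const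
      (by fun_prop)
  have h2 : ∀ᵐ x ∂lam, ∫⁻ y, D x y * h (x, y) ∂ν'.condKernel x
      = G x * ∫⁻ y, E (x, y) ∂ν'.condKernel x := by
    filter_upwards [hGg] with x hx
    rw [← lintegral_const_mul _ (by fun_prop)]
    congr 1 with y
    simp only [D, E, min_eq_left hx]
    split_ifs
    · simp
    · ring
  simp only [h1]
  have h3 := lintegral_withDensity_eq_lintegral_mul lam hGm
    (hE.lintegral_kernel_prod_right' (κ := ν'.condKernel))
  simp only [Pi.mul_apply] at h3
  rw [lintegral_congr_ae h2, ← h3, hGlam,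
    Measure.lintegral_condKernel hE, hν', lintegral_withDensity_eq_lintegral_mul _ (by fun_prop) hE,
    lintegral_withDensity_eq_lintegral_mul _ (by fun_prop) (by fun_prop)]
  refine lintegral_congr_ae ?_
  have h0' : ∀ᵐ z ∂ν, z.2 ≠ 0 := by
    rw [ae_iff]
    simpa using h0
  filter_upwards [h0'] with z hz
  have hg0 : (g z.1 : ℝ≥0∞) ≠ 0 := by simpa using (hgpos z.1).ne'
  simp only [Pi.mul_apply, E, if_neg hz]
  calc h z = (levyWeight z.2 * (levyWeight z.2)⁻¹) * ((g z.1 : ℝ≥0∞) * (g z.1 : ℝ≥0∞)⁻¹) * h z := by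
        rw [ENNReal.mul_inv_cancel (levyWeight_ne_zero hz) (levyWeight_ne_top _),
          ENNReal.mul_inv_cancel hg0 ENNReal.coe_ne_top, one_mul, one_mul]
    _ = _ := by ring

/-- A kernel which integrates `y² ∧ 1` uniformly and has no mass at `0` is s-finite. -/
lemma isSFiniteKernel_of_lintegral_levyWeight_le {κ : Kernel X ℝ}
    (h : ∀ x, ∫⁻ y, levyWeight y ∂κ x ≤ 1) (h0 : ∀ x, κ x {0} = 0) : IsSFiniteKernel κ := by
  -- By Markov's inequality these level sets have mass at most n + 1 for every x; they exhaust the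
  -- complement of 0, and are made disjoint below.
  let s : ℕ → Set ℝ := fun n => {y | (n + 1 : ℝ≥0∞)⁻¹ ≤ levyWeight y}
  have hs : ∀ n, MeasurableSet (s n) := fun n =>
    measurableSet_le measurable_const measurable_levyWeight
  have hU : ⋃ n, s n = {0}ᶜ := by
    ext y
    simp only [mem_iUnion, mem_compl_iff, mem_singleton_iff, s, mem_ofPred_eq]
    constructor
    · rintro ⟨n, hn⟩ rfl
      have : (n + 1 : ℝ≥0∞)⁻¹ = 0 := by
        rwa [levyWeight, zero_pow two_ne_zero, min_eq_right zero_le_one, ENNReal.ofReal_zero,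
          nonpos_iff_eq_zero] at hn
      rw [ENNReal.inv_eq_zero] at this
      exact ENNReal.add_ne_top.2 ⟨ENNReal.natCast_ne_top n, ENNReal.one_ne_top⟩ this
    · intro hy
      obtain ⟨n, hn⟩ := ENNReal.exists_inv_nat_lt (levyWeight_ne_zero hy)
      refine ⟨n, le_trans ?_ hn.le⟩
      exact ENNReal.inv_le_inv.2 le_self_add
  have hfin : ∀ n, IsFiniteKernel (κ.restrict (hs n)) := by
    intro n
    refine ⟨⟨(n + 1 : ℝ≥0∞), ?_, fun x => ?_⟩⟩
    · exact lt_top_iff_ne_top.2 (ENNReal.add_ne_top.2 ⟨ENNReal.natCast_ne_top n, ENNReal.one_ne_top⟩)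
    · rw [Kernel.restrict_apply, Measure.restrict_apply_univ]
      have h1 := (mul_meas_ge_le_lintegral measurable_levyWeight (μ := κ x) (n + 1 : ℝ≥0∞)⁻¹).trans
        (h x)
      rw [mul_comm, ← div_eq_mul_inv] at h1
      rwa [ENNReal.div_le_iff_le_mul (Or.inl (by simp)) (Or.inl (by finiteness)), one_mul] at h1
  have hd : ∀ n, MeasurableSet (disjointed s n) := fun n => MeasurableSet.disjointed hs n
  have hfin' : ∀ n, IsFiniteKernel (κ.restrict (hd n)) := by
    intro n
    obtain ⟨C, hC, hle⟩ := (hfin n).exists_univ_le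
    refine ⟨⟨C, hC, fun x => le_trans ?_ (hle x)⟩⟩
    rw [Kernel.restrict_apply, Kernel.restrict_apply, Measure.restrict_apply_univ,
      Measure.restrict_apply_univ]
    exact measure_mono (disjointed_subset s n)
  refine ⟨fun n => κ.restrict (hd n), hfin', ?_⟩
  ext x t ht
  rw [Kernel.sum_apply' _ _ ht]
  simp only [Kernel.restrict_apply' _ _ _ ht]
  rw [← measure_iUnion, ← inter_iUnion, iUnion_disjointed, hU]
  · exact (measure_sdiff_null (h0 x)).symm
  · exact fun i j hij => (disjoint_disjointed s hij).mono inter_subset_right inter_subset_right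
  · exact fun n => ht.inter (hd n)

/-- A disintegration can be modified on a null set so as to be s-finite, with a uniform bound. -/
lemma IsDisintegration.exists_good {ν : Measure (X × ℝ)} {lam : Measure X} [SigmaFinite lam]
    {ρ₀ : Kernel X ℝ} (hρ₀ : IsDisintegration ν lam ρ₀) (h0 : ν {z | z.2 = 0} = 0)
    (hle : (ν.withDensity fun z => levyWeight z.2).map Prod.fst ≤ lam) :
    ∃ ρ : Kernel X ℝ, IsSFiniteKernel ρ ∧ (∀ x, ∫⁻ y, levyWeight y ∂ρ x ≤ 1) ∧
      (∀ᵐ x ∂lam, ρ₀ x = ρ x) ∧ ν = lam ⊗ₘ ρ := by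
  classical
  have hw := measurable_levyWeight
  -- Integrated over any measurable s, the left side is the weighted marginal of ν, which is at most
  -- `lam s`.
  have h1 : ∀ᵐ x ∂lam, ∫⁻ y, levyWeight y ∂ρ₀ x ≤ 1 := by
    refine ae_le_of_forall_setLIntegral_le_of_sigmaFinite (g := fun _ => 1)
      (hw.lintegral_kernel) fun s hs _ => ?_
    rw [setLIntegral_one]
    refine le_trans (le_of_eq ?_) (hle s)
    rw [Measure.map_apply measurable_fst hs, withDensity_apply _ (measurable_fst hs),
      ← lintegral_indicator (measurable_fst hs), hρ₀ _ ((by fun_prop : Measurable fun z : X × ℝ =>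
        levyWeight z.2).indicator (measurable_fst hs)), ← lintegral_indicator hs]
    congr 1 with x
    by_cases hx : x ∈ s <;> simp [hx, indicator]
  have h2 : ∀ᵐ x ∂lam, ρ₀ x {0} = 0 := by
    have hm : MeasurableSet {z : X × ℝ | z.2 = 0} := measurable_snd (measurableSet_singleton (0 : ℝ))
    have h3 := hρ₀ _ ((measurable_one : Measurable (1 : X × ℝ → ℝ≥0∞)).indicator hm)
    rw [lintegral_indicator_one hm, h0] at h3
    have h4 : ∀ x, ∫⁻ y, {z : X × ℝ | z.2 = 0}.indicator 1 (x, y) ∂ρ₀ x = ρ₀ x {0} := by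
      intro x
      rw [← lintegral_indicator_one (measurableSet_singleton 0)]
      rfl
    simp only [h4] at h3
    exact (lintegral_eq_zero_iff (ρ₀.measurable_coe (measurableSet_singleton 0))).1 h3.symm
  let s : Set X := {x | ∫⁻ y, levyWeight y ∂ρ₀ x ≤ 1} ∩ {x | ρ₀ x {0} = 0}
  have hs : MeasurableSet s := (measurableSet_le hw.lintegral_kernel measurable_const).inter
    (ρ₀.measurable_coe (measurableSet_singleton 0) (measurableSet_singleton 0))
  let ρ := Kernel.piecewise hs ρ₀ 0
  have hs1 : ∀ x ∈ s, ρ x = ρ₀ x := fun x hx => by simp [ρ, Kernel.piecewise_apply, hx]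
  have hs2 : ∀ x ∉ s, ρ x = 0 := fun x hx => by simp [ρ, Kernel.piecewise_apply, hx]
  have hle' : ∀ x, ∫⁻ y, levyWeight y ∂ρ x ≤ 1 := fun x => by
    by_cases hx : x ∈ s
    · rw [hs1 x hx]; exact hx.1
    · rw [hs2 x hx]; simp
  have hsf : IsSFiniteKernel ρ := isSFiniteKernel_of_lintegral_levyWeight_le hle' fun x => by
    by_cases hx : x ∈ s
    · rw [hs1 x hx]; exact hx.2
    · rw [hs2 x hx]; simp
  have hae : ∀ᵐ x ∂lam, ρ₀ x = ρ x := by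
    filter_upwards [h1, h2] with x hx1 hx2 using (hs1 x ⟨hx1, hx2⟩).symm
  refine ⟨ρ, hsf, hle', hae, Measure.ext_of_lintegral _ fun h hh => ?_⟩
  rw [Measure.lintegral_compProd hh, hρ₀ h hh]
  refine lintegral_congr_ae ?_
  filter_upwards [hae] with x hx
  rw [hx]

end Disintegration

/-! ### Local triplets -/

section LocalTriplet

variable {X : Type*} [MeasurableSpace X]

/-- Measurable families of Lévy triplets `(a x, g x, ρ x)` of size at most `3`. -/
structure IsLocalTriplet (lam : Measure X) (a g : X → ℝ) (ρ : Kernel X ℝ) : Prop where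
  measurable_drift : Measurable a
  measurable_gauss : Measurable g
  gauss_nonneg : ∀ x, 0 ≤ g x
  isSFinite : IsSFiniteKernel ρ
  integrable_min : ∀ x, Integrable (fun y : ℝ => min 1 (y ^ 2)) (ρ x)
  size_one_le : ∀ᵐ x ∂lam, tripletSize (a x) (g x) (ρ x) 1 ≤ 3

namespace IsLocalTriplet

variable {lam : Measure X} {a g : X → ℝ} {ρ : Kernel X ℝ}

lemma measurable_scaledDrift (h : IsLocalTriplet lam a g ρ) {f : X → ℝ} (hf : Measurable f) :
    Measurable fun x => scaledDrift (a x) (ρ x) (f x) := by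
  have := h.isSFinite
  have hb := measurable_ballInd
  have ha := h.measurable_drift
  have h1 : StronglyMeasurable fun z : X × ℝ => z.2 * (ballInd (f z.1 * z.2) - ballInd z.2) :=
    (by fun_prop : Measurable _).stronglyMeasurable
  have h2 := (h1.integral_kernel_prod_right' (κ := ρ)).measurable
  unfold scaledDrift
  fun_prop

lemma measurable_tripletSize (h : IsLocalTriplet lam a g ρ) {f : X → ℝ} (hf : Measurable f) :
    Measurable fun x => tripletSize (a x) (g x) (ρ x) (f x) := by
  have := h.isSFinite
  have hg := h.measurable_gauss
  have h1 : StronglyMeasurable fun z : X × ℝ => min 1 ((f z.1 * z.2) ^ 2) :=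
    (by fun_prop : Measurable _).stronglyMeasurable
  have h2 := (h1.integral_kernel_prod_right' (κ := ρ)).measurable
  have h3 := h.measurable_scaledDrift hf
  unfold tripletSize
  fun_prop

lemma measurable_levySymbol (h : IsLocalTriplet lam a g ρ) {f : X → ℝ} (hf : Measurable f) :
    Measurable fun x => levySymbol (a x) (g x) (ρ x) (f x) := by
  have := h.isSFinite
  have hg := h.measurable_gauss
  have ha := h.measurable_drift
  have hb := measurable_ballInd
  have h1 : StronglyMeasurable fun z : X × ℝ => lkIntegrand (f z.1) z.2 := by
    unfold lkIntegrand
    exact (by fun_prop : Measurable _).stronglyMeasurable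
  have h2 := (h1.integral_kernel_prod_right' (κ := ρ)).measurable
  simp only [levySymbol_eq]
  fun_prop

lemma size_nonneg (h : IsLocalTriplet lam a g ρ) (x : X) (v : ℝ) :
    0 ≤ tripletSize (a x) (g x) (ρ x) v := tripletSize_nonneg _ (h.gauss_nonneg x) _ _

lemma size_le_of_abs_le (h : IsLocalTriplet lam a g ρ) (x : X) {C v w : ℝ} (hv : |v| ≤ C * |w|) :
    tripletSize (a x) (g x) (ρ x) v ≤ 2 * (1 + C ^ 2) * tripletSize (a x) (g x) (ρ x) w :=
  tripletSize_le_of_abs_le (h.integrable_min x) _ (h.gauss_nonneg x) hv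

lemma size_le (h : IsLocalTriplet lam a g ρ) {C : ℝ} :
    ∀ᵐ x ∂lam, ∀ v, |v| ≤ C → tripletSize (a x) (g x) (ρ x) v ≤ 6 * (1 + C ^ 2) := by
  filter_upwards [h.size_one_le] with x hx v hv
  have h1 := h.size_le_of_abs_le x (v := v) (w := 1) (C := C) (by simpa using hv)
  nlinarith [sq_nonneg C]

lemma norm_levySymbol_mul_le (h : IsLocalTriplet lam a g ρ) (x : X) (u v : ℝ) :
    ‖levySymbol (a x) (g x) (ρ x) (u * v)‖
      ≤ 2 * (1 + u ^ 2) * tripletSize (a x) (g x) (ρ x) v :=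
  CylLevy.norm_levySymbol_mul_le (h.integrable_min x) _ (h.gauss_nonneg x) u v

lemma norm_levySymbol_le (h : IsLocalTriplet lam a g ρ) :
    ∀ᵐ x ∂lam, ∀ u, ‖levySymbol (a x) (g x) (ρ x) u‖ ≤ 6 * (1 + u ^ 2) := by
  filter_upwards [h.size_one_le] with x hx u
  have h1 := h.norm_levySymbol_mul_le x u 1
  rw [mul_one] at h1
  nlinarith [sq_nonneg u]

lemma integrableOn_levySymbol (h : IsLocalTriplet lam a g ρ) {A : Set X}
    (hA : lam A < ∞) (u : ℝ) : IntegrableOn (fun x => levySymbol (a x) (g x) (ρ x) u) A lam :=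
  IntegrableOn.of_bound hA (h.measurable_levySymbol measurable_const).aestronglyMeasurable
    (6 * (1 + u ^ 2)) (ae_restrict_of_ae (h.norm_levySymbol_le.mono fun _ hx => hx u))

lemma continuous_setIntegral (h : IsLocalTriplet lam a g ρ) {A : Set X}
    (hA : lam A < ∞) :
    Continuous fun u => ∫ x in A, levySymbol (a x) (g x) (ρ x) u ∂lam := by
  refine continuous_iff_continuousAt.2 fun u₀ => continuousAt_of_dominated
    (bound := fun _ => 6 * (1 + (|u₀| + 1) ^ 2))
    (Eventually.of_forall fun u =>
      (h.measurable_levySymbol measurable_const).aestronglyMeasurable) ?_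
    (integrableOn_const hA.ne) (ae_of_all _ fun x =>
      (continuous_levySymbol (h.integrable_min x) _ _).continuousAt)
  filter_upwards [Metric.ball_mem_nhds u₀ one_pos] with u hu
  filter_upwards [ae_restrict_of_ae h.norm_levySymbol_le] with x hx
  refine (hx u).trans ?_
  have h1 : |u| ≤ |u₀| + 1 := by
    rw [Metric.mem_ball, Real.dist_eq] at hu
    have := abs_sub_abs_le_abs_sub u u₀
    linarith
  have h2 : u ^ 2 ≤ (|u₀| + 1) ^ 2 := by
    rw [← sq_abs]
    exact pow_le_pow_left₀ (abs_nonneg _) h1 2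
  linarith

/-- Bounded functions supported in a set of finite measure have integrable size. -/
lemma integrable_size_of_bounded (h : IsLocalTriplet lam a g ρ) {A : Set X}
    (hA : lam A < ∞) (hAm : MeasurableSet A) {f : X → ℝ} (hf : Measurable f) {C : ℝ}
    (hC : ∀ x, |f x| ≤ C) (hsupp : ∀ x ∉ A, f x = 0) :
    Integrable (fun x => tripletSize (a x) (g x) (ρ x) (f x)) lam := by
  have h1 : (fun x => tripletSize (a x) (g x) (ρ x) (f x))
      = A.indicator fun x => tripletSize (a x) (g x) (ρ x) (f x) := by
    refine (indicator_eq_self.2 fun x hx => ?_).symm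
    by_contra hxA
    exact hx (by simp [hsupp x hxA])
  rw [h1, integrable_indicator_iff hAm]
  refine IntegrableOn.of_bound hA (h.measurable_tripletSize hf).aestronglyMeasurable
    (6 * (1 + C ^ 2)) (ae_restrict_of_ae ?_)
  filter_upwards [h.size_le (C := C)] with x hx
  rw [Real.norm_of_nonneg (h.size_nonneg x _)]
  exact hx _ (hC x)

/-- Dominated convergence for the size of functions. -/
lemma tendsto_integral_size (h : IsLocalTriplet lam a g ρ) {f : X → ℝ}
    (hf : Integrable (fun x => tripletSize (a x) (g x) (ρ x) (f x)) lam) {κ : Type*}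
    {l : Filter κ} [l.IsCountablyGenerated] {d : κ → X → ℝ} (hdm : ∀ i, Measurable (d i)) {C : ℝ}
    (hd : ∀ i x, |d i x| ≤ C * |f x|) (hlim : ∀ᵐ x ∂lam, Tendsto (fun i => d i x) l (𝓝 0)) :
    Tendsto (fun i => ∫ x, tripletSize (a x) (g x) (ρ x) (d i x) ∂lam) l (𝓝 0) := by
  have h0 : (0 : ℝ) = ∫ _, (0 : ℝ) ∂lam := by simp
  rw [h0]
  refine tendsto_integral_filter_of_dominated_convergence
    (fun x => 2 * (1 + C ^ 2) * tripletSize (a x) (g x) (ρ x) (f x))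
    (Eventually.of_forall fun i => (h.measurable_tripletSize (hdm i)).aestronglyMeasurable)
    (Eventually.of_forall fun i => ae_of_all _ fun x => ?_) (hf.const_mul _) ?_
  · rw [Real.norm_of_nonneg (h.size_nonneg x _)]
    exact h.size_le_of_abs_le x (hd i x)
  · filter_upwards [hlim] with x hx
    exact (tendsto_tripletSize_zero (h.integrable_min x) _ _).comp hx

lemma tendsto_integral_levySymbol (h : IsLocalTriplet lam a g ρ) {f : X → ℝ}
    (hf : Integrable (fun x => tripletSize (a x) (g x) (ρ x) (f x)) lam)
    {s : ℕ → X → ℝ} (hs : ∀ n, Measurable (s n)) {C : ℝ} (hsf : ∀ n x, |s n x| ≤ C * |f x|)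
    (hlim : ∀ᵐ x ∂lam, Tendsto (fun n => s n x) atTop (𝓝 (f x))) (A : Set X) (u : ℝ) :
    Tendsto (fun n => ∫ x in A, levySymbol (a x) (g x) (ρ x) (u * s n x) ∂lam) atTop
      (𝓝 (∫ x in A, levySymbol (a x) (g x) (ρ x) (u * f x) ∂lam)) := by
  refine tendsto_integral_of_dominated_convergence
    (fun x => 2 * (1 + u ^ 2) * (2 * (1 + C ^ 2) * tripletSize (a x) (g x) (ρ x) (f x)))
    (fun n => (h.measurable_levySymbol ((hs n).const_mul u)).aestronglyMeasurable)
    ((hf.const_mul _).const_mul _).integrableOn (fun n => ae_of_all _ fun x => ?_)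
    (ae_restrict_of_ae ?_)
  · refine (h.norm_levySymbol_mul_le x u (s n x)).trans ?_
    exact mul_le_mul_of_nonneg_left (h.size_le_of_abs_le x (hsf n x)) (by positivity)
  · filter_upwards [hlim] with x hx
    exact ((continuous_levySymbol (h.integrable_min x) _ _).tendsto _).comp (hx.const_mul u)

end IsLocalTriplet

variable [TopologicalSpace X]

/-- The density `dγ/dλ`. -/
def driftDensity (γ : LocalSignedMeasure X) (lam : Measure X) (x : X) : ℝ :=
  (γ.pos.rnDeriv lam x).toReal - (γ.neg.rnDeriv lam x).toReal

/-- The density `dS/dλ`. -/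
def gaussDensity (S lam : Measure X) (x : X) : ℝ := (S.rnDeriv lam x).toReal

variable {γ : LocalSignedMeasure X} {S : Measure X} {ν : Measure (X × ℝ)}

lemma pos_le_controlMeasure : γ.pos ≤ controlMeasure γ S ν := by
  rw [controlMeasure, LocalSignedMeasure.totalVariation, add_assoc, add_assoc]
  exact Measure.le_add_right le_rfl

lemma neg_le_controlMeasure : γ.neg ≤ controlMeasure γ S ν := by
  rw [controlMeasure, LocalSignedMeasure.totalVariation, add_comm γ.pos, add_assoc, add_assoc]
  exact Measure.le_add_right le_rfl

lemma gauss_le_controlMeasure : S ≤ controlMeasure γ S ν := by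
  rw [controlMeasure, add_comm _ S, add_assoc]
  exact Measure.le_add_right le_rfl

lemma levy_le_controlMeasure :
    (ν.withDensity fun z => levyWeight z.2).map Prod.fst ≤ controlMeasure γ S ν :=
  Measure.le_add_left le_rfl

lemma integrable_min_of_lintegral_levyWeight_le {m : Measure ℝ}
    (h : ∫⁻ y, levyWeight y ∂m ≤ 1) : Integrable (fun y : ℝ => min 1 (y ^ 2)) m :=
  ⟨by fun_prop, (hasFiniteIntegral_iff_ofReal (ae_of_all _ min_one_sq_nonneg)).2
    (h.trans_lt ENNReal.one_lt_top)⟩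

/-- The control measure dominates γ⁺, γ⁻ and Σ, so their densities lie in [0, 1] almost everywhere.
Drift, variance and jump part each contribute at most 1, which gives the bound 3. -/
lemma isLocalTriplet_density [SigmaFinite (controlMeasure γ S ν)] {ρ : Kernel X ℝ}
    [IsSFiniteKernel ρ] (hρ : ∀ x, ∫⁻ y, levyWeight y ∂ρ x ≤ 1) :
    IsLocalTriplet (controlMeasure γ S ν) (driftDensity γ (controlMeasure γ S ν))
      (gaussDensity S (controlMeasure γ S ν)) ρ where
  measurable_drift := by
    have h1 := Measure.measurable_rnDeriv γ.pos (controlMeasure γ S ν)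
    have h2 := Measure.measurable_rnDeriv γ.neg (controlMeasure γ S ν)
    unfold driftDensity
    fun_prop
  measurable_gauss := (Measure.measurable_rnDeriv S (controlMeasure γ S ν)).ennreal_toReal
  gauss_nonneg _ := ENNReal.toReal_nonneg
  isSFinite := inferInstance
  integrable_min x := integrable_min_of_lintegral_levyWeight_le (hρ x)
  size_one_le := by
    filter_upwards [Measure.rnDeriv_le_one_of_le (pos_le_controlMeasure (γ := γ) (S := S) (ν := ν)),
      Measure.rnDeriv_le_one_of_le (neg_le_controlMeasure (γ := γ) (S := S) (ν := ν)),
      Measure.rnDeriv_le_one_of_le (gauss_le_controlMeasure (γ := γ) (S := S) (ν := ν))]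
      with x h1 h2 h3
    have key : ∀ {c : ℝ≥0∞}, c ≤ 1 → c.toReal ≤ 1 := fun hc => by
      simpa using ENNReal.toReal_mono ENNReal.one_ne_top hc
    have h1' := key h1
    have h2' := key h2
    have h3' := key h3
    have h4 : ∫ y, min 1 (y ^ 2) ∂ρ x ≤ 1 := by
      rw [integral_eq_lintegral_of_nonneg_ae (ae_of_all _ min_one_sq_nonneg) (by fun_prop)]
      exact key (hρ x)
    have h5 : |driftDensity γ (controlMeasure γ S ν) x| ≤ 1 := by
      rw [abs_le, driftDensity]
      constructor <;> linarith [ENNReal.toReal_nonneg (a := γ.pos.rnDeriv (controlMeasure γ S ν) x),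
        ENNReal.toReal_nonneg (a := γ.neg.rnDeriv (controlMeasure γ S ν) x)]
    rw [tripletSize_one, gaussDensity]
    linarith

end LocalTriplet

/-! ### Convergence in probability and characteristic functions -/

section Convergence

variable {Ω : Type*} [MeasurableSpace Ω] {P : Measure Ω} [IsProbabilityMeasure P]

lemma tendsto_charFunDual_of_tendstoInMeasure {E : Type*} [NormedAddCommGroup E] [NormedSpace ℝ E]
    [MeasurableSpace E] [BorelSpace E] {κ : Type*} {l : Filter κ} [l.IsCountablyGenerated]
    [l.NeBot] {X : κ → Ω → E} {Z : Ω → E} (h : TendstoInMeasure P X l Z)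
    (hX : ∀ i, AEMeasurable (X i) P) (ℓ : StrongDual ℝ E) :
    Tendsto (fun i => charFunDual (P.map (X i)) ℓ) l (𝓝 (charFunDual (P.map Z) ℓ)) := by
  exact (ProbabilityMeasure.tendsto_iff_forall_integral_rclike_tendsto ℂ).1
    (h.tendstoInDistribution hX).tendsto (BoundedContinuousFunction.ofNormedAddCommGroup
    (fun v => Complex.exp (ℓ v * Complex.I)) (by fun_prop) 1
    fun v => (Complex.norm_exp_ofReal_mul_I (ℓ v)).le)

lemma tendsto_charFun_of_tendstoInMeasure {κ : Type*} {l : Filter κ} [l.IsCountablyGenerated]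
    [l.NeBot] {X : κ → Ω → ℝ} {Z : Ω → ℝ} (h : TendstoInMeasure P X l Z)
    (hX : ∀ i, AEMeasurable (X i) P) (u : ℝ) :
    Tendsto (fun i => charFun (P.map (X i)) u) l (𝓝 (charFun (P.map Z) u)) := by
  simp only [charFun_eq_charFunDual_toDualMap]
  exact tendsto_charFunDual_of_tendstoInMeasure h hX _

/-- A sequence which is Cauchy in probability converges in probability. -/
lemma exists_tendstoInMeasure_of_cauchy {X : ℕ → Ω → ℝ} (hX : ∀ n, AEStronglyMeasurable (X n) P)
    (h : ∀ ε : ℝ, 0 < ε → ∀ δ : ℝ≥0∞, 0 < δ → ∃ N, ∀ n ≥ N, ∀ m ≥ N,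
      P {ω | ε ≤ |X n ω - X m ω|} ≤ δ) :
    ∃ Z : Ω →ₘ[P] ℝ, TendstoInMeasure P X atTop Z := by
  have h2 : ∀ k : ℕ, ∃ N, ∀ n ≥ N, ∀ m ≥ N,
      P {ω | (1 / 2 : ℝ) ^ k ≤ |X n ω - X m ω|} ≤ (1 / 2 : ℝ≥0∞) ^ k := fun k =>
    h _ (by positivity) _ (ENNReal.pow_pos (by simp) k)
  have h2' : ∀ k : ℕ, ∃ N, ∀ n ≥ N, ∀ m ≥ n,
      P {ω | (1 / 2 : ℝ) ^ k ≤ |X n ω - X m ω|} ≤ (1 / 2 : ℝ≥0∞) ^ k := fun k =>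
    let ⟨N, hN⟩ := h2 k
    ⟨N, fun n hn m hm => hN n hn m (hn.trans hm)⟩
  -- Along this subsequence successive differences exceed 2⁻ᵏ with probability at most 2⁻ᵏ, so
  -- Borel–Cantelli gives almost sure convergence.
  obtain ⟨φ, hφ, hφN⟩ := extraction_forall_of_eventually' h2'
  have h3 : ∀ᵐ ω ∂P, ∀ᶠ k in atTop,
      ω ∉ {ω | (1 / 2 : ℝ) ^ k ≤ |X (φ k) ω - X (φ (k + 1)) ω|} := by
    refine ae_eventually_notMem (ne_top_of_le_ne_top ?_
      (ENNReal.tsum_le_tsum fun k => hφN k (φ (k + 1)) (hφ (Nat.lt_succ_self k)).le))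
    rw [ENNReal.tsum_geometric]
    simp
  have h4 : ∀ᵐ ω ∂P, ∃ l, Tendsto (fun k => X (φ k) ω) atTop (𝓝 l) := by
    filter_upwards [h3] with ω hω
    obtain ⟨k₀, hk₀⟩ := eventually_atTop.1 hω
    have hc : CauchySeq fun k => X (φ (k + k₀)) ω := by
      refine cauchySeq_of_le_geometric (1 / 2) ((1 / 2) ^ k₀) (by norm_num) fun k => ?_
      have := hk₀ (k + k₀) (Nat.le_add_left _ _)
      simp only [not_le] at this
      rw [Real.dist_eq, ← pow_add, add_comm k₀ k, add_right_comm k 1 k₀]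
      exact this.le
    exact cauchySeq_tendsto_of_complete ((cauchySeq_shift (u := fun k => X (φ k) ω) k₀).1 hc)
  obtain ⟨Z, hZ, hlim⟩ := exists_stronglyMeasurable_limit_of_tendsto_ae (fun k => hX (φ k)) h4
  have h5 : TendstoInMeasure P (fun k => X (φ k)) atTop Z :=
    tendstoInMeasure_of_tendsto_ae (fun k => hX (φ k)) hlim
  refine ⟨AEEqFun.mk Z hZ.aestronglyMeasurable, TendstoInMeasure.congr_right
    (AEEqFun.coeFn_mk Z hZ.aestronglyMeasurable).symm ?_⟩
  rw [tendstoInMeasure_iff_dist] at h5 ⊢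
  intro ε hε
  rw [ENNReal.tendsto_nhds_zero]
  intro δ hδ
  obtain ⟨N, hN⟩ := h (ε / 2) (half_pos hε) (δ / 2) (ENNReal.half_pos hδ.ne')
  obtain ⟨k, hk1, hk2⟩ := ((ENNReal.tendsto_nhds_zero.1 (h5 (ε / 2) (half_pos hε)) (δ / 2)
    (ENNReal.half_pos hδ.ne')).and (hφ.tendsto_atTop.eventually_ge_atTop N)).exists
  filter_upwards [eventually_ge_atTop N] with n hn
  calc P {ω | ε ≤ dist (X n ω) (Z ω)}
      ≤ P ({ω | ε / 2 ≤ |X n ω - X (φ k) ω|} ∪ {ω | ε / 2 ≤ dist (X (φ k) ω) (Z ω)}) := by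
        refine measure_mono fun ω hω => ?_
        simp only [mem_ofPred_eq, mem_union] at hω ⊢
        by_contra! hcon
        have := dist_triangle (X n ω) (X (φ k) ω) (Z ω)
        rw [Real.dist_eq (X n ω) (X (φ k) ω)] at this
        linarith
    _ ≤ δ / 2 + δ / 2 := (measure_union_le _ _).trans (add_le_add (hN n hn _ hk2) hk1)
    _ = δ := ENNReal.add_halves δ

/-- A tail bound from a quadratic bound on the characteristic exponent. -/
lemma measure_abs_gt_le_of_charFun {X : Ω → ℝ} (hX : AEMeasurable X P) {ψ : ℝ → ℂ} {C : ℝ}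
    (hC : 0 ≤ C) (hψ : ∀ u, charFun (P.map X) u = Complex.exp (ψ u))
    (hle : ∀ u, ‖ψ u‖ ≤ C * (1 + u ^ 2)) {r : ℝ} (hr : 0 < r) :
    P {ω | r < |X ω|} ≤ ENNReal.ofReal (4 * (1 + (2 / r) ^ 2) * C) := by
  have hprob : IsProbabilityMeasure (P.map X) := Measure.isProbabilityMeasure_map hX
  -- For small ψ this is the Lipschitz bound of exp near 0; for |ψ| > 1 the trivial bound 2
  -- suffices.
  have h1 : ∀ u, ‖1 - charFun (P.map X) u‖ ≤ 2 * ‖ψ u‖ := by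
    intro u
    rcases le_or_gt ‖ψ u‖ 1 with h | h
    · rw [hψ, norm_sub_rev]
      exact Complex.norm_exp_sub_one_le h
    · exact norm_one_sub_charFun_le_two.trans (by linarith)
  have h2 : ‖∫ u in (-2 * r⁻¹)..(2 * r⁻¹), 1 - charFun (P.map X) u‖
      ≤ 2 * (C * (1 + (2 / r) ^ 2)) * |2 * r⁻¹ - (-2 * r⁻¹)| := by
    refine intervalIntegral.norm_integral_le_of_norm_le_const fun u hu => ?_
    have hr' : -2 * r⁻¹ ≤ 2 * r⁻¹ := by
      have : 0 < r⁻¹ := inv_pos.2 hr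
      linarith
    rw [uIoc_of_le hr'] at hu
    have hu' : |u| ≤ 2 / r := abs_le.2 ⟨by rw [div_eq_mul_inv]; linarith [hu.1],
      by rw [div_eq_mul_inv]; exact hu.2⟩
    have hu2 : u ^ 2 ≤ (2 / r) ^ 2 := by
      rw [← sq_abs]
      exact pow_le_pow_left₀ (abs_nonneg _) hu' 2
    have h3 := mul_le_mul_of_nonneg_left (add_le_add_right hu2 1) hC
    linarith [h1 u, hle u]
  have h3 := (measureReal_abs_gt_le_integral_charFun (μ := P.map X) hr).trans
    (mul_le_mul_of_nonneg_left h2 (by positivity))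
  have h4 : 2⁻¹ * r * (2 * (C * (1 + (2 / r) ^ 2)) * |2 * r⁻¹ - (-2 * r⁻¹)|)
      = 4 * (1 + (2 / r) ^ 2) * C := by
    rw [abs_of_nonneg (by have : 0 < r⁻¹ := inv_pos.2 hr; linarith)]
    field_simp
    ring
  rw [h4, measureReal_def, Measure.map_apply_of_aemeasurable hX
    (measurableSet_lt measurable_const (by fun_prop))] at h3
  exact (ENNReal.le_ofReal_iff_toReal_le (measure_ne_top _ _) (by positivity)).2 h3

/-- Characteristic exponents of real processes with stationary independent increments. -/
lemma charFun_eq_exp_mul {Y : ℝ≥0 → Ω → ℝ} (hY : ∀ t, AEMeasurable (Y t) P)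
    (hzero : Y 0 =ᵐ[P] 0) (hindep : HasIndepIncrements Y P)
    (hstat : ∀ s t : ℝ≥0, IdentDistrib (fun ω => Y (s + t) ω - Y s ω) (Y t) P P)
    (hcont : ∀ t : ℝ≥0, TendstoInMeasure P Y (𝓝 t) (Y t)) {ψ : ℝ → ℂ} (hψ : Continuous ψ)
    (hψ0 : ψ 0 = 0) (h1 : ∀ u, charFun (P.map (Y 1)) u = Complex.exp (ψ u)) (t : ℝ≥0) (u : ℝ) :
    charFun (P.map (Y t)) u = Complex.exp (t * ψ u) := by
  have hprob : ∀ t, IsProbabilityMeasure (P.map (Y t)) := fun t =>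
    Measure.isProbabilityMeasure_map (hY t)
  have hmul : ∀ (s t : ℝ≥0) (u : ℝ), charFun (P.map (Y (s + t))) u
      = charFun (P.map (Y s)) u * charFun (P.map (Y t)) u := by
    intro s t u
    have h2 := (hindep.indepFun_eval_sub (zero_le (a := s)) (le_self_add (b := t)) hzero)
    have h3 := h2.charFun_map_add_eq_mul (hY s) ((hY (s + t)).sub (hY s))
    rw [add_sub_cancel] at h3
    rw [h3, Pi.mul_apply]
    congr 2
    exact (hstat s t).map_eq
  have hzero' : ∀ u, charFun (P.map (Y 0)) u = 1 := by
    intro u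
    rw [Measure.map_congr hzero]
    simp [Pi.zero_def, Measure.map_const]
  have hpow : ∀ (n : ℕ) (s : ℝ≥0) (u : ℝ),
      charFun (P.map (Y (n * s))) u = charFun (P.map (Y s)) u ^ n := by
    intro n s u
    induction n with
    | zero => simpa using hzero' u
    | succ n ih => rw [Nat.cast_succ, add_mul, one_mul, hmul, ih, pow_succ]
  -- The n-th power fixes the value only up to a root of unity. The quotient by the expected value
  -- is continuous in u, takes values in the finite set of n-th roots of unity and equals 1 at u =
  -- 0, so it is identically 1.
  have hroot : ∀ (n : ℕ), 0 < n → ∀ u,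
      charFun (P.map (Y (n : ℝ≥0)⁻¹)) u = Complex.exp ((n : ℂ)⁻¹ * ψ u) := by
    intro n hn
    have hn' : (n : ℂ) ≠ 0 := by exact_mod_cast hn.ne'
    let c : ℝ → ℂ := fun u => charFun (P.map (Y (n : ℝ≥0)⁻¹)) u * Complex.exp (-((n : ℂ)⁻¹ * ψ u))
    have hc : Continuous c := continuous_charFun.mul (by fun_prop)
    have hcn : ∀ u, c u ∈ {z : ℂ | z ^ n = 1} := by
      intro u
      simp only [c, mem_ofPred_eq]
      rw [mul_pow, ← hpow, mul_inv_cancel₀ (by exact_mod_cast hn.ne'), h1, ← Complex.exp_nat_mul,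
        ← Complex.exp_add]
      have : ψ u + n * -((n : ℂ)⁻¹ * ψ u) = 0 := by field_simp; ring
      rw [this, Complex.exp_zero]
    have hfin : {z : ℂ | z ^ n = 1}.Finite := by
      refine (Polynomial.nthRootsFinset n (1 : ℂ)).finite_toSet.subset fun z hz => ?_
      simpa [Polynomial.mem_nthRootsFinset hn] using hz
    have h0 : c 0 = 1 := by simp [c, hψ0]
    intro u
    have h2 : c u = c 0 := isPreconnected_univ.constant_of_mapsTo hfin.isDiscrete
      hc.continuousOn (fun u _ => hcn u) (mem_univ u) (mem_univ 0)
    rw [h0] at h2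
    simp only [c] at h2
    rw [Complex.exp_neg, mul_inv_eq_one₀ (Complex.exp_ne_zero _)] at h2
    exact h2
  have hrat : ∀ (k n : ℕ), 0 < n → charFun (P.map (Y (k * (n : ℝ≥0)⁻¹))) u
      = Complex.exp (((k * (n : ℝ≥0)⁻¹ : ℝ≥0) : ℝ) * ψ u) := by
    intro k n hn
    rw [hpow, hroot n hn, ← Complex.exp_nat_mul]
    congr 1
    push_cast
    ring
  -- Rational times suffice, because stochastic continuity makes the characteristic function
  -- continuous in time.
  have hlim : Tendsto (fun n : ℕ => (⌊(t : ℝ) * n⌋₊ : ℝ≥0) * (n : ℝ≥0)⁻¹) atTop (𝓝 t) := by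
    rw [← NNReal.tendsto_coe]
    push_cast
    have := (tendsto_nat_floor_mul_div_atTop (R := ℝ) t.2).comp tendsto_natCast_atTop_atTop
    exact this
  have hl1 := (tendsto_charFun_of_tendstoInMeasure (hcont t) hY u).comp hlim
  have hl2 : Tendsto (fun s : ℝ≥0 => Complex.exp (s * ψ u)) (𝓝 t) (𝓝 (Complex.exp (t * ψ u))) :=
    Continuous.tendsto (by fun_prop) t
  refine tendsto_nhds_unique hl1 ((hl2.comp hlim).congr' ?_)
  filter_upwards [eventually_gt_atTop 0] with n hn
  exact (hrat _ n hn).symm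

end Convergence

/-! ### Random measures and simple functions -/

section Simple

variable {Ω : Type*} [MeasurableSpace Ω] {P : Measure Ω}
variable {X : Type*} [TopologicalSpace X] [MeasurableSpace X]

lemma borelB.mono {A B : Set X} (hA : A ∈ borelB X) (hB : MeasurableSet B) (h : B ⊆ A) :
    B ∈ borelB X :=
  ⟨hB, hA.2.of_isClosed_subset isClosed_closure (closure_mono h)⟩

lemma borelB.empty : (∅ : Set X) ∈ borelB X := ⟨MeasurableSet.empty, by simp⟩

lemma borelB.union {A B : Set X} (hA : A ∈ borelB X) (hB : B ∈ borelB X) : A ∪ B ∈ borelB X :=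
  ⟨hA.1.union hB.1, by rw [closure_union]; exact hA.2.union hB.2⟩

lemma borelB.biUnion {κ : Type*} (s : Finset κ) {A : κ → Set X} (hA : ∀ k ∈ s, A k ∈ borelB X) :
    (⋃ k ∈ s, A k) ∈ borelB X := by
  classical
  induction s using Finset.induction_on with
  | empty => simpa using borelB.empty
  | insert k s hk ih =>
    rw [Finset.set_biUnion_insert]
    exact borelB.union (hA k (Finset.mem_insert_self k s))
      (ih fun j hj => hA j (Finset.mem_insert_of_mem hj))

lemma borelB.inter {A B : Set X} (hA : MeasurableSet A) (hB : B ∈ borelB X) : A ∩ B ∈ borelB X :=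
  borelB.mono hB (hA.inter hB.1) inter_subset_right

namespace IsInfDivRandomMeasure

variable {N : Set X → Ω →ₘ[P] ℝ}

/-- Countable additivity applied to ∅, ∅, … makes n N(∅) converge almost surely, so its increments
N(∅) tend to 0. -/
lemma empty (hN : IsInfDivRandomMeasure N) : N ∅ = 0 := by
  refine AEEqFun.ext ?_
  have h := hN.iUnion (fun _ => ∅) (fun _ => borelB.empty) (fun _ _ _ => disjoint_empty _)
    (by simpa using borelB.empty)
  filter_upwards [h, AEEqFun.coeFn_zero (α := Ω) (β := ℝ) (μ := P)] with ω hω h0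
  rw [h0, Pi.zero_apply]
  simp only [iUnion_empty, Finset.sum_const, Finset.card_range, nsmul_eq_mul] at hω
  have h2 := (hω.comp (tendsto_add_atTop_nat 1)).sub hω
  rw [sub_self] at h2
  refine tendsto_nhds_unique (tendsto_const_nhds.congr fun n => ?_) h2
  simp only [Function.comp_apply]
  push_cast
  ring

lemma union (hN : IsInfDivRandomMeasure N) {A B : Set X} (hA : A ∈ borelB X) (hB : B ∈ borelB X)
    (hd : Disjoint A B) : N (A ∪ B) = N A + N B := by
  let C : ℕ → Set X := fun k => if k = 0 then A else if k = 1 then B else ∅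
  have hC : ∀ k, C k ∈ borelB X := fun k => by
    simp only [C]
    split_ifs
    exacts [hA, hB, borelB.empty]
  have hU : ⋃ k, C k = A ∪ B := by
    ext x
    simp only [mem_iUnion, mem_union, C]
    constructor
    · rintro ⟨k, hk⟩
      split_ifs at hk
      exacts [Or.inl hk, Or.inr hk, hk.elim]
    · rintro (h | h)
      exacts [⟨0, by simpa using h⟩, ⟨1, by simpa using h⟩]
  have hdC : Pairwise (Function.onFun Disjoint C) := by
    intro i j hij
    simp only [Function.onFun, C]
    split_ifs with h1 h2 h3 h4 h5 h6
    · exact (hij (h1.trans h2.symm)).elim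
    · exact hd
    · exact disjoint_empty _
    · exact hd.symm
    · exact (hij (h4.trans h6.symm)).elim
    all_goals simp
  have h := hN.iUnion C hC hdC (hU ▸ borelB.union hA hB)
  refine AEEqFun.ext ?_
  filter_upwards [h, AEEqFun.coeFn_add (N A) (N B),
    AEEqFun.coeFn_zero (α := Ω) (β := ℝ) (μ := P)] with ω hω hadd h0
  rw [hadd, Pi.add_apply]
  rw [hU] at hω
  refine tendsto_nhds_unique hω (tendsto_const_nhds.congr' ?_)
  filter_upwards [eventually_ge_atTop 2] with n hn
  have h3 : ∀ k, 2 ≤ k → N (C k) ω = 0 := fun k hk => by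
    have : C k = ∅ := by
      simp only [C]
      rw [if_neg (by omega), if_neg (by omega)]
    rw [this, hN.empty, h0, Pi.zero_apply]
  rw [← Finset.sum_subset (Finset.range_mono hn)
    fun k _ hk => h3 k (by simp only [Finset.mem_range] at hk; omega), Finset.sum_range_succ, Finset.sum_range_one]
  rfl

lemma biUnion (hN : IsInfDivRandomMeasure N) {κ : Type*} (s : Finset κ) {A : κ → Set X}
    (hA : ∀ k ∈ s, A k ∈ borelB X) (hd : (s : Set κ).PairwiseDisjoint A) :
    N (⋃ k ∈ s, A k) = ∑ k ∈ s, N (A k) := by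
  classical
  induction s using Finset.induction_on with
  | empty => simpa using hN.empty
  | insert k s hk ih =>
    rw [Finset.set_biUnion_insert, Finset.sum_insert hk, hN.union
      (hA k (Finset.mem_insert_self k s))
      (borelB.biUnion s fun j hj => hA j (Finset.mem_insert_of_mem hj)),
      ih (fun j hj => hA j (Finset.mem_insert_of_mem hj))
        (hd.subset (by simp [Finset.coe_insert]))]
    rw [disjoint_iUnion₂_right]
    intro j hj
    refine hd (by simp) (by simp [hj]) ?_
    rintro rfl
    exact hk hj

end IsInfDivRandomMeasure

lemma coeFn_sum_smul {κ : Type*} (s : Finset κ) (c : κ → ℝ) (Z : κ → Ω →ₘ[P] ℝ) :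
    ((∑ k ∈ s, c k • Z k : Ω →ₘ[P] ℝ) : Ω → ℝ) =ᵐ[P] fun ω => ∑ k ∈ s, c k * Z k ω := by
  classical
  induction s using Finset.induction_on with
  | empty =>
    simp only [Finset.sum_empty]
    exact AEEqFun.coeFn_zero
  | insert k s hk ih =>
    rw [Finset.sum_insert hk]
    filter_upwards [ih, AEEqFun.coeFn_add (c k • Z k) (∑ k ∈ s, c k • Z k),
      AEEqFun.coeFn_smul (c k) (Z k)] with ω h1 h2 h3
    rw [h2, Pi.add_apply, h1, h3, Finset.sum_insert hk, Pi.smul_apply, smul_eq_mul]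

namespace SimpleB

/-- The simple function with given coefficients on a finite disjoint family of sets. -/
def ofFintype {κ : Type*} [Fintype κ] (c : κ → ℝ) (A : κ → Set X) (hA : ∀ k, A k ∈ borelB X)
    (hd : Pairwise (Function.onFun Disjoint A)) : SimpleB X where
  n := Fintype.card κ
  coeff := c ∘ (Fintype.equivFin κ).symm
  set := A ∘ (Fintype.equivFin κ).symm
  mem _ := hA _
  disj _ _ hij := hd fun h => hij ((Fintype.equivFin κ).symm.injective h)

section ofFintype

variable {κ : Type*} [Fintype κ] (c : κ → ℝ) (A : κ → Set X) (hA : ∀ k, A k ∈ borelB X)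
    (hd : Pairwise (Function.onFun Disjoint A))

lemma toFun_ofFintype (x : X) :
    (ofFintype c A hA hd).toFun x = ∑ k, (A k).indicator (fun _ => c k) x :=
  (Fintype.equivFin κ).symm.sum_comp fun k => (A k).indicator (fun _ => c k) x

lemma integral_ofFintype (M : ℝ≥0 → Set X → Ω →ₘ[P] ℝ) (t : ℝ≥0) (B : Set X) :
    (ofFintype c A hA hd).integral M t B = ∑ k, c k • M t (B ∩ A k) :=
  (Fintype.equivFin κ).symm.sum_comp fun k => c k • M t (B ∩ A k)

end ofFintype

lemma measurable_toFun (s : SimpleB X) : Measurable s.toFun :=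
  Finset.measurable_sum _ fun k _ => measurable_const.indicator (s.mem k).1

/-- The support of a simple function. -/
def support (s : SimpleB X) : Set X := ⋃ k, s.set k

lemma support_mem (s : SimpleB X) : s.support ∈ borelB X := by
  have := borelB.biUnion Finset.univ (A := s.set) fun k _ => s.mem k
  simpa [support] using this

lemma toFun_of_mem (s : SimpleB X) {k : Fin s.n} {x : X} (hx : x ∈ s.set k) :
    s.toFun x = s.coeff k := by
  rw [toFun, Finset.sum_eq_single k]
  · rw [indicator_of_mem hx]
  · intro j _ hj
    rw [indicator_of_notMem]
    exact fun h => (s.disj hj).le_bot ⟨h, hx⟩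
  · simp

lemma toFun_of_notMem (s : SimpleB X) {x : X} (hx : x ∉ s.support) : s.toFun x = 0 := by
  rw [toFun]
  refine Finset.sum_eq_zero fun k _ => ?_
  rw [indicator_of_notMem]
  exact fun h => hx (mem_iUnion.2 ⟨k, h⟩)

lemma exists_bound (s : SimpleB X) : ∃ C : ℝ, ∀ x, |s.toFun x| ≤ C := by
  refine ⟨∑ k, |s.coeff k|, fun x => (Finset.abs_sum_le_sum_abs _ _).trans
    (Finset.sum_le_sum fun k _ => ?_)⟩
  by_cases hx : x ∈ s.set k <;> simp [hx]

/-- At most one of the disjoint sets contains x. Vanishing at the value 0 covers points outside the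
support; the exponents are of this kind. -/
lemma sum_indicator_eq {G : Type*} [AddCommMonoid G] (s : SimpleB X) (F : X → ℝ → G)
    (hF : ∀ x, F x 0 = 0) (x : X) :
    F x (s.toFun x) = ∑ k, (s.set k).indicator (fun x => F x (s.coeff k)) x := by
  by_cases hx : x ∈ s.support
  · obtain ⟨k, hk⟩ := mem_iUnion.1 hx
    rw [s.toFun_of_mem hk, Finset.sum_eq_single k]
    · rw [indicator_of_mem hk]
    · intro j _ hj
      rw [indicator_of_notMem]
      exact fun h => (s.disj hj).le_bot ⟨h, hk⟩
    · simp
  · rw [s.toFun_of_notMem hx, hF, Finset.sum_eq_zero]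
    intro k _
    rw [indicator_of_notMem]
    exact fun h => hx (mem_iUnion.2 ⟨k, h⟩)

/-- Linear combinations of simple functions are simple, and the integral is linear. -/
lemma exists_linearCombination (s r : SimpleB X) (α β : ℝ) : ∃ q : SimpleB X,
    (∀ x, q.toFun x = α * s.toFun x + β * r.toFun x) ∧
    ∀ (P : Measure Ω) (M : ℝ≥0 → Set X → Ω →ₘ[P] ℝ) (t : ℝ≥0) (B : Set X),
      IsInfDivRandomMeasure (M t) → MeasurableSet B →
      q.integral M t B = α • s.integral M t B + β • r.integral M t B := by
  classical
  have hU := borelB.union s.support_mem r.support_mem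
  set V := s.support ∪ r.support with hV
  -- The index `none` carries the rest of V with coefficient 0. Both functions are then given on
  -- partitions of the same set, and their common refinement represents the combination.
  let A : ∀ p : SimpleB X, Option (Fin p.n) → Set X := fun p i =>
    i.elim (V \ p.support) p.set
  let c : ∀ p : SimpleB X, Option (Fin p.n) → ℝ := fun p i => i.elim 0 p.coeff
  have hA : ∀ p i, MeasurableSet (A p i) := by
    rintro p (_ | i)
    · exact hU.1.diff p.support_mem.1
    · exact (p.mem i).1
  have hdA : ∀ p, Pairwise (Function.onFun Disjoint (A p)) := by
    rintro p (_ | i) (_ | j) hij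
    · exact (hij rfl).elim
    · exact disjoint_sdiff_left.mono_right (subset_iUnion p.set j)
    · exact disjoint_sdiff_right.mono_left (subset_iUnion p.set i)
    · exact p.disj fun h => hij (congrArg some h)
  have hcov : ∀ p, V ⊆ ⋃ i, A p i := by
    intro p x hx
    by_cases h : x ∈ p.support
    · obtain ⟨k, hk⟩ := mem_iUnion.1 h
      exact mem_iUnion.2 ⟨some k, hk⟩
    · exact mem_iUnion.2 ⟨none, hx, h⟩
  have hsV : ∀ i, A s i ⊆ V := by
    rintro (_ | i)
    · exact sdiff_subset
    · exact (subset_iUnion s.set i).trans subset_union_left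
  have hrV : ∀ i, A r i ⊆ V := by
    rintro (_ | i)
    · exact sdiff_subset
    · exact (subset_iUnion r.set i).trans subset_union_right
  let D : Option (Fin s.n) × Option (Fin r.n) → Set X := fun k => A s k.1 ∩ A r k.2
  have hD : ∀ k, D k ∈ borelB X := fun k =>
    borelB.mono hU ((hA s _).inter (hA r _)) (inter_subset_left.trans (hsV _))
  have hdD : Pairwise (Function.onFun Disjoint D) := by
    rintro ⟨i, j⟩ ⟨i', j'⟩ hij
    by_cases h : i = i'
    · subst h
      have hj : j ≠ j' := fun h' => hij (by rw [h'])
      exact (hdA r hj).mono inter_subset_right inter_subset_right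
    · exact (hdA s h).mono inter_subset_left inter_subset_left
  have hsum : ∀ p : SimpleB X, ∀ x, p.toFun x = ∑ i, (A p i).indicator (fun _ => c p i) x := by
    intro p x
    rw [Fintype.sum_option]
    simp [A, c, toFun]
  refine ⟨ofFintype (fun k => α * c s k.1 + β * c r k.2) D hD hdD, fun x => ?_,
    fun P M t B hM hB => ?_⟩
  · rw [toFun_ofFintype]
    by_cases hx : x ∈ V
    · obtain ⟨i, hi⟩ := mem_iUnion.1 (hcov s hx)
      obtain ⟨j, hj⟩ := mem_iUnion.1 (hcov r hx)
      have key : ∀ {κ : Type} [Fintype κ] (A : κ → Set X) (c : κ → ℝ),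
          Pairwise (Function.onFun Disjoint A) → ∀ i, x ∈ A i →
          ∑ k, (A k).indicator (fun _ => c k) x = c i := by
        intro κ _ A c hd i hi
        rw [Finset.sum_eq_single i]
        · rw [indicator_of_mem hi]
        · intro k _ hk
          rw [indicator_of_notMem]
          exact fun h => (hd hk).le_bot ⟨h, hi⟩
        · simp
      rw [hsum s, hsum r, key _ _ (hdA s) i hi, key _ _ (hdA r) j hj,
        key D _ hdD (i, j) ⟨hi, hj⟩]
    · rw [Finset.sum_eq_zero, s.toFun_of_notMem fun h => hx (Or.inl h),
        r.toFun_of_notMem fun h => hx (Or.inr h), mul_zero, mul_zero, add_zero]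
      intro k _
      rw [indicator_of_notMem]
      exact fun h => hx (hsV _ h.1)
  · rw [integral_ofFintype]
    have hBD : ∀ k, B ∩ D k ∈ borelB X := fun k => borelB.inter hB (hD k)
    have hs : ∀ i, M t (B ∩ A s i) = ∑ j, M t (B ∩ D (i, j)) := by
      intro i
      have h1 := hM.biUnion Finset.univ (A := fun j => B ∩ D (i, j)) (fun j _ => hBD _)
        (fun j _ j' _ hj => (hdA r hj).mono (inter_subset_right.trans inter_subset_right)
          (inter_subset_right.trans inter_subset_right))
      rw [← h1]
      congr 1
      simp only [Finset.mem_univ, iUnion_true, ← inter_iUnion, D]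
      rw [inter_eq_left.2 ((hsV i).trans (hcov r))]
    have hr : ∀ j, M t (B ∩ A r j) = ∑ i, M t (B ∩ D (i, j)) := by
      intro j
      have h1 := hM.biUnion Finset.univ (A := fun i => B ∩ D (i, j)) (fun i _ => hBD _)
        (fun i _ i' _ hi => (hdA s hi).mono (inter_subset_right.trans inter_subset_left)
          (inter_subset_right.trans inter_subset_left))
      rw [← h1]
      congr 1
      simp only [Finset.mem_univ, iUnion_true, ← inter_iUnion, D]
      rw [← iUnion_inter, inter_eq_right.2 ((hrV j).trans (hcov s))]
    have hint : ∀ p : SimpleB X, p.integral M t B = ∑ i, c p i • M t (B ∩ A p i) := by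
      intro p
      rw [Fintype.sum_option]
      simp [A, c, SimpleB.integral]
    rw [hint s, hint r]
    simp only [hs, hr, add_smul, Finset.sum_add_distrib, Finset.smul_sum, Fintype.sum_prod_type,
      smul_smul]
    congr 1
    exact Finset.sum_comm

lemma integral_union (s : SimpleB X) {M : ℝ≥0 → Set X → Ω →ₘ[P] ℝ} {t : ℝ≥0}
    (hM : IsInfDivRandomMeasure (M t)) {A B : Set X} (hA : MeasurableSet A) (hB : MeasurableSet B)
    (hd : Disjoint A B) :
    s.integral M t (A ∪ B) = s.integral M t A + s.integral M t B := by
  simp only [SimpleB.integral, ← Finset.sum_add_distrib, ← smul_add]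
  refine Finset.sum_congr rfl fun k _ => ?_
  rw [union_inter_distrib_right, hM.union (borelB.inter hA (s.mem k)) (borelB.inter hB (s.mem k))
    (hd.mono inter_subset_left inter_subset_left)]

end SimpleB

end Simple

/-! ### The law of the integral of a simple function -/

section Driven

variable {Ω : Type*} [MeasurableSpace Ω] {P : Measure Ω}
variable {X : Type*} [TopologicalSpace X] [MeasurableSpace X]

/-- A Lévy-valued random measure whose value on `A` at time `1` has the exponent obtained by
integrating the exponents of the local triplets `(a x, g x, ρ x)` over `A`. -/
structure IsDriven (M : ℝ≥0 → Set X → Ω →ₘ[P] ℝ) (lam : Measure X) (a g : X → ℝ)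
    (ρ : Kernel X ℝ) : Prop where
  random : IsLevyRandomMeasure M
  triplet : IsLocalTriplet lam a g ρ
  lt_top : ∀ A ∈ borelB X, lam A < ∞
  charFun_one : ∀ A ∈ borelB X, ∀ u : ℝ, charFun (P.map (M 1 A)) u
    = Complex.exp (∫ x in A, levySymbol (a x) (g x) (ρ x) u ∂lam)

variable {M : ℝ≥0 → Set X → Ω →ₘ[P] ℝ} {lam : Measure X} {a g : X → ℝ} {ρ : Kernel X ℝ}

namespace IsDriven

lemma integrable_size_simple (h : IsDriven M lam a g ρ) (s : SimpleB X) :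
    Integrable (fun x => tripletSize (a x) (g x) (ρ x) (s.toFun x)) lam := by
  obtain ⟨C, hC⟩ := s.exists_bound
  exact h.triplet.integrable_size_of_bounded (h.lt_top _ s.support_mem) s.support_mem.1
    s.measurable_toFun hC fun x hx => s.toFun_of_notMem hx

/-- For fixed A the process t ↦ M(t, A) is a real Lévy process, so its exponent at time t is t times
the one at time 1. -/
lemma charFun_eq [IsProbabilityMeasure P] (h : IsDriven M lam a g ρ) {A : Set X} (hA : A ∈ borelB X) (t : ℝ≥0) (u : ℝ) :
    charFun (P.map (M t A)) u
      = Complex.exp (t * ∫ x in A, levySymbol (a x) (g x) (ρ x) u ∂lam) := by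
  have hl := h.random.levy 1 (fun _ => A) fun _ => hA
  have hY : ∀ t, AEMeasurable (M t A) P := fun t => (M t A).aestronglyMeasurable.aemeasurable
  refine charFun_eq_exp_mul (Y := fun t => M t A) hY ?_ ?_ ?_ ?_
    (h.triplet.continuous_setIntegral (h.lt_top A hA)) (by simp [levySymbol_zero])
    (h.charFun_one A hA) t u
  · filter_upwards [hl.zero] with ω hω
    exact congrFun hω 0
  · exact hl.indep.map (ContinuousLinearMap.proj (R := ℝ) (φ := fun _ : Fin 1 => ℝ) 0)
  · intro s t
    exact (hl.stationary s t).comp (measurable_pi_apply (0 : Fin 1))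
  · intro t
    refine tendstoInMeasure_iff_dist.2 fun ε hε => ?_
    refine tendsto_of_tendsto_of_tendsto_of_le_of_le tendsto_const_nhds
      (tendstoInMeasure_iff_dist.1 (hl.stochCont t) ε hε) (fun _ => zero_le) fun s => ?_
    refine measure_mono fun ω hω => ?_
    simp only [mem_ofPred_eq] at hω ⊢
    exact hω.trans (dist_le_pi_dist (fun _ : Fin 1 => M s A ω) (fun _ : Fin 1 => M t A ω) 0)

/-- The characteristic function of the integral of a simple function. -/
lemma charFun_integral [IsProbabilityMeasure P] (h : IsDriven M lam a g ρ) (s : SimpleB X) {A : Set X}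
    (hA : MeasurableSet A) (t : ℝ≥0) (u : ℝ) :
    charFun (P.map (s.integral M t A)) u
      = Complex.exp (t * ∫ x in A, levySymbol (a x) (g x) (ρ x) (u * s.toFun x) ∂lam) := by
  have hAk : ∀ k, A ∩ s.set k ∈ borelB X := fun k => borelB.inter hA (s.mem k)
  have hm : ∀ k, AEMeasurable (M t (A ∩ s.set k)) P := fun k =>
    (M t _).aestronglyMeasurable.aemeasurable
  -- Independence is postulated for sequences of sets, so the finite family is padded with ∅.
  let B : ℕ → Set X := fun k => if hk : k < s.n then A ∩ s.set ⟨k, hk⟩ else ∅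
  have hB : ∀ k : Fin s.n, B k = A ∩ s.set k := fun k => by simp [B]
  have hind : iIndepFun (fun k : Fin s.n => (M t (A ∩ s.set k) : Ω → ℝ)) P := by
    have h1 := (h.random.infDivRandomMeasure t).indep B (fun k => by
      simp only [B]
      split_ifs
      exacts [hAk _, borelB.empty]) (by
      intro i j hij
      simp only [Function.onFun, B]
      split_ifs with hi hj
      · exact (s.disj fun h' => hij (Fin.mk.inj_iff.1 h')).mono inter_subset_right
          inter_subset_right
      all_goals simp)
    have h2 := h1.precomp (g := fun k : Fin s.n => (k : ℕ)) Fin.val_injective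
    simp only [hB] at h2
    exact h2
  have hind' : iIndepFun (fun (k : Fin s.n) ω => s.coeff k * M t (A ∩ s.set k) ω) P :=
    hind.comp (fun k y => s.coeff k * y) fun k => by fun_prop
  rw [SimpleB.integral, Measure.map_congr (coeFn_sum_smul _ _ _),
    hind'.charFun_map_fun_sum_eq_prod fun k => (hm k).const_mul _, Finset.prod_apply]
  have h3 : ∀ k, charFun (P.map fun ω => s.coeff k * M t (A ∩ s.set k) ω) u
      = Complex.exp (t * ∫ x in A ∩ s.set k, levySymbol (a x) (g x) (ρ x) (u * s.coeff k) ∂lam) :=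
    fun k => by rw [charFun_map_mul_comp (hm k), mul_comm, h.charFun_eq (hAk k)]
  simp only [h3]
  rw [← Complex.exp_sum, ← Finset.mul_sum]
  congr 2
  have h4 := s.sum_indicator_eq (fun x v => levySymbol (a x) (g x) (ρ x) (u * v))
    fun x => by rw [mul_zero, levySymbol_zero]
  simp only [h4]
  rw [integral_finsetSum]
  · refine Finset.sum_congr rfl fun k _ => ?_
    rw [setIntegral_indicator (s.mem k).1]
  · intro k _
    refine Integrable.integrableOn ?_
    rw [integrable_indicator_iff (s.mem k).1]
    exact h.triplet.integrableOn_levySymbol (h.lt_top _ (s.mem k)) _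

lemma norm_integral_levySymbol_le (h : IsDriven M lam a g ρ) {f : X → ℝ}
    (hfi : Integrable (fun x => tripletSize (a x) (g x) (ρ x) (f x)) lam) (A : Set X) (t : ℝ≥0)
    (u : ℝ) : ‖t * ∫ x in A, levySymbol (a x) (g x) (ρ x) (u * f x) ∂lam‖
      ≤ 2 * t * (∫ x in A, tripletSize (a x) (g x) (ρ x) (f x) ∂lam) * (1 + u ^ 2) := by
  have h1 : ‖∫ x in A, levySymbol (a x) (g x) (ρ x) (u * f x) ∂lam‖
      ≤ ∫ x in A, 2 * (1 + u ^ 2) * tripletSize (a x) (g x) (ρ x) (f x) ∂lam :=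
    norm_integral_le_of_norm_le (hfi.integrableOn.const_mul _)
      (ae_of_all _ fun x => h.triplet.norm_levySymbol_mul_le x u (f x))
  rw [integral_const_mul] at h1
  rw [norm_mul]
  have ht : ‖((t : ℝ) : ℂ)‖ = t := by simp
  rw [ht]
  calc _ ≤ (t : ℝ) * (2 * (1 + u ^ 2) * ∫ x in A, tripletSize (a x) (g x) (ρ x) (f x) ∂lam) :=
        mul_le_mul_of_nonneg_left h1 t.2
    _ = _ := by ring

variable [IsProbabilityMeasure P]

/-- The tail of a random variable with the characteristic function of an integral. -/
lemma measure_abs_gt_le (h : IsDriven M lam a g ρ) {f : X → ℝ}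
    (hfi : Integrable (fun x => tripletSize (a x) (g x) (ρ x) (f x)) lam) (A : Set X) (t : ℝ≥0)
    {Z : Ω →ₘ[P] ℝ} (hZ : ∀ u, charFun (P.map Z) u
      = Complex.exp (t * ∫ x in A, levySymbol (a x) (g x) (ρ x) (u * f x) ∂lam))
    {r : ℝ} (hr : 0 < r) : P {ω | r < |Z ω|} ≤ ENNReal.ofReal
      (8 * (1 + (2 / r) ^ 2) * t * ∫ x in A, tripletSize (a x) (g x) (ρ x) (f x) ∂lam) := by
  have h0 : 0 ≤ ∫ x in A, tripletSize (a x) (g x) (ρ x) (f x) ∂lam :=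
    integral_nonneg fun x => h.triplet.size_nonneg x _
  refine (measure_abs_gt_le_of_charFun Z.aestronglyMeasurable.aemeasurable (by positivity) hZ
    (fun u => h.norm_integral_levySymbol_le hfi A t u) hr).trans
    (ENNReal.ofReal_le_ofReal (le_of_eq (by ring)))

/-- Integrals of simple functions whose sizes tend to zero converge to zero in probability. -/
lemma tendstoInMeasure_zero (h : IsDriven M lam a g ρ) {κ : Type*} {l : Filter κ}
    {Z : κ → Ω →ₘ[P] ℝ} {f : κ → X → ℝ} {A : κ → Set X} {t : κ → ℝ≥0}
    (hfi : ∀ i, Integrable (fun x => tripletSize (a x) (g x) (ρ x) (f i x)) lam)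
    (hZ : ∀ i u, charFun (P.map (Z i)) u
      = Complex.exp (t i * ∫ x in A i, levySymbol (a x) (g x) (ρ x) (u * f i x) ∂lam))
    (hlim : Tendsto (fun i => t i * ∫ x in A i, tripletSize (a x) (g x) (ρ x) (f i x) ∂lam) l
      (𝓝 0)) :
    TendstoInMeasure P (fun i => (Z i : Ω → ℝ)) l 0 := by
  refine tendstoInMeasure_iff_norm.2 fun ε hε => ?_
  have h1 : Tendsto (fun i => ENNReal.ofReal (8 * (1 + (2 / (ε / 2)) ^ 2) *
      (t i * ∫ x in A i, tripletSize (a x) (g x) (ρ x) (f i x) ∂lam))) l (𝓝 0) := by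
    have := ENNReal.tendsto_ofReal (hlim.const_mul (8 * (1 + (2 / (ε / 2)) ^ 2)))
    simpa using this
  refine tendsto_of_tendsto_of_tendsto_of_le_of_le tendsto_const_nhds h1 (fun _ => zero_le)
    fun i => ?_
  refine le_trans (measure_mono fun ω hω => ?_)
    ((h.measure_abs_gt_le (hfi i) (A i) (t i) (hZ i) (half_pos hε)).trans
      (ENNReal.ofReal_le_ofReal (le_of_eq (by ring))))
  simp only [Pi.zero_apply, sub_zero, mem_ofPred_eq, Real.norm_eq_abs] at hω ⊢
  linarith

end IsDriven

end Driven

/-! ### Integrable functions -/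

section InMeasure

variable {Ω : Type*} [MeasurableSpace Ω] {P : Measure Ω} {κ : Type*} {l : Filter κ}

lemma tendstoInMeasure_add {E : Type*} [NormedAddCommGroup E] {f g : κ → Ω → E} {f' g' : Ω → E}
    (hf : TendstoInMeasure P f l f') (hg : TendstoInMeasure P g l g') :
    TendstoInMeasure P (fun i ω => f i ω + g i ω) l fun ω => f' ω + g' ω := by
  rw [tendstoInMeasure_iff_norm] at hf hg ⊢
  intro ε hε
  have h1 := (hf (ε / 2) (half_pos hε)).add (hg (ε / 2) (half_pos hε))
  rw [add_zero] at h1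
  refine tendsto_of_tendsto_of_tendsto_of_le_of_le tendsto_const_nhds h1 (fun _ => zero_le)
    fun i => (measure_mono fun ω hω => ?_).trans (measure_union_le _ _)
  simp only [mem_ofPred_eq, mem_union] at hω ⊢
  by_contra! hcon
  have := norm_add_le (f i ω - f' ω) (g i ω - g' ω)
  rw [← add_sub_add_comm] at this
  linarith

lemma tendstoInMeasure_const_mul (c : ℝ) {f : κ → Ω → ℝ} {f' : Ω → ℝ}
    (hf : TendstoInMeasure P f l f') :
    TendstoInMeasure P (fun i ω => c * f i ω) l fun ω => c * f' ω := by
  rw [tendstoInMeasure_iff_norm] at hf ⊢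
  intro ε hε
  refine tendsto_of_tendsto_of_tendsto_of_le_of_le tendsto_const_nhds
    (hf (ε / (|c| + 1)) (by positivity)) (fun _ => zero_le) fun i => measure_mono fun ω hω => ?_
  simp only [mem_ofPred_eq] at hω ⊢
  rw [div_le_iff₀ (by positivity)]
  rw [← mul_sub, norm_mul, Real.norm_eq_abs c] at hω
  nlinarith [norm_nonneg (f i ω - f' ω)]

lemma tendstoInMeasure_pi {n : ℕ} {E : Type*} [PseudoMetricSpace E] {f : κ → Ω → Fin n → E}
    {f' : Ω → Fin n → E}
    (h : ∀ k, TendstoInMeasure P (fun i ω => f i ω k) l fun ω => f' ω k) :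
    TendstoInMeasure P f l f' := by
  simp only [tendstoInMeasure_iff_dist] at h ⊢
  intro ε hε
  have h1 : Tendsto (fun i => ∑ k, P {ω | ε ≤ dist (f i ω k) (f' ω k)}) l (𝓝 0) := by
    have := tendsto_finsetSum Finset.univ fun k _ => h k ε hε
    simpa using this
  refine tendsto_of_tendsto_of_tendsto_of_le_of_le tendsto_const_nhds h1 (fun _ => zero_le)
    fun i => (measure_mono fun ω hω => ?_).trans (measure_iUnion_fintype_le _ _)
  simp only [mem_ofPred_eq, mem_iUnion] at hω ⊢
  by_contra! hcon
  exact absurd hω (not_le.2 ((dist_pi_lt_iff hε).2 hcon))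

lemma aeEqFun_eq_of_tendstoInMeasure [l.NeBot] [l.IsCountablyGenerated] {f : κ → Ω → ℝ}
    {Z Z' : Ω →ₘ[P] ℝ} (h : TendstoInMeasure P f l Z) (h' : TendstoInMeasure P f l Z') : Z = Z' :=
  AEEqFun.ext (tendstoInMeasure_ae_unique h h')

lemma tendstoInMeasure_linearCombination {Y Y' W : κ → Ω →ₘ[P] ℝ} {Z Z' : Ω →ₘ[P] ℝ} (α β : ℝ)
    (hW : ∀ i, W i = α • Y i + β • Y' i)
    (hY : TendstoInMeasure P (fun i => (Y i : Ω → ℝ)) l Z)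
    (hY' : TendstoInMeasure P (fun i => (Y' i : Ω → ℝ)) l Z') :
    TendstoInMeasure P (fun i => (W i : Ω → ℝ)) l (α • Z + β • Z' : Ω →ₘ[P] ℝ) := by
  have key : ∀ Y Y' : Ω →ₘ[P] ℝ, ((α • Y + β • Y' : Ω →ₘ[P] ℝ) : Ω → ℝ)
      =ᵐ[P] fun ω => α * Y ω + β * Y' ω := by
    intro Y Y'
    filter_upwards [AEEqFun.coeFn_add (α • Y) (β • Y'), AEEqFun.coeFn_smul α Y,
      AEEqFun.coeFn_smul β Y'] with ω h1 h2 h3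
    rw [h1, Pi.add_apply, h2, h3]
    rfl
  simp only [hW]
  exact (tendstoInMeasure_add (tendstoInMeasure_const_mul α hY)
    (tendstoInMeasure_const_mul β hY')).congr (fun i => (key _ _).symm) (key _ _).symm

end InMeasure

-- Existence and uniqueness of the integral

section Integrable

variable {Ω : Type*} [MeasurableSpace Ω] {P : Measure Ω} [IsProbabilityMeasure P]
variable {X : Type*} [TopologicalSpace X] [MeasurableSpace X]
variable {M : ℝ≥0 → Set X → Ω →ₘ[P] ℝ} {lam : Measure X} {a g : X → ℝ} {ρ : Kernel X ℝ}

/-- An exhaustion of the space by sets in `borelB`, up to a null set. -/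
def IsExhaustion (lam : Measure X) (K : ℕ → Set X) : Prop :=
  Monotone K ∧ (∀ n, K n ∈ borelB X) ∧ lam (⋃ n, K n)ᶜ = 0

lemma IsExhaustion.ae_eventually_mem {K : ℕ → Set X} (hK : IsExhaustion lam K) :
    ∀ᵐ x ∂lam, ∀ᶠ n in atTop, x ∈ K n := by
  filter_upwards [compl_mem_ae_iff.2 hK.2.2] with x hx
  obtain ⟨n, hn⟩ := mem_iUnion.1 (not_not.1 hx)
  exact eventually_atTop.2 ⟨n, fun m hm => hK.1 hm hn⟩

/-- The restriction of a simple function to a relatively compact set. -/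
lemma exists_simpleB (φ : SimpleFunc X ℝ) {K : Set X} (hK : K ∈ borelB X) :
    ∃ s : SimpleB X, s.toFun = K.indicator φ := by
  classical
  have hd : Pairwise (Function.onFun Disjoint fun v : φ.range => φ ⁻¹' {(v : ℝ)} ∩ K) := by
    intro v w hvw
    refine Disjoint.mono inter_subset_left inter_subset_left ?_
    refine disjoint_left.2 fun x hx hx' => hvw (Subtype.ext ?_)
    exact (mem_singleton_iff.1 hx).symm.trans (mem_singleton_iff.1 hx')
  refine ⟨SimpleB.ofFintype (fun v : φ.range => (v : ℝ)) _
    (fun v => borelB.inter (φ.measurableSet_preimage _) hK) hd, ?_⟩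
  · ext x
    rw [SimpleB.toFun_ofFintype]
    by_cases hx : x ∈ K
    · rw [indicator_of_mem hx, Finset.sum_eq_single ⟨φ x, φ.mem_range_self x⟩]
      · rw [indicator_of_mem]
        exact ⟨rfl, hx⟩
      · intro v _ hv
        rw [indicator_of_notMem]
        rintro ⟨h, -⟩
        exact hv (Subtype.ext (mem_singleton_iff.1 h).symm)
      · simp
    · rw [indicator_of_notMem hx, Finset.sum_eq_zero]
      intro v _
      rw [indicator_of_notMem]
      exact fun h => hx h.2

/-- Measurable functions are limits of dominated simple functions. -/
lemma exists_seq_simpleB {K : ℕ → Set X} (hK : IsExhaustion lam K) {f : X → ℝ}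
    (hf : Measurable f) : ∃ s : ℕ → SimpleB X, (∀ n x, |(s n).toFun x| ≤ 2 * |f x|) ∧
      ∀ᵐ x ∂lam, Tendsto (fun n => (s n).toFun x) atTop (𝓝 (f x)) := by
  choose s hs using fun n => exists_simpleB (SimpleFunc.approxOn f hf univ 0 (mem_univ _) n)
    (hK.2.1 n)
  refine ⟨s, fun n x => ?_, ?_⟩
  · have h1 := SimpleFunc.norm_approxOn_zero_le hf (mem_univ (0 : ℝ)) x n
    rw [Real.norm_eq_abs, Real.norm_eq_abs] at h1
    rw [hs]
    by_cases hx : x ∈ K n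
    · rw [indicator_of_mem hx]
      linarith
    · rw [indicator_of_notMem hx, abs_zero]
      positivity
  · filter_upwards [hK.ae_eventually_mem] with x hx
    refine (SimpleFunc.tendsto_approxOn hf (mem_univ (0 : ℝ)) (x := x) (by simp)).congr' ?_
    filter_upwards [hx] with n hn
    rw [hs, indicator_of_mem hn]

namespace IsDriven

/-- Dominated simple approximations of a function of integrable size have convergent integrals. -/
lemma exists_tendsto_integral (h : IsDriven M lam a g ρ) {f : X → ℝ}
    (hf : Integrable (fun x => tripletSize (a x) (g x) (ρ x) (f x)) lam)
    {s : ℕ → SimpleB X} (hsf : ∀ n x, |(s n).toFun x| ≤ 2 * |f x|)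
    (hlim : ∀ᵐ x ∂lam, Tendsto (fun n => (s n).toFun x) atTop (𝓝 (f x))) {A : Set X}
    (hA : MeasurableSet A) (t : ℝ≥0) :
    ∃ Z : Ω →ₘ[P] ℝ, TendstoInMeasure P (fun n => ((s n).integral M t A : Ω → ℝ)) atTop Z := by
  -- The simple function with index (n, m) is sₙ - sₘ. Its size tends to 0 along ℕ × ℕ, so the
  -- integrals are Cauchy in probability.
  choose q hq hqi using fun k : ℕ × ℕ =>
    (s k.1).exists_linearCombination (Ω := Ω) (s k.2) 1 (-1)
  have hqf : ∀ k x, |(q k).toFun x| ≤ 4 * |f x| := by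
    intro k x
    rw [hq, one_mul, neg_one_mul, ← sub_eq_add_neg]
    have := abs_sub ((s k.1).toFun x) ((s k.2).toFun x)
    linarith [hsf k.1 x, hsf k.2 x]
  have hqlim : ∀ᵐ x ∂lam, Tendsto (fun k => (q k).toFun x) atTop (𝓝 0) := by
    filter_upwards [hlim] with x hx
    have h1 := (hx.comp tendsto_fst).sub (hx.comp tendsto_snd)
    rw [prod_atTop_atTop_eq, sub_self] at h1
    refine h1.congr fun k => ?_
    simp only [hq, Function.comp_apply]
    ring
  have h2 := h.triplet.tendsto_integral_size hf (fun k => (q k).measurable_toFun) hqf hqlim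
  have h3 : TendstoInMeasure P (fun k => ((q k).integral M t A : Ω → ℝ)) atTop 0 := by
    refine h.tendstoInMeasure_zero (f := fun k => (q k).toFun) (A := fun _ => A) (t := fun _ => t)
      (fun k => h.integrable_size_simple _) (fun k u => h.charFun_integral _ hA t u) ?_
    have h4 := h2.const_mul (t : ℝ)
    rw [mul_zero] at h4
    refine squeeze_zero (fun k => mul_nonneg t.2 (integral_nonneg fun x => h.triplet.size_nonneg x _))
      (fun k => mul_le_mul_of_nonneg_left (setIntegral_le_integral (h.integrable_size_simple _)
        (ae_of_all _ fun x => h.triplet.size_nonneg x _)) t.2) h4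
  refine exists_tendstoInMeasure_of_cauchy (fun n => AEEqFun.aestronglyMeasurable _)
    fun ε hε δ hδ => ?_
  obtain ⟨⟨N₁, N₂⟩, hN⟩ := eventually_atTop.1
    (ENNReal.tendsto_nhds_zero.1 (tendstoInMeasure_iff_norm.1 h3 ε hε) δ hδ)
  refine ⟨max N₁ N₂, fun n hn m hm => le_trans (le_of_eq (measure_congr ?_))
    (hN (n, m) ⟨le_of_max_le_left hn, le_of_max_le_right hm⟩)⟩
  have h5 := hqi (n, m) P M t A (h.random.infDivRandomMeasure t) hA
  rw [one_smul, neg_one_smul, ← sub_eq_add_neg] at h5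
  rw [h5]
  filter_upwards [AEEqFun.coeFn_sub ((s n).integral M t A) ((s m).integral M t A)] with ω hω
  refine propext ?_
  change ε ≤ _ ↔ ε ≤ _
  rw [hω, Pi.zero_apply, sub_zero]
  rfl

lemma exists_isApprox (h : IsDriven M lam a g ρ) {K : ℕ → Set X} (hK : IsExhaustion lam K)
    {f : X → ℝ} (hfm : Measurable f)
    (hf : Integrable (fun x => tripletSize (a x) (g x) (ρ x) (f x)) lam) :
    ∃ s : ℕ → SimpleB X, IsApprox M lam f s ∧ ∀ n x, |(s n).toFun x| ≤ 2 * |f x| := by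
  obtain ⟨s, hs, hlim⟩ := exists_seq_simpleB hK hfm
  exact ⟨s, ⟨hlim, fun A hA t => h.exists_tendsto_integral hf hs hlim hA t⟩, hs⟩

/-- The characteristic function of the limit of the integrals of dominated approximations. -/
lemma charFun_limit (h : IsDriven M lam a g ρ) {f : X → ℝ}
    (hf : Integrable (fun x => tripletSize (a x) (g x) (ρ x) (f x)) lam)
    {s : ℕ → SimpleB X} (hsf : ∀ n x, |(s n).toFun x| ≤ 2 * |f x|)
    (hlim : ∀ᵐ x ∂lam, Tendsto (fun n => (s n).toFun x) atTop (𝓝 (f x))) {A : Set X}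
    (hA : MeasurableSet A) (t : ℝ≥0) {Z : Ω →ₘ[P] ℝ}
    (hZ : TendstoInMeasure P (fun n => ((s n).integral M t A : Ω → ℝ)) atTop Z) (u : ℝ) :
    charFun (P.map Z) u
      = Complex.exp (t * ∫ x in A, levySymbol (a x) (g x) (ρ x) (u * f x) ∂lam) := by
  refine tendsto_nhds_unique (tendsto_charFun_of_tendstoInMeasure hZ
    (fun n => (AEEqFun.aestronglyMeasurable _).aemeasurable) u) ?_
  simp only [h.charFun_integral _ hA]
  exact (Complex.continuous_exp.tendsto _).comp
    ((h.triplet.tendsto_integral_levySymbol hf (fun n => (s n).measurable_toFun) hsf hlim A u).const_mul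
      _)

/-- Integrals of a sequence of simple functions which converges to `0` almost everywhere have limit
`0`, provided that the integrals over all measurable sets converge. -/
lemma eq_zero_of_isApprox_zero (h : IsDriven M lam a g ρ) {K : ℕ → Set X}
    (hK : IsExhaustion lam K) {d : ℕ → SimpleB X} (hd : IsApprox M lam 0 d) (t : ℝ≥0)
    {Z : Ω →ₘ[P] ℝ}
    (hZ : TendstoInMeasure P (fun n => ((d n).integral M t univ : Ω → ℝ)) atTop Z) : Z = 0 := by
  let σ : ℕ → X → ℝ := fun n x => tripletSize (a x) (g x) (ρ x) ((d n).toFun x)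
  have hσ0 : ∀ n x, 0 ≤ σ n x := fun n x => h.triplet.size_nonneg x _
  have hσ : ∀ n, Integrable (σ n) lam := fun n => h.integrable_size_simple (d n)
  -- On E m the d n with n ≥ m are bounded by 1 and the measure is finite, so their sizes converge
  -- dominatedly to 0. The sets increase to almost everything, so each single d n has small size off
  -- E m for large m.
  let E : ℕ → Set X := fun m => K m ∩ ⋂ n ≥ m, {x | |(d n).toFun x| ≤ 1}
  have hEm : ∀ m, MeasurableSet (E m) := fun m => (hK.2.1 m).1.inter
    (MeasurableSet.biInter (to_countable _) fun n _ =>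
      measurableSet_le (d n).measurable_toFun.abs measurable_const)
  have hEmono : Monotone E := fun m m' hm x hx => by
    refine ⟨hK.1 hm hx.1, ?_⟩
    have hx2 := hx.2
    simp only [mem_iInter] at hx2 ⊢
    exact fun n hn => hx2 n (le_trans hm hn)
  have hEae : ∀ᵐ x ∂lam, ∃ m, x ∈ E m := by
    filter_upwards [hK.ae_eventually_mem, hd.1] with x hx hx'
    have h1 : ∀ᶠ n in atTop, |(d n).toFun x| ≤ 1 := by
      have := (hx'.abs).eventually_lt_const (u := 1) (by simp)
      exact this.mono fun n hn => hn.le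
    obtain ⟨m₁, hm₁⟩ := eventually_atTop.1 h1
    obtain ⟨m₂, hm₂⟩ := eventually_atTop.1 hx
    refine ⟨max m₁ m₂, hm₂ _ (le_max_right _ _), ?_⟩
    simp only [mem_iInter]
    exact fun n hn => hm₁ n (le_trans (le_max_left _ _) hn)
  have hin : ∀ m, Tendsto (fun n => ∫ x in E m, σ n x ∂lam) atTop (𝓝 0) := by
    intro m
    have h0 : (0 : ℝ) = ∫ _ in E m, (0 : ℝ) ∂lam := by simp
    rw [h0]
    refine tendsto_integral_filter_of_dominated_convergence (fun _ => 6 * (1 + 1 ^ 2))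
      (Eventually.of_forall fun n => (hσ n).aestronglyMeasurable.restrict) ?_
      (integrableOn_const ((measure_mono inter_subset_left).trans_lt
        (h.lt_top _ (hK.2.1 m))).ne) (ae_restrict_of_ae ?_)
    · filter_upwards [eventually_ge_atTop m] with n hn
      rw [ae_restrict_iff' (hEm m)]
      filter_upwards [h.triplet.size_le (C := 1)] with x hx hxE
      rw [Real.norm_of_nonneg (hσ0 n x)]
      have hx2 := hxE.2
      simp only [mem_iInter] at hx2
      exact hx _ (hx2 n hn)
    · filter_upwards [hd.1] with x hx
      exact (tendsto_tripletSize_zero (h.triplet.integrable_min x) _ _).comp hx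
  have hout : ∀ n, Tendsto (fun m => ∫ x in (E m)ᶜ, σ n x ∂lam) atTop (𝓝 0) := by
    intro n
    have h1 := tendsto_setIntegral_of_antitone (f := σ n) (μ := lam) (s := fun m => (E m)ᶜ)
      (fun m => (hEm m).compl) (fun m m' hm => compl_subset_compl.2 (hEmono hm))
      ⟨0, (hσ n).integrableOn⟩
    have h2 : lam (⋂ m, (E m)ᶜ) = 0 := by
      rw [← compl_iUnion]
      refine measure_mono_null (fun x hx => ?_) (ae_iff.1 hEae)
      simpa using hx
    rwa [Measure.restrict_eq_zero.2 h2, integral_zero_measure] at h1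
  have hN : ∀ m j : ℕ, ∃ n, j ≤ n ∧ ∫ x in E m, σ n x ∂lam ≤ 1 / ((j : ℝ) + 1) := by
    intro m j
    have h1 := (hin m).eventually_lt_const (u := 1 / ((j : ℝ) + 1)) (by positivity)
    obtain ⟨n, hn1, hn2⟩ := (h1.and (eventually_ge_atTop j)).exists
    exact ⟨n, hn2, hn1.le⟩
  choose N hNj hN using hN
  have hM' : ∀ m n j : ℕ, ∃ m', m ≤ m' ∧ ∫ x in (E m')ᶜ, σ n x ∂lam ≤ 1 / ((j : ℝ) + 1) := by
    intro m n j
    have h1 := (hout n).eventually_lt_const (u := 1 / ((j : ℝ) + 1)) (by positivity)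
    obtain ⟨m', hn1, hn2⟩ := (h1.and (eventually_ge_atTop m)).exists
    exact ⟨m', hn2, hn1.le⟩
  choose m' hmm' hm' using hM'
  -- Gliding hump: m j determines n j, for which the size on E (m j) is small; then m (j + 1) is
  -- taken so large that the size of the same function off E (m (j + 1)) is small. What remains sits
  -- on an annulus.
  let m : ℕ → ℕ := fun j => Nat.rec 0 (fun j mj => m' mj (N mj j) j) j
  have hm_succ : ∀ j, m (j + 1) = m' (m j) (N (m j) j) j := fun j => rfl
  have hm_mono : Monotone m := monotone_nat_of_le_succ fun j => by rw [hm_succ]; exact hmm' _ _ _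
  let n : ℕ → ℕ := fun j => N (m j) j
  have hn : Tendsto n atTop atTop := tendsto_atTop_mono (fun j => hNj (m j) j) tendsto_id
  let R : ℕ → Set X := fun j => E (m j) ∪ (E (m (j + 1)))ᶜ
  have hR : ∀ j, ∫ x in R j, σ (n j) x ∂lam ≤ 2 * (1 / ((j : ℝ) + 1)) := by
    intro j
    have h1 := hN (m j) j
    have h2 := hm' (m j) (n j) j
    have h3 : ∫ x in R j, σ (n j) x ∂lam
        = ∫ x in E (m j), σ (n j) x ∂lam + ∫ x in (E (m (j + 1)))ᶜ, σ (n j) x ∂lam :=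
      setIntegral_union (disjoint_compl_right.mono_left (hEmono (hm_mono (Nat.le_succ j))))
        (hEm _).compl (hσ _).integrableOn (hσ _).integrableOn
    rw [h3, two_mul]
    exact add_le_add h1 (by rw [hm_succ]; exact h2)
  have hRlim : Tendsto (fun j : ℕ => 2 * (1 / ((j : ℝ) + 1))) atTop (𝓝 0) := by
    simpa using (tendsto_one_div_add_atTop_nhds_zero_nat (𝕜 := ℝ)).const_mul 2
  -- D is the union of the even annuli. Functions of odd index have their hump outside D, those of
  -- even index outside Dᶜ.
  let D : Set X := ⋃ i, E (m (2 * i + 1)) \ E (m (2 * i))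
  have hDm : MeasurableSet D := MeasurableSet.iUnion fun i => (hEm _).diff (hEm _)
  have heven : ∀ i, Dᶜ ⊆ R (2 * i) := by
    intro i x hx
    by_contra hxR
    simp only [R, mem_union, mem_compl_iff, not_or, not_not] at hxR
    exact hx (mem_iUnion.2 ⟨i, hxR.2, hxR.1⟩)
  have hodd : ∀ i, D ⊆ R (2 * i + 1) := by
    intro i x hx
    obtain ⟨k, hk1, hk2⟩ := mem_iUnion.1 hx
    rcases le_or_gt k i with hki | hki
    · exact Or.inl (hEmono (hm_mono (show 2 * k + 1 ≤ 2 * i + 1 by omega)) hk1)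
    · exact Or.inr fun hx' => hk2 (hEmono (hm_mono (show 2 * i + 1 + 1 ≤ 2 * k by omega)) hx')
  have key : ∀ (j : ℕ → ℕ) (B : Set X), Tendsto j atTop atTop → MeasurableSet B →
      (∀ i, B ⊆ R (j i)) →
      TendstoInMeasure P (fun i => ((d (n (j i))).integral M t B : Ω → ℝ)) atTop 0 := by
    intro j B hj hB hBR
    refine h.tendstoInMeasure_zero (f := fun i => (d (n (j i))).toFun) (A := fun _ => B)
      (t := fun _ => t) (fun k => hσ _) (fun k u => h.charFun_integral _ hB t u) ?_
    have h4 := (hRlim.comp hj).const_mul (t : ℝ)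
    rw [mul_zero] at h4
    refine squeeze_zero (fun k => mul_nonneg t.2 (integral_nonneg fun x => hσ0 _ x))
      (fun i => mul_le_mul_of_nonneg_left ?_ t.2) h4
    exact (setIntegral_mono_set (hσ _).integrableOn (ae_of_all _ fun x => hσ0 _ x)
      (ae_of_all _ (hBR i))).trans (hR (j i))
  have hj0 : Tendsto (fun i : ℕ => 2 * i) atTop atTop := tendsto_id.const_mul_atTop' two_pos
  have hj1 : Tendsto (fun i : ℕ => 2 * i + 1) atTop atTop := (tendsto_add_atTop_nat 1).comp hj0
  -- Here convergence over the set D is essential: the odd subsequence identifies the limit over D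
  -- as 0. Along the even subsequence the integrals over D and Dᶜ both tend to 0, hence so does the
  -- total.
  obtain ⟨W, hW⟩ := hd.2 D hDm t
  have hz : ((0 : Ω →ₘ[P] ℝ) : Ω → ℝ) =ᵐ[P] 0 := AEEqFun.coeFn_zero
  have hW0 : W = 0 := aeEqFun_eq_of_tendstoInMeasure (hW.comp (hn.comp hj1))
    ((key _ D hj1 hDm hodd).congr_right hz.symm)
  subst hW0
  refine aeEqFun_eq_of_tendstoInMeasure (hZ.comp (hn.comp hj0)) ?_
  have h6 := tendstoInMeasure_linearCombination 1 1
    (W := fun i => (d (n (2 * i))).integral M t univ)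
    (Y := fun i => (d (n (2 * i))).integral M t D)
    (Y' := fun i => (d (n (2 * i))).integral M t Dᶜ) (fun i => by
      rw [one_smul, one_smul, ← (d _).integral_union (h.random.infDivRandomMeasure t) hDm hDm.compl
        disjoint_compl_right, union_compl_self])
    (hW.comp (hn.comp hj0)) ((key _ Dᶜ hj0 hDm.compl heven).congr_right hz.symm)
  simpa using! h6

end IsDriven

end Integrable

/-! ### The integral as a Lévy process -/

section Limits

variable {Ω : Type*} [MeasurableSpace Ω] {P : Measure Ω} [IsProbabilityMeasure P]
variable {E : Type*} [NormedAddCommGroup E] [NormedSpace ℝ E] [CompleteSpace E]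
  [MeasurableSpace E] [BorelSpace E] [SecondCountableTopology E]

/-- Independence is the factorisation of the joint characteristic functional, an identity preserved
by limits in probability. -/
lemma iIndepFun_of_tendstoInMeasure {k : ℕ} {X : ℕ → Fin k → Ω → E} {Z : Fin k → Ω → E}
    (hX : ∀ n j, AEMeasurable (X n j) P) (hind : ∀ n, iIndepFun (X n) P)
    (hlim : ∀ j, TendstoInMeasure P (fun n => X n j) atTop (Z j)) : iIndepFun Z P := by
  have hZ : ∀ j, AEMeasurable (Z j) P := fun j => (hlim j).aemeasurable fun n => hX n j
  rw [iIndepFun_iff_charFunDual_pi hZ]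
  intro ℓ
  have h1 : TendstoInMeasure P (fun n ω j => X n j ω) atTop fun ω j => Z j ω :=
    tendstoInMeasure_pi hlim
  refine tendsto_nhds_unique (tendsto_charFunDual_of_tendstoInMeasure h1
    (fun n => aemeasurable_pi_lambda _ fun j => hX n j) ℓ) ?_
  simp only [fun n => (iIndepFun_iff_charFunDual_pi (hX n)).1 (hind n) ℓ]
  exact tendsto_finsetProd _ fun j _ =>
    tendsto_charFunDual_of_tendstoInMeasure (hlim j) (fun n => hX n j) _

lemma identDistrib_of_tendstoInMeasure {X Y : ℕ → Ω → E} {Z W : Ω → E}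
    (hX : ∀ n, AEMeasurable (X n) P) (hXY : ∀ n, IdentDistrib (X n) (Y n) P P)
    (hZ : TendstoInMeasure P X atTop Z) (hW : TendstoInMeasure P Y atTop W) :
    IdentDistrib Z W P P := by
  have hY : ∀ n, AEMeasurable (Y n) P := fun n => (hXY n).aemeasurable_snd
  have hZm := hZ.aemeasurable hX
  have hWm := hW.aemeasurable hY
  have : IsProbabilityMeasure (P.map Z) := Measure.isProbabilityMeasure_map hZm
  have : IsProbabilityMeasure (P.map W) := Measure.isProbabilityMeasure_map hWm
  refine ⟨hZm, hWm, Measure.ext_of_charFunDual (funext fun ℓ => ?_)⟩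
  refine tendsto_nhds_unique (tendsto_charFunDual_of_tendstoInMeasure hZ hX ℓ) ?_
  simp only [fun n => (hXY n).map_eq]
  exact tendsto_charFunDual_of_tendstoInMeasure hW hY ℓ

end Limits

section LevyProcess

variable {Ω : Type*} [MeasurableSpace Ω] {P : Measure Ω}
variable {X : Type*} [TopologicalSpace X] [MeasurableSpace X]
variable {M : ℝ≥0 → Set X → Ω →ₘ[P] ℝ} {lam : Measure X} {a g : X → ℝ} {ρ : Kernel X ℝ}

lemma IsApprox.congr {f f' : X → ℝ} (h : f =ᵐ[lam] f') {s : ℕ → SimpleB X}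
    (hs : IsApprox M lam f s) : IsApprox M lam f' s := by
  refine ⟨?_, hs.2⟩
  filter_upwards [h, hs.1] with x hx hx'
  rwa [← hx]

lemma IsMIntegral.congr {f f' : X → ℝ} (h : f =ᵐ[lam] f') {t : ℝ≥0} {A : Set X} {Z : Ω →ₘ[P] ℝ}
    (hZ : IsMIntegral M lam t A f Z) : IsMIntegral M lam t A f' Z :=
  let ⟨s, hs, hsZ⟩ := hZ
  ⟨s, hs.congr h, hsZ⟩

/-- Linear combinations of admissible approximating sequences. -/
lemma IsApprox.exists_linearCombination (hM : IsLevyRandomMeasure M) {f f' : X → ℝ}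
    {s r : ℕ → SimpleB X} (hs : IsApprox M lam f s) (hr : IsApprox M lam f' r) (α β : ℝ) :
    ∃ q : ℕ → SimpleB X, IsApprox M lam (fun x => α * f x + β * f' x) q ∧
      ∀ (t : ℝ≥0) (A : Set X) (Z Z' : Ω →ₘ[P] ℝ), MeasurableSet A →
        TendstoInMeasure P (fun n => ((s n).integral M t A : Ω → ℝ)) atTop Z →
        TendstoInMeasure P (fun n => ((r n).integral M t A : Ω → ℝ)) atTop Z' →
        TendstoInMeasure P (fun n => ((q n).integral M t A : Ω → ℝ)) atTop
          (α • Z + β • Z' : Ω →ₘ[P] ℝ) := by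
  choose q hq hqi using fun n => (s n).exists_linearCombination (Ω := Ω) (r n) α β
  have key : ∀ (t : ℝ≥0) (A : Set X) (Z Z' : Ω →ₘ[P] ℝ), MeasurableSet A →
      TendstoInMeasure P (fun n => ((s n).integral M t A : Ω → ℝ)) atTop Z →
      TendstoInMeasure P (fun n => ((r n).integral M t A : Ω → ℝ)) atTop Z' →
      TendstoInMeasure P (fun n => ((q n).integral M t A : Ω → ℝ)) atTop
        (α • Z + β • Z' : Ω →ₘ[P] ℝ) := fun t A Z Z' hA hZ hZ' =>
    tendstoInMeasure_linearCombination α β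
      (fun n => hqi n P M t A (hM.infDivRandomMeasure t) hA) hZ hZ'
  refine ⟨q, ⟨?_, fun A hA t => ?_⟩, key⟩
  · filter_upwards [hs.1, hr.1] with x hx hx'
    simp only [hq]
    exact (hx.const_mul α).add (hx'.const_mul β)
  · obtain ⟨Z, hZ⟩ := hs.2 A hA t
    obtain ⟨Z', hZ'⟩ := hr.2 A hA t
    exact ⟨_, key t A Z Z' hA hZ hZ'⟩

lemma IsMIntegral.linearCombination (hM : IsLevyRandomMeasure M) {f f' : X → ℝ} {t : ℝ≥0}
    {A : Set X} (hA : MeasurableSet A) {Z Z' : Ω →ₘ[P] ℝ} (hZ : IsMIntegral M lam t A f Z)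
    (hZ' : IsMIntegral M lam t A f' Z') (α β : ℝ) :
    IsMIntegral M lam t A (fun x => α * f x + β * f' x) (α • Z + β • Z') := by
  obtain ⟨s, hs, hsZ⟩ := hZ
  obtain ⟨r, hr, hrZ⟩ := hZ'
  obtain ⟨q, hq, hqZ⟩ := hs.exists_linearCombination hM hr α β
  exact ⟨q, hq, hqZ t A Z Z' hA hsZ hrZ⟩

/-- The integrals of finitely many simple functions form a process with independent and stationary
increments. -/
lemma IsLevyRandomMeasure.simple (hM : IsLevyRandomMeasure M) {n : ℕ} (r : Fin n → SimpleB X) :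
    HasIndepIncrements (fun t ω i => (r i).integral M t univ ω) P ∧
    ∀ s t : ℝ≥0, IdentDistrib
      (fun ω i => (r i).integral M (s + t) univ ω - (r i).integral M s univ ω)
      (fun ω i => (r i).integral M t univ ω) P P := by
  -- All sets of all the simple functions form one finite family, on which M is a Lévy process. The
  -- integrals are its image under the fixed linear map T; overlaps between the sets do not matter.
  let e := Fintype.equivFin (Σ i, Fin (r i).n)
  let D : (Σ i, Fin (r i).n) → Set X := fun p => (r p.1).set p.2
  let A : Fin (Fintype.card (Σ i, Fin (r i).n)) → Set X := fun j => D (e.symm j)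
  have hA : ∀ i k, A (e ⟨i, k⟩) = (r i).set k := fun i k =>
    congrArg D (e.symm_apply_apply ⟨i, k⟩)
  have hl := hM.levy _ A fun j => (r _).mem _
  let T : (Fin (Fintype.card (Σ i, Fin (r i).n)) → ℝ) →L[ℝ] (Fin n → ℝ) :=
    ContinuousLinearMap.pi fun i => ∑ k, (r i).coeff k • ContinuousLinearMap.proj (e ⟨i, k⟩)
  have hT : ∀ t, (fun ω i => (r i).integral M t univ ω)
      =ᵐ[P] fun ω => T fun j => M t (A j) ω := by
    intro t
    have h1 : ∀ i, ∀ᵐ ω ∂P, (r i).integral M t univ ω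
        = ∑ k, (r i).coeff k * M t (univ ∩ (r i).set k) ω := fun i =>
      coeFn_sum_smul Finset.univ _ _
    filter_upwards [ae_all_iff.2 h1] with ω hω
    ext i
    rw [hω]
    simp [T, hA]
  constructor
  · intro k t ht
    refine ((hl.indep.map T) k t ht).congr fun i => ?_
    filter_upwards [hT (t i.succ), hT (t i.castSucc)] with ω h1 h2
    rw [← h1, ← h2]
  · intro s t
    have h1 := (hl.stationary s t).comp T.measurable
    have h3 : (fun ω i => (r i).integral M (s + t) univ ω - (r i).integral M s univ ω)
        =ᵐ[P] T ∘ fun ω j => M (s + t) (A j) ω - M s (A j) ω := by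
      filter_upwards [hT (s + t), hT s] with ω h2 h3
      have h4 : (fun j => M (s + t) (A j) ω - M s (A j) ω)
          = (fun j => M (s + t) (A j) ω) - fun j => M s (A j) ω := rfl
      rw [Function.comp_apply, h4, map_sub, ← h2, ← h3]
      rfl
    exact ⟨h1.aemeasurable_fst.congr h3.symm, h1.aemeasurable_snd.congr (hT t).symm, by
      rw [Measure.map_congr h3, Measure.map_congr (hT t)]
      exact h1.map_eq⟩

namespace IsDriven

variable [IsProbabilityMeasure P]

/-- The difference of two admissible sequences for f is admissible for 0. -/
lemma isMIntegral_unique (h : IsDriven M lam a g ρ) {K : ℕ → Set X} (hK : IsExhaustion lam K)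
    {f : X → ℝ} {t : ℝ≥0} {Z Z' : Ω →ₘ[P] ℝ} (hZ : IsMIntegral M lam t univ f Z)
    (hZ' : IsMIntegral M lam t univ f Z') : Z = Z' := by
  obtain ⟨q, hq, hqZ⟩ := hZ.linearCombination h.random MeasurableSet.univ hZ' 1 (-1)
  have h0 : (fun x => 1 * f x + -1 * f x) = 0 := by
    ext x
    simp
  rw [h0] at hq
  have h1 := h.eq_zero_of_isApprox_zero hK hq t hqZ
  rwa [one_smul, neg_one_smul, ← sub_eq_add_neg, sub_eq_zero] at h1

lemma isMIntegral_mIntegral (h : IsDriven M lam a g ρ) {K : ℕ → Set X} (hK : IsExhaustion lam K)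
    {f : X → ℝ} (hfm : Measurable f)
    (hf : Integrable (fun x => tripletSize (a x) (g x) (ρ x) (f x)) lam) (t : ℝ≥0) :
    IsMIntegral M lam t univ f (mIntegral M lam t univ f) := by
  obtain ⟨s, hs, -⟩ := h.exists_isApprox hK hfm hf
  obtain ⟨Z, hZ⟩ := hs.2 univ MeasurableSet.univ t
  have hex : ∃ Z, IsMIntegral M lam t univ f Z := ⟨Z, s, hs, hZ⟩
  rw [mIntegral, dif_pos hex]
  exact hex.choose_spec

/-- Every admissible sequence of `f` has integrals converging to the integral of `f`. -/
lemma tendsto_mIntegral (h : IsDriven M lam a g ρ) {K : ℕ → Set X} (hK : IsExhaustion lam K)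
    {f : X → ℝ} (hfm : Measurable f)
    (hf : Integrable (fun x => tripletSize (a x) (g x) (ρ x) (f x)) lam) {s : ℕ → SimpleB X}
    (hs : IsApprox M lam f s) (t : ℝ≥0) :
    TendstoInMeasure P (fun n => ((s n).integral M t univ : Ω → ℝ)) atTop
      (mIntegral M lam t univ f) := by
  obtain ⟨Z, hZ⟩ := hs.2 univ MeasurableSet.univ t
  rwa [h.isMIntegral_unique hK (h.isMIntegral_mIntegral hK hfm hf t) ⟨s, hs, hZ⟩]

/-- Uniqueness of the integral allows the computation along a dominated sequence, where the
exponents converge. -/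
lemma charFun_mIntegral (h : IsDriven M lam a g ρ) {K : ℕ → Set X} (hK : IsExhaustion lam K)
    {f : X → ℝ} (hfm : Measurable f)
    (hf : Integrable (fun x => tripletSize (a x) (g x) (ρ x) (f x)) lam) (t : ℝ≥0) (u : ℝ) :
    charFun (P.map (mIntegral M lam t univ f)) u
      = Complex.exp (t * ∫ x in univ, levySymbol (a x) (g x) (ρ x) (u * f x) ∂lam) := by
  obtain ⟨s, hs, hsf⟩ := h.exists_isApprox hK hfm hf
  exact h.charFun_limit hf hsf hs.1 MeasurableSet.univ t (h.tendsto_mIntegral hK hfm hf hs t) u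

lemma mIntegral_zero_time (h : IsDriven M lam a g ρ) {K : ℕ → Set X} (hK : IsExhaustion lam K)
    {f : X → ℝ} (hfm : Measurable f)
    (hf : Integrable (fun x => tripletSize (a x) (g x) (ρ x) (f x)) lam) :
    mIntegral M lam 0 univ f = 0 := by
  have h1 : TendstoInMeasure P (fun _ : ℕ => (mIntegral M lam 0 univ f : Ω → ℝ)) atTop 0 :=
    h.tendstoInMeasure_zero (f := fun _ => f) (A := fun _ => univ) (t := fun _ => 0)
      (fun _ => hf) (fun _ u => h.charFun_mIntegral hK hfm hf 0 u) (by simp)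
  refine aeEqFun_eq_of_tendstoInMeasure (tendstoInMeasure_of_tendsto_ae
    (fun _ => AEEqFun.aestronglyMeasurable _) (ae_of_all _ fun ω => tendsto_const_nhds))
    (h1.congr_right AEEqFun.coeFn_zero.symm)

/-- The integrals of finitely many functions form a Lévy process. -/
lemma isLevyProcess_mIntegral (h : IsDriven M lam a g ρ) {K : ℕ → Set X}
    (hK : IsExhaustion lam K) {n : ℕ} {f : Fin n → X → ℝ} (hfm : ∀ i, Measurable (f i))
    (hf : ∀ i, Integrable (fun x => tripletSize (a x) (g x) (ρ x) (f i x)) lam) :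
    IsLevyProcess (fun t ω i => mIntegral M lam t univ (f i) ω) P := by
  choose s hs _ using fun i => h.exists_isApprox hK (hfm i) (hf i)
  have hlim : ∀ i t, TendstoInMeasure P (fun n => ((s i n).integral M t univ : Ω → ℝ)) atTop
      (mIntegral M lam t univ (f i)) := fun i t =>
    h.tendsto_mIntegral hK (hfm i) (hf i) (hs i) t
  have hlim' : ∀ i t t', TendstoInMeasure P
      (fun n ω => (s i n).integral M t univ ω - (s i n).integral M t' univ ω) atTop
      fun ω => mIntegral M lam t univ (f i) ω - mIntegral M lam t' univ (f i) ω := by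
    intro i t t'
    have := tendstoInMeasure_add (hlim i t) (tendstoInMeasure_const_mul (-1) (hlim i t'))
    simpa only [neg_one_mul, ← sub_eq_add_neg] using this
  have hmeas : ∀ t m, AEMeasurable (fun ω i => (s i m).integral M t univ ω) P := fun t m =>
    aemeasurable_pi_lambda _ fun i => (AEEqFun.aestronglyMeasurable _).aemeasurable
  have hstat : ∀ u t : ℝ≥0, IdentDistrib
      (fun ω i => mIntegral M lam (u + t) univ (f i) ω - mIntegral M lam u univ (f i) ω)
      (fun ω i => mIntegral M lam t univ (f i) ω) P P := fun u t =>
    identDistrib_of_tendstoInMeasure (fun m => (hmeas (u + t) m).sub (hmeas u m))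
      (fun m => (h.random.simple fun i => s i m).2 u t)
      (tendstoInMeasure_pi fun i => hlim' i _ _) (tendstoInMeasure_pi fun i => hlim i t)
  refine ⟨?_, ?_, hstat, ?_⟩
  · have h0 : ∀ i, ∀ᵐ ω ∂P, mIntegral M lam 0 univ (f i) ω = 0 := fun i => by
      rw [h.mIntegral_zero_time hK (hfm i) (hf i)]
      exact AEEqFun.coeFn_zero
    filter_upwards [ae_all_iff.2 h0] with ω hω
    ext i
    exact hω i
  · intro k t ht
    exact iIndepFun_of_tendstoInMeasure
      (X := fun m j ω i => (s i m).integral M (t j.succ) univ ω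
        - (s i m).integral M (t j.castSucc) univ ω)
      (fun m j => (hmeas _ m).sub (hmeas _ m))
      (fun m => (h.random.simple fun i => s i m).1 k t ht)
      fun j => tendstoInMeasure_pi fun i => hlim' i _ _
  · intro t
    refine tendstoInMeasure_pi fun i => tendstoInMeasure_iff_norm.2 fun ε hε => ?_
    -- By stationarity an increment between u and t is distributed as the integral at time |u - t|,
    -- up to sign, and the exponent of the latter carries the factor |u - t|.
    have h1 : TendstoInMeasure P (fun u : ℝ≥0 => (mIntegral M lam (nndist u t) univ (f i) : Ω → ℝ))
        (𝓝 t) 0 := by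
      refine h.tendstoInMeasure_zero (f := fun _ => f i) (A := fun _ => univ)
        (t := fun u => nndist u t) (fun _ => hf i)
        (fun u v => h.charFun_mIntegral hK (hfm i) (hf i) _ v) ?_
      have h2 : Tendsto (fun u : ℝ≥0 => (nndist u t : ℝ)) (𝓝 t) (𝓝 0) := by
        have := (continuous_id.nndist (continuous_const (y := t))).tendsto t
        simpa using NNReal.tendsto_coe.2 this
      simpa using h2.mul_const
        (∫ x in univ, tripletSize (a x) (g x) (ρ x) (f i x) ∂lam)
    have hst : ∀ u v : ℝ≥0, P {ω | ε ≤ ‖mIntegral M lam (u + v) univ (f i) ω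
        - mIntegral M lam u univ (f i) ω‖} = P {ω | ε ≤ ‖mIntegral M lam v univ (f i) ω‖} :=
      fun u v => ((hstat u v).comp (measurable_pi_apply i)).measure_mem_eq
        (s := {y | ε ≤ ‖y‖}) (measurableSet_le measurable_const measurable_norm)
    refine (tendstoInMeasure_iff_norm.1 h1 ε hε).congr fun u => ?_
    simp only [Pi.zero_apply, sub_zero]
    rw [← hst (min u t)]
    rcases le_total u t with hu | hu
    · have h3 : u + nndist u t = t := by
        rw [NNReal.nndist_eq, tsub_eq_zero_of_le hu, max_eq_right (zero_le), add_tsub_cancel_of_le hu]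
      rw [min_eq_left hu, h3]
      simp only [norm_sub_rev]
    · have h3 : t + nndist u t = u := by
        rw [NNReal.nndist_eq, tsub_eq_zero_of_le hu, max_eq_left (zero_le), add_tsub_cancel_of_le hu]
      rw [min_eq_right hu, h3]

end IsDriven

end LevyProcess

/-! ### Exhaustion by compact sets -/

section Exhaustion

/-- O need not be locally compact, so compact sets come from inner regularity: pass to an equivalent
finite measure, approximate O from inside, and take finite unions. Compact subsets of E inside O are
compact in the topology of O. -/
lemma exists_isExhaustion {E : Type*} [TopologicalSpace E] [PolishSpace E] [MeasurableSpace E]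
    [BorelSpace E] {O : Set E} (hO : MeasurableSet O) (κ : Measure O) [SFinite κ] :
    ∃ K : ℕ → Set O, IsExhaustion κ K := by
  let μ : Measure E := κ.toFinite.map Subtype.val
  have h1 : ∀ n : ℕ, ((n : ℝ≥0∞) + 1)⁻¹ ≠ 0 := fun n => by simp
  choose C hCO hC hCμ using fun n : ℕ =>
    hO.exists_isCompact_sdiff_lt (μ := μ) (measure_ne_top _ _) (h1 n)
  have hval : Topology.IsInducing (Subtype.val : O → E) := Topology.IsInducing.subtypeVal
  have hK : ∀ n, IsCompact (Subtype.val ⁻¹' C n : Set O) := fun n =>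
    (hval.isCompact_preimage_iff (by rw [Subtype.range_coe]; exact hCO n)).2 (hC n)
  have hacc : ∀ n, IsCompact (Set.accumulate (fun n => (Subtype.val ⁻¹' C n : Set O)) n) :=
    fun n => (Set.finite_le_nat n).isCompact_biUnion fun i _ => hK i
  refine ⟨Set.accumulate fun n => Subtype.val ⁻¹' C n, Set.monotone_accumulate, fun n => ?_, ?_⟩
  · exact ⟨(hacc n).measurableSet, (hacc n).isClosed.closure_eq.symm ▸ hacc n⟩
  · refine absolutelyContinuous_toFinite κ (le_antisymm (le_of_forall_pos_le_add fun ε hε => ?_)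
      (zero_le))
    obtain ⟨n, hn⟩ := ENNReal.exists_inv_nat_lt hε.ne'
    rw [zero_add, Set.iUnion_accumulate]
    calc κ.toFinite (⋃ n, Subtype.val ⁻¹' C n)ᶜ
        ≤ κ.toFinite (Subtype.val ⁻¹' (O \ C n)) := measure_mono fun x hx =>
          ⟨x.2, fun h => hx (mem_iUnion.2 ⟨n, h⟩)⟩
      _ = μ (O \ C n) := (Measure.map_apply measurable_subtype_coe
          (MeasurableSet.diff hO (hC n).measurableSet)).symm
      _ ≤ ((n : ℝ≥0∞) + 1)⁻¹ := (hCμ n).le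
      _ ≤ (n : ℝ≥0∞)⁻¹ := ENNReal.inv_le_inv.2 le_self_add
      _ ≤ ε := hn.le

variable {X : Type*} [MeasurableSpace X]

lemma sectionMeasure_apply {ν : Measure (X × ℝ)} {A : Set X} {B : Set ℝ} (hB : MeasurableSet B) :
    sectionMeasure ν A B = ν (A ×ˢ B) := by
  rw [sectionMeasure, Measure.map_apply measurable_snd hB,
    Measure.restrict_apply (measurable_snd hB)]
  congr 1
  ext z
  simp [and_comm]

variable [TopologicalSpace X]

lemma IsExhaustion.mono_measure {κ κ' : Measure X} {K : ℕ → Set X} (hK : IsExhaustion κ K)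
    (h : κ' ≤ κ) : IsExhaustion κ' K :=
  ⟨hK.1, hK.2.1, le_antisymm ((h _).trans hK.2.2.le) (zero_le)⟩

/-- Over relatively compact sets the Lévy measure has no mass at 0. The exhaustion must be one for
the marginal of ν, since the control measure weights y = 0 by 0 and cannot see mass there. -/
lemma measure_snd_eq_zero {ν : Measure (X × ℝ)} {K : ℕ → Set X}
    (hK : IsExhaustion (ν.map Prod.fst) K)
    (hν : ∀ A ∈ borelB X, IsLevyMeasure (sectionMeasure ν A)) : ν {z | z.2 = 0} = 0 := by
  have h1 : {z : X × ℝ | z.2 = 0} ⊆ (Prod.fst ⁻¹' (⋃ n, K n)ᶜ) ∪ ⋃ n, K n ×ˢ {0} := by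
    intro z hz
    by_cases h : z.1 ∈ ⋃ n, K n
    · obtain ⟨n, hn⟩ := mem_iUnion.1 h
      exact Or.inr (mem_iUnion.2 ⟨n, hn, hz⟩)
    · exact Or.inl h
  refine measure_mono_null h1 (measure_union_null ?_ (measure_iUnion_null fun n => ?_))
  · rw [← Measure.map_apply measurable_fst (MeasurableSet.iUnion fun n => (hK.2.1 n).1).compl]
    exact hK.2.2
  · rw [← sectionMeasure_apply (measurableSet_singleton 0)]
    exact (hν _ (hK.2.1 n)).1

end Exhaustion

/-! ### The triplet of the integral -/

section Image

variable {X : Type*} [MeasurableSpace X]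

/-- The image of `ν` under `(x, y) ↦ f(x) y`, without the mass at `0`. -/
def imageMeasure (ν : Measure (X × ℝ)) (f : X → ℝ) : Measure ℝ :=
  (ν.map fun z => f z.1 * z.2).restrict {0}ᶜ

variable {ν : Measure (X × ℝ)} {f : X → ℝ}

lemma imageMeasure_zero : imageMeasure ν f {0} = 0 := by
  rw [imageMeasure, Measure.restrict_apply (measurableSet_singleton 0)]
  simp

lemma imageMeasure_apply (hf : Measurable f) {B : Set ℝ} (hB : MeasurableSet B) :
    imageMeasure ν f B = ν {z | f z.1 * z.2 ∈ B \ {0}} := by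
  rw [imageMeasure, Measure.restrict_apply hB, Measure.map_apply (by fun_prop)
    (hB.inter (measurableSet_singleton 0).compl)]
  rfl

lemma integral_imageMeasure {G : Type*} [NormedAddCommGroup G] [NormedSpace ℝ G]
    [MeasurableSpace G] [BorelSpace G] [SecondCountableTopology G]
    (hf : Measurable f) {φ : ℝ → G} (hφ : Measurable φ) (h0 : φ 0 = 0) :
    ∫ y, φ y ∂imageMeasure ν f = ∫ z, φ (f z.1 * z.2) ∂ν := by
  rw [imageMeasure, setIntegral_eq_integral_of_forall_compl_eq_zero, integral_map (by fun_prop)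
    hφ.aestronglyMeasurable]
  intro y hy
  have : y = 0 := by simpa using hy
  rw [this, h0]

lemma lintegral_imageMeasure_le (hf : Measurable f) {φ : ℝ → ℝ≥0∞} (hφ : Measurable φ) :
    ∫⁻ y, φ y ∂imageMeasure ν f ≤ ∫⁻ z, φ (f z.1 * z.2) ∂ν :=
  (setLIntegral_le_lintegral _ _).trans (lintegral_map hφ (by fun_prop)).le

end Image

namespace IsLocalTriplet

variable {X : Type*} [MeasurableSpace X] {lam : Measure X} {a g : X → ℝ} {ρ : Kernel X ℝ}
  {f : X → ℝ}

lemma integrable_scaledDrift (h : IsLocalTriplet lam a g ρ) (hfm : Measurable f)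
    (hf : Integrable (fun x => tripletSize (a x) (g x) (ρ x) (f x)) lam) :
    Integrable (fun x => scaledDrift (a x) (ρ x) (f x)) lam := by
  refine hf.mono' (h.measurable_scaledDrift hfm).aestronglyMeasurable (ae_of_all _ fun x => ?_)
  have h1 := mul_nonneg (sq_nonneg (f x)) (h.gauss_nonneg x)
  have h2 := integral_min_nonneg (ρ x) (f x)
  rw [Real.norm_eq_abs, tripletSize]
  linarith

lemma sq_mul_gauss_le_size (x : X) (v : ℝ) :
    v ^ 2 * g x ≤ tripletSize (a x) (g x) (ρ x) v := by
  have h2 := integral_min_nonneg (ρ x) v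
  have h3 := abs_nonneg (scaledDrift (a x) (ρ x) v)
  rw [tripletSize]
  linarith

lemma integrable_sq_mul_gauss (h : IsLocalTriplet lam a g ρ) (hfm : Measurable f)
    (hf : Integrable (fun x => tripletSize (a x) (g x) (ρ x) (f x)) lam) :
    Integrable (fun x => f x ^ 2 * g x) lam := by
  have hg := h.measurable_gauss
  refine hf.mono' (by fun_prop) (ae_of_all _ fun x => ?_)
  rw [Real.norm_of_nonneg (mul_nonneg (sq_nonneg (f x)) (h.gauss_nonneg x))]
  exact sq_mul_gauss_le_size x _

lemma integral_min_le_size (h : IsLocalTriplet lam a g ρ) (x : X) (v : ℝ) :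
    ∫ y, min 1 ((v * y) ^ 2) ∂ρ x ≤ tripletSize (a x) (g x) (ρ x) v := by
  have h1 := mul_nonneg (sq_nonneg v) (h.gauss_nonneg x)
  have h3 := abs_nonneg (scaledDrift (a x) (ρ x) v)
  rw [tripletSize]
  linarith

variable [SFinite lam]

lemma integrable_min_compProd (h : IsLocalTriplet lam a g ρ) (hfm : Measurable f)
    (hf : Integrable (fun x => tripletSize (a x) (g x) (ρ x) (f x)) lam) :
    Integrable (fun z : X × ℝ => min 1 ((f z.1 * z.2) ^ 2)) (lam ⊗ₘ ρ) := by
  have := h.isSFinite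
  have h1 : StronglyMeasurable fun z : X × ℝ => min 1 ((f z.1 * z.2) ^ 2) :=
    (by fun_prop : Measurable _).stronglyMeasurable
  refine (Measure.integrable_compProd_iff h1.aestronglyMeasurable).2
    ⟨ae_of_all _ fun x => integrable_min_one_sq_mul (h.integrable_min x) (f x), ?_⟩
  simp only [Real.norm_of_nonneg (min_one_sq_nonneg _)]
  refine hf.mono' (h1.integral_kernel_prod_right' (κ := ρ)).aestronglyMeasurable
    (ae_of_all _ fun x => ?_)
  rw [Real.norm_of_nonneg (integral_min_nonneg _ _)]
  exact h.integral_min_le_size x _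

lemma integrable_lkIntegrand_compProd (h : IsLocalTriplet lam a g ρ) (hfm : Measurable f)
    (hf : Integrable (fun x => tripletSize (a x) (g x) (ρ x) (f x)) lam) (u : ℝ) :
    Integrable (fun z : X × ℝ => lkIntegrand u (f z.1 * z.2)) (lam ⊗ₘ ρ) :=
  ((h.integrable_min_compProd hfm hf).const_mul (2 * (1 + u ^ 2))).mono'
    ((measurable_lkIntegrand u).comp (by fun_prop)).aestronglyMeasurable
    (ae_of_all _ fun _ => norm_lkIntegrand_le u _)

/-- The exponent of the integral of `f`. -/
lemma integral_levySymbol_mul (h : IsLocalTriplet lam a g ρ) (hfm : Measurable f)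
    (hf : Integrable (fun x => tripletSize (a x) (g x) (ρ x) (f x)) lam) (u : ℝ) :
    ∫ x, levySymbol (a x) (g x) (ρ x) (u * f x) ∂lam
      = levySymbol (∫ x, scaledDrift (a x) (ρ x) (f x) ∂lam) (∫ x, f x ^ 2 * g x ∂lam)
        (imageMeasure (lam ⊗ₘ ρ) f) u := by
  have := h.isSFinite
  have h1 : Integrable (fun x => Complex.I * u * (scaledDrift (a x) (ρ x) (f x) : ℂ)) lam :=
    (h.integrable_scaledDrift hfm hf).ofReal.const_mul _
  have h2 : Integrable (fun x => (u : ℂ) ^ 2 * ((f x ^ 2 * g x : ℝ) : ℂ) / 2) lam :=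
    ((h.integrable_sq_mul_gauss hfm hf).ofReal.const_mul _).div_const _
  have h3 := h.integrable_lkIntegrand_compProd hfm hf u
  have h4 : Integrable (fun x => ∫ y, lkIntegrand u (f x * y) ∂ρ x) lam :=
    Integrable.integral_compProd (κ := Kernel.const Unit lam) (η := Kernel.prodMkLeft Unit ρ)
      (a := ()) h3
  simp only [levySymbol_mul (h.integrable_min _)]
  have h5 := integral_add (h1.sub h2) h4
  simp only [Pi.sub_apply] at h5
  rw [h5, integral_sub h1 h2, levySymbol_eq,
    integral_imageMeasure hfm (measurable_lkIntegrand u) (lkIntegrand_zero u),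
    Measure.integral_compProd h3, integral_const_mul, integral_div, integral_const_mul,
    integral_complex_ofReal, integral_complex_ofReal]

lemma isLevyMeasure_imageMeasure (h : IsLocalTriplet lam a g ρ) (hfm : Measurable f)
    (hf : Integrable (fun x => tripletSize (a x) (g x) (ρ x) (f x)) lam) :
    IsLevyMeasure (imageMeasure (lam ⊗ₘ ρ) f) := by
  refine ⟨imageMeasure_zero, (lintegral_imageMeasure_le hfm measurable_levyWeight).trans_lt ?_⟩
  have h1 := (h.integrable_min_compProd hfm hf).2
  rwa [hasFiniteIntegral_iff_ofReal (ae_of_all _ fun _ => min_one_sq_nonneg _)] at h1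

end IsLocalTriplet

/-! ### Characteristics and densities -/

section Densities

variable {X : Type*} [TopologicalSpace X] [MeasurableSpace X] {γ : LocalSignedMeasure X}
  {S : Measure X} {ν : Measure (X × ℝ)}

lemma controlMeasure_lt_top (hS : ∀ A ∈ borelB X, S A < ∞)
    (hν : ∀ A ∈ borelB X, IsLevyMeasure (sectionMeasure ν A)) {A : Set X} (hA : A ∈ borelB X) :
    controlMeasure γ S ν A < ∞ := by
  have h1 := (hν A hA).2
  rw [sectionMeasure, lintegral_map (by fun_prop) measurable_snd] at h1
  rw [controlMeasure, LocalSignedMeasure.totalVariation, Measure.add_apply, Measure.add_apply,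
    Measure.add_apply, Measure.map_apply measurable_fst hA.1,
    withDensity_apply _ (measurable_fst hA.1), ← Set.prod_univ]
  exact ENNReal.add_lt_top.2 ⟨ENNReal.add_lt_top.2 ⟨ENNReal.add_lt_top.2
    ⟨γ.pos_lt_top A hA, γ.neg_lt_top A hA⟩, hS A hA⟩, h1⟩

variable [SigmaFinite (controlMeasure γ S ν)]

lemma integral_mul_driftDensity {f : X → ℝ} (hf : Integrable f γ.totalVariation) :
    Integrable (fun x => f x * driftDensity γ (controlMeasure γ S ν) x) (controlMeasure γ S ν) ∧
    ∫ x, f x * driftDensity γ (controlMeasure γ S ν) x ∂controlMeasure γ S ν = γ.integral f := by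
  have hp : γ.pos ≤ controlMeasure γ S ν := pos_le_controlMeasure
  have hn : γ.neg ≤ controlMeasure γ S ν := neg_le_controlMeasure
  have := Measure.sigmaFinite_of_le _ hp
  have := Measure.sigmaFinite_of_le _ hn
  have hp' := Measure.absolutelyContinuous_of_le hp
  have hn' := Measure.absolutelyContinuous_of_le hn
  rw [LocalSignedMeasure.totalVariation, integrable_add_measure] at hf
  have h1 := (integrable_rnDeriv_smul_iff hp').2 hf.1
  have h2 := (integrable_rnDeriv_smul_iff hn').2 hf.2
  simp only [smul_eq_mul] at h1 h2
  have h3 : (fun x => f x * driftDensity γ (controlMeasure γ S ν) x)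
      = fun x => (γ.pos.rnDeriv (controlMeasure γ S ν) x).toReal * f x
        - (γ.neg.rnDeriv (controlMeasure γ S ν) x).toReal * f x := by
    ext x
    rw [driftDensity]
    ring
  rw [h3]
  refine ⟨h1.sub h2, ?_⟩
  rw [integral_sub h1 h2, integral_toReal_rnDeriv_mul hp', integral_toReal_rnDeriv_mul hn']
  rfl

lemma integrable_mul_gaussDensity_iff {f : X → ℝ} :
    Integrable (fun x => f x * gaussDensity S (controlMeasure γ S ν) x) (controlMeasure γ S ν) ↔
      Integrable f S := by
  have hp : S ≤ controlMeasure γ S ν := gauss_le_controlMeasure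
  have := Measure.sigmaFinite_of_le _ hp
  rw [← integrable_rnDeriv_smul_iff (Measure.absolutelyContinuous_of_le hp)]
  simp only [smul_eq_mul, mul_comm, gaussDensity]

lemma integral_mul_gaussDensity (f : X → ℝ) :
    ∫ x, f x * gaussDensity S (controlMeasure γ S ν) x ∂controlMeasure γ S ν = ∫ x, f x ∂S := by
  have hp : S ≤ controlMeasure γ S ν := gauss_le_controlMeasure
  have := Measure.sigmaFinite_of_le _ hp
  rw [← integral_toReal_rnDeriv_mul (Measure.absolutelyContinuous_of_le hp)]
  simp only [mul_comm, gaussDensity]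

/-- The size of the triplet at `v` is dominated by `Φ_M(|v|, x)`. -/
lemma ofReal_tripletSize_le_Phi {ρ : Kernel X ℝ} [IsSFiniteKernel ρ]
    (hρ : ∀ x, ∫⁻ y, levyWeight y ∂ρ x ≤ 1)
    (hae : ∀ᵐ x ∂controlMeasure γ S ν, disint ν (controlMeasure γ S ν) x = ρ x) :
    ∀ᵐ x ∂controlMeasure γ S ν, ∀ v,
      ENNReal.ofReal (tripletSize (driftDensity γ (controlMeasure γ S ν) x)
        (gaussDensity S (controlMeasure γ S ν) x) (ρ x) v) ≤ Phi γ S ν |v| x := by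
  filter_upwards [hae,
    Measure.rnDeriv_le_one_of_le (gauss_le_controlMeasure (γ := γ) (S := S) (ν := ν))]
    with x hx hx' v
  have hm := integrable_min_of_lintegral_levyWeight_le (hρ x)
  have hg : 0 ≤ gaussDensity S (controlMeasure γ S ν) x := ENNReal.toReal_nonneg
  rw [← tripletSize_abs, tripletSize, ENNReal.ofReal_add (by positivity) (integral_min_nonneg _ _),
    ENNReal.ofReal_add (by positivity) (by positivity), Phi, hx]
  refine add_le_add (add_le_add ?_ ?_) ?_
  -- Only c = 1 in the supremum is needed; the size is already quasi-monotone without it.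
  · refine le_trans (le_of_eq ?_) (le_iSup₂ (f := fun c (_ : c ∈ Icc (-1 : ℝ) 1) =>
      ENNReal.ofReal |U γ S ν (c * |v|) x|) 1 (by simp))
    simp only [one_mul]
    rw [U, hx]
    rfl
  · rw [ENNReal.ofReal_mul (by positivity), gaussDensity,
      ENNReal.ofReal_toReal (hx'.trans_lt ENNReal.one_lt_top).ne]
  · rw [ofReal_integral_eq_lintegral_ofReal (integrable_min_one_sq_mul hm _)
      (ae_of_all _ fun _ => min_one_sq_nonneg _)]

end Densities

-- From characteristics to local exponents

section Characteristics

variable {Ω : Type*} [MeasurableSpace Ω] {P : Measure Ω}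
variable {X : Type*} [TopologicalSpace X] [MeasurableSpace X] {γ : LocalSignedMeasure X}
  {S : Measure X} {ν : Measure (X × ℝ)} {M : ℝ≥0 → Set X → Ω →ₘ[P] ℝ}

/-- Apply the formula for the integrated exponent to the indicator of A: its three parts are γ(A),
Σ(A) and the jump part of ν(A × ·). -/
lemma IsCharacteristics.isDriven (hchar : IsCharacteristics M γ S ν)
    (hM : IsLevyRandomMeasure M) {ρ : Kernel X ℝ} [IsSFiniteKernel ρ]
    (hρ : ∀ x, ∫⁻ y, levyWeight y ∂ρ x ≤ 1) (hν : ν = controlMeasure γ S ν ⊗ₘ ρ) :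
    IsDriven M (controlMeasure γ S ν) (driftDensity γ (controlMeasure γ S ν))
      (gaussDensity S (controlMeasure γ S ν)) ρ := by
  have := hchar.sigmaFinite_control
  have hloc := isLocalTriplet_density (γ := γ) (S := S) (ν := ν) hρ
  have hlt : ∀ A ∈ borelB X, controlMeasure γ S ν A < ∞ := fun A hA =>
    controlMeasure_lt_top hchar.lt_top hchar.levyMeasure hA
  refine ⟨hM, hloc, hlt, fun A hA u => ?_⟩
  have hf : Measurable (A.indicator fun _ => (1 : ℝ)) := measurable_const.indicator hA.1
  have hint := hloc.integrable_size_of_bounded (hlt A hA) hA.1 hf (C := 1)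
    (fun x => by by_cases hx : x ∈ A <;> simp [hx]) (fun x hx => indicator_of_notMem hx _)
  have h1 := hloc.integral_levySymbol_mul hf hint u
  rw [hchar.charFun_eq A hA u]
  have hA' : ∀ φ : X → ℂ, (∫ x in A, φ x ∂controlMeasure γ S ν)
      = ∫ x, A.indicator φ x ∂controlMeasure γ S ν := fun φ => (integral_indicator hA.1).symm
  have h2 : (fun x => levySymbol (driftDensity γ (controlMeasure γ S ν) x)
      (gaussDensity S (controlMeasure γ S ν) x) (ρ x) (u * A.indicator (fun _ => (1 : ℝ)) x))
      = A.indicator fun x => levySymbol (driftDensity γ (controlMeasure γ S ν) x)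
      (gaussDensity S (controlMeasure γ S ν) x) (ρ x) u := by
    ext x
    by_cases hx : x ∈ A <;> simp [hx, levySymbol_zero]
  rw [hA', ← h2, h1, ← hν, levySymbol_eq, levySymbol_eq]
  have hsd : (fun x => scaledDrift (driftDensity γ (controlMeasure γ S ν) x) (ρ x)
      (A.indicator (fun _ => (1 : ℝ)) x))
      = fun x => A.indicator (fun _ => (1 : ℝ)) x * driftDensity γ (controlMeasure γ S ν) x := by
    ext x
    by_cases hx : x ∈ A <;> simp [hx, scaledDrift_one]
  have hsq : (fun x => A.indicator (fun _ => (1 : ℝ)) x ^ 2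
      * gaussDensity S (controlMeasure γ S ν) x)
      = fun x => A.indicator (fun _ => (1 : ℝ)) x * gaussDensity S (controlMeasure γ S ν) x := by
    ext x
    by_cases hx : x ∈ A <;> simp [hx]
  have hp := γ.pos_lt_top A hA
  have hn := γ.neg_lt_top A hA
  have hi : Integrable (A.indicator fun _ => (1 : ℝ)) γ.totalVariation := by
    rw [integrable_indicator_iff hA.1, LocalSignedMeasure.totalVariation]
    exact integrableOn_const (by rw [Measure.add_apply]; finiteness)
  rw [hsd, (integral_mul_driftDensity hi).2, hsq, integral_mul_gaussDensity,
    integral_imageMeasure hf (measurable_lkIntegrand u) (lkIntegrand_zero u), sectionMeasure,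
    integral_map measurable_snd.aemeasurable (measurable_lkIntegrand u).aestronglyMeasurable,
    ← integral_indicator (hA.1.prod MeasurableSet.univ)]
  have hv : γ.integral (A.indicator fun _ => 1) = γ.value A := by
    rw [LocalSignedMeasure.value, LocalSignedMeasure.integral, integral_indicator_const _ hA.1,
      integral_indicator_const _ hA.1]
    simp [Measure.real]
  have hS : ∫ x, A.indicator (fun _ => (1 : ℝ)) x ∂S = (S A).toReal := by
    rw [integral_indicator_const _ hA.1]
    simp [Measure.real]
  have hlk : (fun z : X × ℝ => (A ×ˢ univ).indicator (fun z => lkIntegrand u z.2) z)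
      = fun z => lkIntegrand u (A.indicator (fun _ => 1) z.1 * z.2) := by
    ext z
    by_cases hx : z.1 ∈ A <;> simp [indicator, hx]
  rw [hv, hS, hlk]

end Characteristics

/-! ### The cylindrical Lévy measure -/

section CylindricalMeasure

variable {X : Type*} [MeasurableSpace X] {lam : Measure X}
variable {F : Type*} [NormedAddCommGroup F] [NormedSpace ℝ F]

/-- Almost every point evaluation on finitely many functionals is the evaluation at an element. -/
lemma exists_forall_apply_eq (ι : StrongDual ℝ F →ₗ[ℝ] (X →ₘ[lam] ℝ)) {κ : Type*} [Fintype κ]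
    (f : κ → StrongDual ℝ F) : ∀ᵐ x ∂lam, ∃ g : F, ∀ k, f k g = ι (f k) x := by
  classical
  let T : F →ₗ[ℝ] (κ → ℝ) := LinearMap.pi fun k => (f k : F →ₗ[ℝ] ℝ)
  -- The annihilator of the range consists of the linear relations among the f k. It is finitely
  -- generated, so one null set takes care of all relations among the functions ι (f k).
  obtain ⟨s, hs⟩ := IsNoetherian.noetherian (LinearMap.range T).dualAnnihilator
  have hrel : ∀ φ ∈ s, ∀ᵐ x ∂lam, φ (fun k => ι (f k) x) = 0 := by
    intro φ hφ
    have h1 : ∀ v : κ → ℝ, φ v = ∑ k, φ (Pi.single k 1) * v k := fun v => by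
      rw [LinearMap.pi_apply_eq_sum_univ φ v]
      refine Finset.sum_congr rfl fun k _ => ?_
      rw [smul_eq_mul, mul_comm]
      congr 2
      ext j
      simp [Pi.single_apply, eq_comm]
    have h2 : ∑ k, φ (Pi.single k 1) • f k = 0 := by
      ext g
      have h3 : φ (T g) = 0 := (Submodule.mem_dualAnnihilator φ).1
        (hs ▸ Submodule.subset_span hφ) _ (LinearMap.mem_range_self T g)
      rw [h1] at h3
      simpa [T] using h3
    have h4 : ∑ k, φ (Pi.single k 1) • ι (f k) = 0 := by
      simpa using congrArg ι h2
    filter_upwards [coeFn_sum_smul Finset.univ (fun k => φ (Pi.single k 1)) fun k => ι (f k),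
      AEEqFun.coeFn_zero (α := X) (β := ℝ) (μ := lam)] with x hx hx0
    rw [h4, hx0] at hx
    rw [h1]
    exact hx.symm
  filter_upwards [(ae_ball_iff s.countable_toSet).2 hrel] with x hx
  have h5 : (fun k => ι (f k) x) ∈ (LinearMap.range T).dualAnnihilator.dualCoannihilator := by
    rw [Submodule.mem_dualCoannihilator]
    intro φ hφ
    rw [← hs] at hφ
    induction hφ using Submodule.span_induction with
    | mem φ hφ => exact hx φ hφ
    | zero => rfl
    | add φ ψ _ _ h h' => rw [LinearMap.add_apply, h, h', add_zero]
    | smul c φ _ h => rw [LinearMap.smul_apply, h, smul_zero]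
  -- In finite dimension a vector satisfying every relation of the range lies in the range itself;
  -- no closure is needed.
  rw [Subspace.dualAnnihilator_dualCoannihilator_eq] at h5
  obtain ⟨g, hg⟩ := h5
  exact ⟨g, fun k => congrFun hg k⟩

variable {ν : Measure (X × ℝ)}

/-- The set `R` of points `(x, y)` corresponds to the cylinder set `C` under the map which sends
`(x, y)` to the (generalized) element `y δ_x`. -/
def IsCylinderPreimage (ι : StrongDual ℝ F →ₗ[ℝ] (X →ₘ[lam] ℝ)) (C : Set F) (R : Set (X × ℝ)) :
    Prop :=
  ∃ (n : ℕ) (f : Fin n → StrongDual ℝ F) (B : Set (Fin n → ℝ)), MeasurableSet B ∧ 0 ∉ B ∧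
    C = cylinder f B ∧ R = {z | (fun k => ι (f k) z.1 * z.2) ∈ B}

variable {ι : StrongDual ℝ F →ₗ[ℝ] (X →ₘ[lam] ℝ)}

lemma IsCylinderPreimage.measurableSet {C : Set F} {R : Set (X × ℝ)}
    (h : IsCylinderPreimage ι C R) : MeasurableSet R := by
  obtain ⟨n, f, B, hB, -, -, rfl⟩ := h
  have hf : ∀ k, Measurable (ι (f k)) := fun k => AEEqFun.measurable _
  exact (by fun_prop : Measurable fun (z : X × ℝ) k => ι (f k) z.1 * z.2) hB

lemma exists_isCylinderPreimage {C : Set F} (hC : C ∈ cylinderSets F) :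
    ∃ R, IsCylinderPreimage ι C R :=
  let ⟨n, f, B, hB, h0, h⟩ := hC
  ⟨_, n, f, B, hB, h0, h, rfl⟩

/-- Finitely many cylinders involve finitely many functionals, so for almost every (x, y) a single g
represents y δ_x on all of them. Every Boolean relation among the cylinders therefore holds almost
everywhere among their preimages. -/
lemma exists_forall_mem_iff (hν : ν.map Prod.fst ≪ lam) {J : Type*} [Fintype J] {C : J → Set F}
    {R : J → Set (X × ℝ)} (h : ∀ j, IsCylinderPreimage ι (C j) (R j)) :
    ∀ᵐ z ∂ν, ∃ g : F, ∀ j, z ∈ R j ↔ g ∈ C j := by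
  choose n f B _ _ hC hR using h
  have h1 := ae_of_ae_map measurable_fst.aemeasurable
    (hν.ae_le (exists_forall_apply_eq ι fun p : Σ j, Fin (n j) => f p.1 p.2))
  filter_upwards [h1] with z hz
  obtain ⟨g, hg⟩ := hz
  refine ⟨z.2 • g, fun j => ?_⟩
  have h2 : (fun k => ι (f j k) z.1 * z.2) = fun k => f j k (z.2 • g) := by
    ext k
    rw [map_smul, hg ⟨j, k⟩, smul_eq_mul, mul_comm]
  rw [hR, hC, mem_ofPred_eq, h2]
  rfl

open scoped Classical in
/-- The content of a cylinder set: the `ν`-measure of the corresponding set of points. -/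
def cylinderContent (ν : Measure (X × ℝ)) (ι : StrongDual ℝ F →ₗ[ℝ] (X →ₘ[lam] ℝ)) (C : Set F) :
    ℝ≥0∞ :=
  if h : ∃ R, IsCylinderPreimage ι C R then ν h.choose else 0

/-- Two representations of the same cylinder have preimages that agree almost everywhere, so the
content is well defined. -/
lemma cylinderContent_eq (hν : ν.map Prod.fst ≪ lam) {C : Set F} {R : Set (X × ℝ)}
    (h : IsCylinderPreimage ι C R) : cylinderContent ν ι C = ν R := by
  have hex : ∃ R, IsCylinderPreimage ι C R := ⟨R, h⟩
  rw [cylinderContent, dif_pos hex]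
  refine measure_congr ?_
  filter_upwards [exists_forall_mem_iff hν (C := fun _ : Bool => C)
    (R := fun b => if b then R else hex.choose)
    (by rintro (_ | _); exacts [hex.choose_spec, h])] with z hz
  obtain ⟨g, hg⟩ := hz
  exact propext ((hg false).trans (hg true).symm)

/-- The image of `ν` under `(x, y) ↦ y δ_x`, as a cylindrical measure. -/
def cylindricalMeasure (hν : ν.map Prod.fst ≪ lam) (ι : StrongDual ℝ F →ₗ[ℝ] (X →ₘ[lam] ℝ)) :
    CylindricalMeasure F where
  content :=
    { toFun := cylinderContent ν ι
      empty' := by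
        have h : IsCylinderPreimage ι (∅ : Set F) ∅ :=
          ⟨0, 0, ∅, MeasurableSet.empty, notMem_empty _, rfl, rfl⟩
        rw [cylinderContent_eq hν h, measure_empty]
      sUnion' := by
        intro I hI hdis hmem
        choose R hR using fun C : I => exists_isCylinderPreimage (ι := ι) (hI C.2)
        obtain ⟨R', hR'⟩ := exists_isCylinderPreimage (ι := ι) hmem
        -- The index `none` stands for the union, so one exceptional null set serves for the union
        -- and all its pieces.
        have hae := exists_forall_mem_iff hν (J := Option I)
          (C := fun o => o.elim (⋃₀ (I : Set (Set F))) fun C => C) (R := fun o => o.elim R' R)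
          (by rintro (_ | C); exacts [hR', hR C])
        have h1 : (R' : Set (X × ℝ)) =ᵐ[ν] ⋃ C : I, R C := by
          filter_upwards [hae] with z hz
          obtain ⟨g, hg⟩ := hz
          refine propext ((hg none).trans ?_)
          rw [Option.elim_none]
          constructor
          · rintro ⟨C, hC, hgC⟩
            exact mem_iUnion.2 ⟨⟨C, hC⟩, (hg (some ⟨C, hC⟩)).2 hgC⟩
          · intro hz
            obtain ⟨C, hC⟩ := mem_iUnion.1 hz
            exact ⟨C, C.2, (hg (some C)).1 hC⟩
        have h2 : Pairwise (Function.onFun (AEDisjoint ν) R) := by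
          intro C D hCD
          have h3 : ∀ᵐ z ∂ν, z ∉ R C ∩ R D := by
            filter_upwards [hae] with z hz
            obtain ⟨g, hg⟩ := hz
            rintro ⟨hzC, hzD⟩
            exact disjoint_left.1 (hdis C.2 D.2 (Subtype.coe_injective.ne hCD))
              ((hg (some C)).1 hzC) ((hg (some D)).1 hzD)
          exact measure_eq_zero_iff_ae_notMem.2 h3
        rw [cylinderContent_eq hν hR', measure_congr h1,
          measure_iUnion₀ h2 fun C => (hR C).measurableSet.nullMeasurableSet, tsum_fintype]
        exact (Finset.sum_congr rfl fun C _ => (cylinderContent_eq hν (hR C)).symm).trans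
          (Finset.sum_coe_sort I fun C => cylinderContent ν ι C) }
  -- With the functionals fixed, preimages commute with countable unions exactly, so countable
  -- additivity of ν applies.
  iUnion_eq n f B hB h0 hd := by
    have h1 : ∀ k, IsCylinderPreimage ι (cylinder f (B k))
        {z | (fun k => ι (f k) z.1 * z.2) ∈ B k} := fun k => ⟨n, f, B k, hB k, h0 k, rfl, rfl⟩
    have h2 : IsCylinderPreimage ι (cylinder f (⋃ k, B k))
        (⋃ k, {z : X × ℝ | (fun k => ι (f k) z.1 * z.2) ∈ B k}) :=
      ⟨n, f, ⋃ k, B k, MeasurableSet.iUnion hB, by simpa using h0, rfl, by ext; simp⟩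
    change cylinderContent ν ι _ = ∑' k, cylinderContent ν ι _
    rw [cylinderContent_eq hν h2, measure_iUnion (fun i j hij => ?_) fun k => (h1 k).measurableSet]
    · exact tsum_congr fun k => (cylinderContent_eq hν (h1 k)).symm
    · exact (hd hij).preimage fun (z : X × ℝ) k => ι (f k) z.1 * z.2

lemma CylindricalMeasure.proj_apply (μ : CylindricalMeasure F) (f : StrongDual ℝ F) {B : Set ℝ}
    (hB : MeasurableSet B) : μ.proj f B = μ.content {g | f g ∈ B \ {0}} :=
  Measure.ofMeasurable_apply B hB

lemma proj_cylindricalMeasure (hν : ν.map Prod.fst ≪ lam) (f : StrongDual ℝ F) :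
    (cylindricalMeasure hν ι).proj f = imageMeasure ν (ι f) := by
  ext B hB
  rw [CylindricalMeasure.proj_apply _ _ hB, imageMeasure_apply (AEEqFun.measurable _) hB]
  exact cylinderContent_eq hν ⟨1, fun _ => f, (fun v => v 0) ⁻¹' (B \ {0}),
    (measurable_pi_apply 0) (MeasurableSet.diff hB (measurableSet_singleton 0)), by simp, rfl, rfl⟩

end CylindricalMeasure

/-! ### Continuity of the drift -/

section Truncation

/-- A bound for the truncation defect `τ(p + q) - τ(p) - τ(q)`, `τ(y) = y 1_{|y| ≤ 1}`,
for `|q| ≤ δ`. -/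
def truncationBound (δ p : ℝ) : ℝ :=
  (if 1 / 2 < |p| then δ else 0) + if |(|p| - 1)| ≤ δ then 3 else 0

lemma measurable_truncationBound (δ : ℝ) : Measurable (truncationBound δ) :=
  (Measurable.ite (measurableSet_lt (by fun_prop) (by fun_prop)) (by fun_prop)
    (by fun_prop)).add (Measurable.ite (measurableSet_le (by fun_prop) (by fun_prop))
    (by fun_prop) (by fun_prop))

lemma truncationBound_nonneg {δ : ℝ} (hδ : 0 < δ) (p : ℝ) : 0 ≤ truncationBound δ p := by
  unfold truncationBound
  positivity

/-- Both terms vanish for |p| < 1/2. Otherwise 1 ∧ p² is at least 1/4, while the bound is at most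
1/2 + 3 ≤ 16/4. This makes it integrable against Lévy measures. -/
lemma truncationBound_le {δ : ℝ} (hδ' : δ ≤ 1 / 2) (p : ℝ) :
    truncationBound δ p ≤ 16 * min 1 (p ^ 2) := by
  rw [truncationBound]
  rcases lt_or_ge |p| (1 / 2) with hp | hp
  · rw [if_neg (by linarith), if_neg, add_zero]
    · exact mul_nonneg (by norm_num) (min_one_sq_nonneg p)
    · rw [not_le]
      refine lt_of_le_of_lt hδ' (lt_abs.2 (Or.inr ?_))
      linarith
  · have h2 : 1 / 4 ≤ min 1 (p ^ 2) := by
      refine le_min (by norm_num) ?_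
      rw [← sq_abs]
      nlinarith
    split_ifs <;> linarith

/-- The truncation defect of a sum is small unless one summand is large or near the jump. -/
lemma abs_truncation_add_sub_le {δ : ℝ} (hδ : 0 < δ) (hδ' : δ ≤ 1 / 2) (p q : ℝ) :
    |(p + q) * ballInd (p + q) - p * ballInd p - q * ballInd q|
      ≤ 3 / δ ^ 2 * min 1 (q ^ 2)
        + truncationBound δ p := by
  have hτ : ∀ z : ℝ, |z * ballInd z| ≤ 1 := fun z => by
    rcases le_or_gt |z| 1 with h | h
    · rwa [ballInd_of_le h, mul_one]
    · simp [ballInd_of_lt h]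
  have h3 : |(p + q) * ballInd (p + q) - p * ballInd p - q * ballInd q| ≤ 3 := by
    refine (abs_sub _ _).trans ((add_le_add_left (abs_sub _ _) _).trans ?_)
    linarith [hτ (p + q), hτ p, hτ q]
  have hr := truncationBound_nonneg hδ p
  have hm : 0 ≤ 3 / δ ^ 2 * min 1 (q ^ 2) := mul_nonneg (by positivity) (min_one_sq_nonneg q)
  -- The defect is always at most 3. For |q| > δ this is absorbed by 3 / δ² times 1 ∧ q², and for
  -- |q| ≤ δ with |p| within δ of 1 by the second term of `truncationBound`.
  rcases lt_or_ge δ |q| with hq | hq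
  · have h1 : δ ^ 2 ≤ min 1 (q ^ 2) := by
      refine le_min (by nlinarith) ?_
      rw [← sq_abs q]
      exact pow_le_pow_left₀ hδ.le hq.le 2
    have h2 : 3 ≤ 3 / δ ^ 2 * min 1 (q ^ 2) := by
      calc (3 : ℝ) = 3 / δ ^ 2 * δ ^ 2 := by field_simp
        _ ≤ _ := mul_le_mul_of_nonneg_left h1 (by positivity)
    linarith
  · have hq1 : ballInd q = 1 := ballInd_of_le (by linarith)
    have hpq := abs_add_le p q
    have hpq' : |p| ≤ |p + q| + |q| := by
      have := abs_sub (p + q) q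
      rwa [add_sub_cancel_right] at this
    rcases le_or_gt |(|p| - 1)| δ with hp | hp
    · rw [truncationBound, if_pos hp]
      have : 0 ≤ if 1 / 2 < |p| then δ else 0 := by positivity
      linarith
    -- Away from the jump p and p + q lie on the same side of it: outside, the defect is -q, of
    -- modulus at most δ; inside, it is 0.
    · rcases lt_abs.1 hp with h | h
      · have h1 : ballInd p = 0 := ballInd_of_lt (by linarith)
        have h2 : ballInd (p + q) = 0 := ballInd_of_lt (by linarith)
        rw [h1, h2, hq1, truncationBound, if_pos (by linarith), if_neg (not_le.2 hp), mul_zero, mul_zero, sub_zero,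
          zero_sub, abs_neg, mul_one]
        linarith
      · have h1 : ballInd p = 1 := ballInd_of_le (by linarith)
        have h2 : ballInd (p + q) = 1 := ballInd_of_le (by linarith)
        rw [h1, h2, hq1, mul_one, mul_one, mul_one, add_sub_cancel_left, sub_self, abs_zero]
        linarith

/-- The bound for the truncation defect vanishes in the mean, unless `m` charges `{-1, 1}`. -/
lemma tendsto_integral_truncation {m : Measure ℝ} (hm : Integrable (fun y : ℝ => min 1 (y ^ 2)) m)
    (h1 : m {-1, 1} = 0) :
    Tendsto (fun n : ℕ => ∫ p, truncationBound (1 / ((n : ℝ) + 2)) p ∂m) atTop (𝓝 0) := by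
  have h0 : (0 : ℝ) = ∫ _, (0 : ℝ) ∂m := by simp
  rw [h0]
  have hlim : Tendsto (fun n : ℕ => 1 / ((n : ℝ) + 2)) atTop (𝓝 0) :=
    tendsto_const_nhds.div_atTop
      (tendsto_atTop_add_const_right _ _ tendsto_natCast_atTop_atTop)
  have hle : ∀ n : ℕ, 1 / ((n : ℝ) + 2) ≤ 1 / 2 := fun n =>
    one_div_le_one_div_of_le two_pos (by linarith [Nat.cast_nonneg (α := ℝ) n])
  refine tendsto_integral_of_dominated_convergence (fun p => 16 * min 1 (p ^ 2))
    (fun n => (measurable_truncationBound _).aestronglyMeasurable) (hm.const_mul _)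
    (fun n => ae_of_all _ fun p => ?_) ?_
  · rw [Real.norm_of_nonneg (truncationBound_nonneg (by positivity) p)]
    exact truncationBound_le (hle n) p
  · have h2 : ∀ᵐ p ∂m, p ∉ ({-1, 1} : Set ℝ) := measure_eq_zero_iff_ae_notMem.1 h1
    filter_upwards [h2] with p hp
    have hp1 : 0 < |(|p| - 1)| := by
      rw [abs_pos, sub_ne_zero]
      intro h
      rcases eq_or_eq_neg_of_abs_eq h with h | h <;> simp [h] at hp
    have h3 : Tendsto (fun n : ℕ => if 1 / 2 < |p| then 1 / ((n : ℝ) + 2) else 0) atTop (𝓝 0) := by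
      split_ifs
      · exact hlim
      · exact tendsto_const_nhds
    have h4 : Tendsto (fun n : ℕ => if |(|p| - 1)| ≤ 1 / ((n : ℝ) + 2) then (3 : ℝ) else 0) atTop
        (𝓝 0) := by
      refine tendsto_const_nhds.congr' ?_
      filter_upwards [hlim.eventually_lt_const hp1] with n hn
      rw [if_neg (not_le.2 hn)]
    simpa [truncationBound] using h3.add h4

lemma truncationBound_zero {δ : ℝ} (hδ' : δ ≤ 1 / 2) : truncationBound δ 0 = 0 := by
  rw [truncationBound, if_neg (by norm_num), if_neg, add_zero]
  rw [not_le]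
  norm_num
  linarith

/-- In v, everything in the drift is linear except the truncated jump v y 1_B(v y). -/
lemma scaledDrift_add {m : Measure ℝ} (hm : Integrable (fun y : ℝ => min 1 (y ^ 2)) m)
    (b v w : ℝ) : scaledDrift b m (v + w) = scaledDrift b m v + scaledDrift b m w
      + ∫ y, ((v * y + w * y) * ballInd (v * y + w * y) - v * y * ballInd (v * y)
        - w * y * ballInd (w * y)) ∂m := by
  have h1 : ∀ c, Integrable (fun y => c * y * (ballInd (c * y) - ballInd y)) m := fun c => by
    have h2 := (integrable_mul_ballInd_sub hm c 1)
    simpa only [one_mul] using h2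
  have h2 : (fun y => (v * y + w * y) * ballInd (v * y + w * y) - v * y * ballInd (v * y)
      - w * y * ballInd (w * y)) = fun y => (v + w) * y * (ballInd ((v + w) * y) - ballInd y)
      - v * y * (ballInd (v * y) - ballInd y) - w * y * (ballInd (w * y) - ballInd y) := by
    ext y
    rw [← add_mul]
    ring
  have h3 := integral_sub ((h1 (v + w)).sub (h1 v)) (h1 w)
  simp only [Pi.sub_apply] at h3
  rw [h2, h3, integral_sub (h1 _) (h1 _), scaledDrift_eq, scaledDrift_eq, scaledDrift_eq]
  ring

end Truncation

section Embedding

variable {X : Type*} [MeasurableSpace X] {lam : Measure X} {a g : X → ℝ} {ρ : Kernel X ℝ}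
  {V : Type*} [NormedAddCommGroup V] [NormedSpace ℝ V] {ι : V →ₗ[ℝ] (X →ₘ[lam] ℝ)}

/-- The functions in the range of `ι` have integrable size, which depends continuously on them. -/
structure IsSizeContinuous (a g : X → ℝ) (ρ : Kernel X ℝ) (ι : V →ₗ[ℝ] (X →ₘ[lam] ℝ)) : Prop where
  integrable : ∀ f, Integrable (fun x => tripletSize (a x) (g x) (ρ x) (ι f x)) lam
  tendsto : Tendsto (fun f => ∫ x, tripletSize (a x) (g x) (ρ x) (ι f x) ∂lam) (𝓝 0) (𝓝 0)

namespace IsSizeContinuous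

lemma tendsto_sub (hι : IsSizeContinuous a g ρ ι) (f : V) :
    Tendsto (fun h => ∫ x, tripletSize (a x) (g x) (ρ x) (ι (h - f) x) ∂lam) (𝓝 f) (𝓝 0) := by
  refine hι.tendsto.comp ?_
  have : Tendsto (fun h => h - f) (𝓝 f) (𝓝 (f - f)) := tendsto_id.sub tendsto_const_nhds
  rwa [sub_self] at this

lemma abs_integral_scaledDrift_le (h : IsLocalTriplet lam a g ρ) (hι : IsSizeContinuous a g ρ ι)
    (f : V) : |∫ x, scaledDrift (a x) (ρ x) (ι f x) ∂lam|
      ≤ ∫ x, tripletSize (a x) (g x) (ρ x) (ι f x) ∂lam := by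
  rw [← Real.norm_eq_abs]
  refine norm_integral_le_of_norm_le (hι.integrable f) (ae_of_all _ fun x => ?_)
  have h1 := mul_nonneg (sq_nonneg (ι f x)) (h.gauss_nonneg x)
  have h2 := integral_min_nonneg (ρ x) (ι f x)
  rw [Real.norm_eq_abs, tripletSize]
  linarith

variable [SFinite lam]

lemma integral_min_compProd_le (h : IsLocalTriplet lam a g ρ) (hι : IsSizeContinuous a g ρ ι)
    (f : V) : ∫ z, min 1 ((ι f z.1 * z.2) ^ 2) ∂(lam ⊗ₘ ρ)
      ≤ ∫ x, tripletSize (a x) (g x) (ρ x) (ι f x) ∂lam := by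
  have := h.isSFinite
  have h1 := h.integrable_min_compProd (AEEqFun.measurable _) (hι.integrable f)
  rw [Measure.integral_compProd h1]
  exact integral_mono (Integrable.integral_compProd (κ := Kernel.const Unit lam)
    (η := Kernel.prodMkLeft Unit ρ) (a := ()) h1) (hι.integrable f)
    fun x => h.integral_min_le_size x (ι f x)

/-- The two errors are decoupled: for fixed δ the first vanishes as e → 0, while the second depends
only on f and δ. -/
lemma abs_integral_scaledDrift_add_sub_le (h : IsLocalTriplet lam a g ρ)
    (hι : IsSizeContinuous a g ρ ι) (f e : V) {δ : ℝ} (hδ : 0 < δ) (hδ' : δ ≤ 1 / 2) :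
    |∫ x, scaledDrift (a x) (ρ x) (ι (f + e) x) ∂lam
        - ∫ x, scaledDrift (a x) (ρ x) (ι f x) ∂lam|
      ≤ (1 + 3 / δ ^ 2) * ∫ x, tripletSize (a x) (g x) (ρ x) (ι e x) ∂lam
        + ∫ p, truncationBound δ p ∂imageMeasure (lam ⊗ₘ ρ) (ι f) := by
  have := h.isSFinite
  have hb := measurable_ballInd
  have hm : ∀ f, Measurable (ι f) := fun f => AEEqFun.measurable _
  have hmf := hm f
  have hme := hm e
  have hd := fun f => h.integrable_scaledDrift (hm f) (hι.integrable f)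
  let D : X × ℝ → ℝ := fun z =>
    (ι f z.1 * z.2 + ι e z.1 * z.2) * ballInd (ι f z.1 * z.2 + ι e z.1 * z.2)
      - ι f z.1 * z.2 * ballInd (ι f z.1 * z.2) - ι e z.1 * z.2 * ballInd (ι e z.1 * z.2)
  have hif := h.integrable_min_compProd hmf (hι.integrable f)
  have hie := h.integrable_min_compProd hme (hι.integrable e)
  have hit : Integrable (fun z : X × ℝ => truncationBound δ (ι f z.1 * z.2)) (lam ⊗ₘ ρ) := by
    refine (hif.const_mul 16).mono' ((measurable_truncationBound δ).comp
      (by fun_prop)).aestronglyMeasurable (ae_of_all _ fun z => ?_)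
    rw [Real.norm_of_nonneg (truncationBound_nonneg hδ _)]
    exact truncationBound_le hδ' _
  have hDle : ∀ z, ‖D z‖ ≤ 3 / δ ^ 2 * min 1 ((ι e z.1 * z.2) ^ 2)
      + truncationBound δ (ι f z.1 * z.2) := fun z => abs_truncation_add_sub_le hδ hδ' _ _
  have hDi : Integrable D (lam ⊗ₘ ρ) :=
    ((hie.const_mul _).add hit).mono' (by fun_prop) (ae_of_all _ hDle)
  have h1 : ∫ x, scaledDrift (a x) (ρ x) (ι (f + e) x) ∂lam
      = ∫ x, scaledDrift (a x) (ρ x) (ι f x) ∂lam + ∫ x, scaledDrift (a x) (ρ x) (ι e x) ∂lam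
        + ∫ z, D z ∂(lam ⊗ₘ ρ) := by
    have hDi' : Integrable (fun x => ∫ y, D (x, y) ∂ρ x) lam := Integrable.integral_compProd
      (κ := Kernel.const Unit lam) (η := Kernel.prodMkLeft Unit ρ) (a := ()) hDi
    rw [Measure.integral_compProd hDi, ← integral_add' (hd f) (hd e),
      ← integral_add' ((hd f).add (hd e)) hDi']
    refine integral_congr_ae ?_
    rw [map_add]
    filter_upwards [AEEqFun.coeFn_add (ι f) (ι e)] with x hx
    rw [hx, Pi.add_apply, Pi.add_apply, Pi.add_apply, scaledDrift_add (h.integrable_min x)]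
  have h2 : |∫ z, D z ∂(lam ⊗ₘ ρ)| ≤ 3 / δ ^ 2 * ∫ x, tripletSize (a x) (g x) (ρ x) (ι e x) ∂lam
      + ∫ p, truncationBound δ p ∂imageMeasure (lam ⊗ₘ ρ) (ι f) := by
    refine (norm_integral_le_of_norm_le ((hie.const_mul _).add hit) (ae_of_all _ hDle)).trans ?_
    rw [integral_add' (hie.const_mul _) hit, integral_const_mul,
      integral_imageMeasure hmf (measurable_truncationBound δ) (truncationBound_zero hδ')]
    exact add_le_add_left (mul_le_mul_of_nonneg_left (integral_min_compProd_le h hι e)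
      (by positivity)) _
  have h3 := abs_integral_scaledDrift_le h hι e
  rw [h1]
  have h4 := abs_add_le (∫ x, scaledDrift (a x) (ρ x) (ι e x) ∂lam) (∫ z, D z ∂(lam ⊗ₘ ρ))
  calc _ = |∫ x, scaledDrift (a x) (ρ x) (ι e x) ∂lam + ∫ z, D z ∂(lam ⊗ₘ ρ)| := by
        congr 1
        ring
    _ ≤ _ := by linarith

/-- The drift is continuous at `f`, unless the Lévy measure at `f` charges `{-1, 1}`. -/
lemma continuousAt_drift (h : IsLocalTriplet lam a g ρ) (hι : IsSizeContinuous a g ρ ι) {f : V}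
    (hf : imageMeasure (lam ⊗ₘ ρ) (ι f) {-1, 1} = 0) :
    ContinuousAt (fun f => ∫ x, scaledDrift (a x) (ρ x) (ι f x) ∂lam) f := by
  have hint : Integrable (fun y : ℝ => min 1 (y ^ 2)) (imageMeasure (lam ⊗ₘ ρ) (ι f)) :=
    (h.isLevyMeasure_imageMeasure (AEEqFun.measurable _) (hι.integrable f)).integrable
  refine Metric.tendsto_nhds.2 fun ε hε => ?_
  -- The width δ = 1 / (n + 2) is fixed before the neighbourhood of f, because the constant 3 / δ²
  -- blows up.
  obtain ⟨n, hn⟩ := ((tendsto_integral_truncation hint hf).eventually_lt_const (half_pos hε)).exists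
  have hδ : 0 < 1 / ((n : ℝ) + 2) := by positivity
  have hδ' : 1 / ((n : ℝ) + 2) ≤ 1 / 2 :=
    one_div_le_one_div_of_le two_pos (by linarith [Nat.cast_nonneg (α := ℝ) n])
  have h1 := (hι.tendsto_sub f).const_mul (1 + 3 / (1 / ((n : ℝ) + 2)) ^ 2)
  rw [mul_zero] at h1
  filter_upwards [h1.eventually_lt_const (half_pos hε)] with k hk
  have h2 := abs_integral_scaledDrift_add_sub_le h hι f (k - f) hδ hδ'
  rw [add_sub_cancel] at h2
  rw [Real.dist_eq]
  linarith

end IsSizeContinuous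

end Embedding

/-! ### The covariance operator -/

section Covariance

variable {X : Type*} [MeasurableSpace X] {lam S : Measure X} {V : Type*} [NormedAddCommGroup V]
  [NormedSpace ℝ V]

/-- A linear map into `L²(S)` which is bounded near the origin defines a continuous bilinear
form. -/
lemma exists_covariance (ι : V →ₗ[ℝ] (X →ₘ[lam] ℝ)) (hS : S ≪ lam)
    (hint : ∀ f, Integrable (fun x => ι f x ^ 2) S)
    (hbdd : ∀ᶠ f in 𝓝 0, ∫ x, ι f x ^ 2 ∂S ≤ 1) :
    ∃ Q : V →L[ℝ] StrongDual ℝ V, ∀ f h, Q f h = ∫ x, ι f x * ι h x ∂S := by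
  have hmul : ∀ f h, Integrable (fun x => ι f x * ι h x) S := fun f h => by
    refine ((hint f).add (hint h)).mono' (((AEEqFun.measurable _).mul
      (AEEqFun.measurable _)).aestronglyMeasurable) (ae_of_all _ fun x => ?_)
    rw [Real.norm_eq_abs, Pi.add_apply, abs_le]
    constructor <;> nlinarith [sq_nonneg (ι f x + ι h x), sq_nonneg (ι f x - ι h x),
      sq_nonneg (ι f x), sq_nonneg (ι h x)]
  have hadd : ∀ f h, ∀ᵐ x ∂S, ι (f + h) x = ι f x + ι h x := fun f h => by
    rw [map_add]
    exact hS.ae_le (AEEqFun.coeFn_add _ _)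
  have hsmul : ∀ (c : ℝ) f, ∀ᵐ x ∂S, ι (c • f) x = c * ι f x := fun c f => by
    rw [map_smul]
    exact hS.ae_le (AEEqFun.coeFn_smul _ _)
  let B : V →ₗ[ℝ] V →ₗ[ℝ] ℝ := LinearMap.mk₂ ℝ (fun f h => ∫ x, ι f x * ι h x ∂S)
    (fun f f' h => by
      rw [← integral_add (hmul _ _) (hmul _ _)]
      refine integral_congr_ae ?_
      filter_upwards [hadd f f'] with x hx
      rw [hx, add_mul])
    (fun c f h => by
      rw [smul_eq_mul, ← integral_const_mul]
      refine integral_congr_ae ?_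
      filter_upwards [hsmul c f] with x hx
      rw [hx, mul_assoc])
    (fun f h h' => by
      rw [← integral_add (hmul _ _) (hmul _ _)]
      refine integral_congr_ae ?_
      filter_upwards [hadd h h'] with x hx
      rw [hx, mul_add])
    (fun c f h => by
      rw [smul_eq_mul, ← integral_const_mul]
      refine integral_congr_ae ?_
      filter_upwards [hsmul c h] with x hx
      rw [hx, mul_left_comm])
  obtain ⟨δ, hδ, hball⟩ := Metric.eventually_nhds_iff.1 hbdd
  have hunit : ∀ f h : V, ‖f‖ < δ → ‖h‖ < δ → |B f h| ≤ 1 := by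
    intro f h hf hh
    have h1 := hball (y := f) (by rwa [dist_zero_right])
    have h2 := hball (y := h) (by rwa [dist_zero_right])
    have h3 : |B f h| ≤ ∫ x, (ι f x ^ 2 + ι h x ^ 2) / 2 ∂S := by
      change |∫ x, ι f x * ι h x ∂S| ≤ _
      rw [← Real.norm_eq_abs]
      refine norm_integral_le_of_norm_le (((hint f).add (hint h)).div_const 2)
        (ae_of_all _ fun x => ?_)
      rw [Real.norm_eq_abs, abs_le]
      constructor <;> nlinarith [sq_nonneg (ι f x + ι h x), sq_nonneg (ι f x - ι h x)]
    rw [integral_div, integral_add (hint f) (hint h)] at h3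
    linarith
  have hbound : ∀ f h, ‖B f h‖ ≤ (2 / δ) ^ 2 * ‖f‖ * ‖h‖ := by
    intro f h
    rcases eq_or_ne f 0 with rfl | hf
    · simp
    rcases eq_or_ne h 0 with rfl | hh
    · simp
    have hf' := norm_pos_iff.2 hf
    have hh' := norm_pos_iff.2 hh
    -- Homogeneity: both arguments are rescaled to norm δ / 2, where the form is bounded by 1.
    have hs : ∀ v : V, v ≠ 0 → ‖(δ / 2 / ‖v‖) • v‖ < δ := fun v hv => by
      have := norm_pos_iff.2 hv
      rw [norm_smul, Real.norm_of_nonneg (by positivity), div_mul_cancel₀ _ this.ne']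
      exact half_lt_self hδ
    have h1 := hunit _ _ (hs f hf) (hs h hh)
    rw [map_smul, map_smul, LinearMap.smul_apply, smul_eq_mul, smul_eq_mul, abs_mul, abs_mul,
      abs_of_pos (by positivity), abs_of_pos (by positivity)] at h1
    rw [Real.norm_eq_abs]
    calc |B f h| = (2 / δ) ^ 2 * ‖f‖ * ‖h‖ * (δ / 2 / ‖h‖ * (δ / 2 / ‖f‖ * |B f h|)) := by
          field_simp
      _ ≤ (2 / δ) ^ 2 * ‖f‖ * ‖h‖ * 1 := mul_le_mul_of_nonneg_left (by linarith) (by positivity)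
      _ = _ := mul_one _
  exact ⟨B.mkContinuous₂ _ hbound, fun f h => rfl⟩

end Covariance

/-! ### The cylindrical Lévy process of an embedding -/

/-- For small t > 0 both t z and t w lie in the strip where exp is injective; a single time would
leave multiples of 2πi open. -/
lemma eq_of_forall_exp_mul_eq {z w : ℂ}
    (h : ∀ t : ℝ≥0, Complex.exp ((t : ℝ) * z) = Complex.exp ((t : ℝ) * w)) : z = w := by
  let t : ℝ≥0 := ⟨(1 + ‖z‖ + ‖w‖)⁻¹, by positivity⟩
  have ht : ((t : ℝ) : ℂ) ≠ 0 := by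
    rw [Complex.ofReal_ne_zero]
    exact inv_ne_zero (by positivity)
  have hv : ∀ v : ℂ, ‖v‖ ≤ 1 + ‖z‖ + ‖w‖ →
      -Real.pi < ((t : ℝ) * v : ℂ).im ∧ ((t : ℝ) * v : ℂ).im ≤ Real.pi := by
    intro v hv
    have h1 : |((t : ℝ) * v : ℂ).im| ≤ 1 := by
      refine (Complex.abs_im_le_norm _).trans ?_
      rw [norm_mul, show ‖((t : ℝ) : ℂ)‖ = (1 + ‖z‖ + ‖w‖)⁻¹ from
        (Complex.norm_real _).trans (Real.norm_of_nonneg t.2)]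
      exact inv_mul_le_one_of_le₀ hv (by positivity)
    have h2 := abs_le.1 h1
    have h3 := Real.pi_gt_three
    constructor <;> linarith
  have hz := hv z (by linarith [norm_nonneg w])
  have hw := hv w (by linarith [norm_nonneg z])
  exact mul_left_cancel₀ ht (Complex.exp_inj_of_neg_pi_lt_of_le_pi hz.1 hz.2 hw.1 hw.2 (h t))

section LevyProcess

variable {Ω : Type*} [MeasurableSpace Ω] {P : Measure Ω} [IsProbabilityMeasure P]
variable {X : Type*} [TopologicalSpace X] [MeasurableSpace X]
variable {M : ℝ≥0 → Set X → Ω →ₘ[P] ℝ} {lam : Measure X} {a g : X → ℝ} {ρ : Kernel X ℝ}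

namespace IsDriven

section Linear

variable {V : Type*} [NormedAddCommGroup V] [NormedSpace ℝ V] {ι : V →ₗ[ℝ] (X →ₘ[lam] ℝ)}
variable {K : ℕ → Set X}

lemma isMIntegral_iff (h : IsDriven M lam a g ρ) (hK : IsExhaustion lam K)
    (hι : IsSizeContinuous a g ρ ι) (t : ℝ≥0) (f : V) (Z : Ω →ₘ[P] ℝ) :
    IsMIntegral M lam t univ (ι f) Z ↔ Z = mIntegral M lam t univ (ι f) := by
  have h1 := h.isMIntegral_mIntegral hK (AEEqFun.measurable _) (hι.integrable f) t
  refine ⟨fun hZ => h.isMIntegral_unique hK hZ h1, ?_⟩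
  rintro rfl
  exact h1

lemma mIntegral_linearCombination (h : IsDriven M lam a g ρ) (hK : IsExhaustion lam K)
    (hι : IsSizeContinuous a g ρ ι) (t : ℝ≥0) (f f' : V) (α β : ℝ) :
    mIntegral M lam t univ (ι (α • f + β • f'))
      = α • mIntegral M lam t univ (ι f) + β • mIntegral M lam t univ (ι f') := by
  have h1 := ((h.isMIntegral_iff hK hι t f _).2 rfl).linearCombination h.random MeasurableSet.univ
    ((h.isMIntegral_iff hK hι t f' _).2 rfl) α β
  refine ((h.isMIntegral_iff hK hι t _ _).1 (h1.congr ?_)).symm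
  rw [map_add, map_smul, map_smul]
  filter_upwards [AEEqFun.coeFn_add (α • ι f) (β • ι f'), AEEqFun.coeFn_smul α (ι f),
    AEEqFun.coeFn_smul β (ι f')] with x h2 h3 h4
  rw [h2, Pi.add_apply, h3, h4]
  rfl

lemma isLinearMap_mIntegral (h : IsDriven M lam a g ρ) (hK : IsExhaustion lam K)
    (hι : IsSizeContinuous a g ρ ι) (t : ℝ≥0) :
    IsLinearMap ℝ fun f => mIntegral M lam t univ (ι f) where
  map_add f f' := by
    have := h.mIntegral_linearCombination hK hι t f f' 1 1
    simpa only [one_smul] using this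
  map_smul c f := by
    have := h.mIntegral_linearCombination hK hι t f 0 c 0
    simpa only [zero_smul, add_zero] using this

/-- Linearity reduces continuity to the origin, where a vanishing integrated size forces convergence
to 0 in probability. -/
lemma tendstoInMeasure_mIntegral (h : IsDriven M lam a g ρ) (hK : IsExhaustion lam K)
    (hι : IsSizeContinuous a g ρ ι) (t : ℝ≥0) (f : V) :
    TendstoInMeasure P (fun f => (mIntegral M lam t univ (ι f) : Ω → ℝ)) (𝓝 f)
      (mIntegral M lam t univ (ι f)) := by
  have h1 : TendstoInMeasure P (fun k => (mIntegral M lam t univ (ι (k - f)) : Ω → ℝ)) (𝓝 f) 0 :=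
    h.tendstoInMeasure_zero (f := fun k => ι (k - f)) (A := fun _ => univ) (t := fun _ => t)
      (fun k => hι.integrable _)
      (fun k u => h.charFun_mIntegral hK (AEEqFun.measurable _) (hι.integrable _) t u)
      (by simpa using (hι.tendsto_sub f).const_mul (t : ℝ))
  have h2 : TendstoInMeasure P (fun k ω => (mIntegral M lam t univ (ι (k - f)) : Ω → ℝ) ω
      + mIntegral M lam t univ (ι f) ω) (𝓝 f)
      (fun ω => (0 : Ω → ℝ) ω + mIntegral M lam t univ (ι f) ω) :=
    tendstoInMeasure_add h1 fun ε hε => by simp [hε.ne']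
  refine (h2.congr_left fun k => ?_).congr_right (ae_of_all _ fun ω => by simp)
  have h3 := (h.isLinearMap_mIntegral hK hι t).map_add (k - f) f
  rw [sub_add_cancel] at h3
  rw [h3]
  exact (AEEqFun.coeFn_add _ _).symm

end Linear

variable {F : Type*} [NormedAddCommGroup F] [NormedSpace ℝ F]
  {ι : StrongDual ℝ F →ₗ[ℝ] (X →ₘ[lam] ℝ)} {K : ℕ → Set X}

lemma isCylindricalLevyProcess_mIntegral (h : IsDriven M lam a g ρ) (hK : IsExhaustion lam K)
    (hι : IsSizeContinuous a g ρ ι) :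
    IsCylindricalLevyProcess fun t f => mIntegral M lam t univ (ι f) where
  linear := h.isLinearMap_mIntegral hK hι
  continuous := h.tendstoInMeasure_mIntegral hK hι
  levy _ f := h.isLevyProcess_mIntegral hK (fun _ => AEEqFun.measurable _)
    fun i => hι.integrable (f i)

variable [SFinite lam]

lemma charFun_mIntegral_eq (h : IsDriven M lam a g ρ) (hK : IsExhaustion lam K)
    (hι : IsSizeContinuous a g ρ ι) (t : ℝ≥0) (f : StrongDual ℝ F) (u : ℝ) :
    charFun (P.map (mIntegral M lam t univ (ι f))) u = Complex.exp ((t : ℝ) * levySymbol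
      (∫ x, scaledDrift (a x) (ρ x) (ι f x) ∂lam) (∫ x, ι f x ^ 2 * g x ∂lam)
      (imageMeasure (lam ⊗ₘ ρ) (ι f)) u) := by
  rw [h.charFun_mIntegral hK (AEEqFun.measurable _) (hι.integrable f), Measure.restrict_univ,
    h.triplet.integral_levySymbol_mul (AEEqFun.measurable _) (hι.integrable f)]

lemma isCylindricalCharacteristics (h : IsDriven M lam a g ρ) (hK : IsExhaustion lam K)
    (hι : IsSizeContinuous a g ρ ι) {Q : StrongDual ℝ F →L[ℝ] StrongDual ℝ (StrongDual ℝ F)}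
    {μ : CylindricalMeasure F} (hQ : ∀ f k, Q f k = ∫ x, ι f x * ι k x * g x ∂lam)
    (hμ : ∀ f, μ.proj f = imageMeasure (lam ⊗ₘ ρ) (ι f)) :
    IsCylindricalCharacteristics (fun t f => mIntegral M lam t univ (ι f))
      (fun f => ∫ x, scaledDrift (a x) (ρ x) (ι f x) ∂lam) Q μ where
  a_zero := by
    rw [integral_eq_zero_of_ae]
    rw [map_zero]
    filter_upwards [AEEqFun.coeFn_zero (α := X) (β := ℝ) (μ := lam)] with x hx
    rw [hx, Pi.zero_apply, scaledDrift_zero]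
  a_continuousAt f hf := hι.continuousAt_drift h.triplet (by rwa [← hμ])
  symmetric f k := by simp only [hQ, mul_comm (ι f _)]
  nonneg f := by
    rw [hQ]
    exact integral_nonneg fun x => mul_nonneg (mul_self_nonneg _) (h.triplet.gauss_nonneg x)
  levyMeasure f := by
    rw [hμ]
    exact h.triplet.isLevyMeasure_imageMeasure (AEEqFun.measurable _) (hι.integrable f)
  charFun_eq t f u := by
    rw [h.charFun_mIntegral_eq hK hι, hμ, hQ]
    simp only [sq]

/-- The characteristics of the cylindrical process are unique. -/
lemma eq_of_isCylindricalCharacteristics (h : IsDriven M lam a g ρ) (hK : IsExhaustion lam K)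
    (hι : IsSizeContinuous a g ρ ι) {b : StrongDual ℝ F → ℝ}
    {Q : StrongDual ℝ F →L[ℝ] StrongDual ℝ (StrongDual ℝ F)} {μ : CylindricalMeasure F}
    (hb : IsCylindricalCharacteristics (fun t f => mIntegral M lam t univ (ι f)) b Q μ)
    (f : StrongDual ℝ F) :
    b f = ∫ x, scaledDrift (a x) (ρ x) (ι f x) ∂lam ∧ Q f f = ∫ x, ι f x ^ 2 * g x ∂lam ∧
      μ.proj f = imageMeasure (lam ⊗ₘ ρ) (ι f) := by
  refine levySymbol_injective (hb.nonneg f)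
    (integral_nonneg fun x => mul_nonneg (sq_nonneg _) (h.triplet.gauss_nonneg x))
    (hb.levyMeasure f)
    (h.triplet.isLevyMeasure_imageMeasure (AEEqFun.measurable _) (hι.integrable f)) fun u =>
    eq_of_forall_exp_mul_eq fun t => ?_
  rw [← hb.charFun_eq, h.charFun_mIntegral_eq hK hι]

end IsDriven

end LevyProcess

-- Continuous embeddings into the Musielak–Orlicz space

section Embedding

variable {X : Type*} [TopologicalSpace X] [MeasurableSpace X] {γ : LocalSignedMeasure X}
  {S : Measure X} {ν : Measure (X × ℝ)} [SigmaFinite (controlMeasure γ S ν)]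
  {V : Type*} [NormedAddCommGroup V] [NormedSpace ℝ V]
  {ι : V →ₗ[ℝ] (X →ₘ[controlMeasure γ S ν] ℝ)}

/-- The size is dominated pointwise by Φ_M, hence its integral by the modular. -/
lemma IsContinuousEmbedding.isSizeContinuous (hι : IsContinuousEmbedding γ S ν ι)
    {ρ : Kernel X ℝ} [IsSFiniteKernel ρ] (hρ : ∀ x, ∫⁻ y, levyWeight y ∂ρ x ≤ 1)
    (hae : ∀ᵐ x ∂controlMeasure γ S ν, disint ν (controlMeasure γ S ν) x = ρ x) :
    IsSizeContinuous (driftDensity γ (controlMeasure γ S ν))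
      (gaussDensity S (controlMeasure γ S ν)) ρ ι := by
  have hloc := isLocalTriplet_density (γ := γ) (S := S) (ν := ν) hρ
  have hle : ∀ f, ∫⁻ x, ENNReal.ofReal (tripletSize (driftDensity γ (controlMeasure γ S ν) x)
      (gaussDensity S (controlMeasure γ S ν) x) (ρ x) (ι f x)) ∂controlMeasure γ S ν
      ≤ modular γ S ν (ι f) := fun f => by
    refine lintegral_mono_ae ?_
    filter_upwards [ofReal_tripletSize_le_Phi hρ hae] with x hx using hx _
  have hint : ∀ f, Integrable (fun x => tripletSize (driftDensity γ (controlMeasure γ S ν) x)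
      (gaussDensity S (controlMeasure γ S ν) x) (ρ x) (ι f x)) (controlMeasure γ S ν) := fun f =>
    ⟨(hloc.measurable_tripletSize (AEEqFun.measurable _)).aestronglyMeasurable,
      (hasFiniteIntegral_iff_ofReal (ae_of_all _ fun x => hloc.size_nonneg x _)).2
        ((hle f).trans_lt (hι.mem f))⟩
  refine ⟨hint, ?_⟩
  have h1 := (ENNReal.tendsto_toReal ENNReal.zero_ne_top).comp hι.continuous
  refine squeeze_zero (fun f => integral_nonneg fun x => hloc.size_nonneg x _) (fun f => ?_) h1
  rw [integral_eq_lintegral_of_nonneg_ae (ae_of_all _ fun x => hloc.size_nonneg x _)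
    (hint f).aestronglyMeasurable]
  exact ENNReal.toReal_mono (hι.mem f).ne (hle f)

end Embedding

end CylLevy

end

-- The main theorem

theorem mainTheorem6 {d : ℕ} {O : Set (EuclideanSpace ℝ (Fin d))} (hO : MeasurableSet O)
    {Ω : Type*} [MeasurableSpace Ω] (P : Measure Ω) [IsProbabilityMeasure P]
    (M : ℝ≥0 → Set O → Ω →ₘ[P] ℝ) (hM : CylLevy.IsLevyRandomMeasure M)
    (γ : CylLevy.LocalSignedMeasure O) (S : Measure O) (ν : Measure (O × ℝ))
    (hchar : CylLevy.IsCharacteristics M γ S ν)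
    {F : Type*} [NormedAddCommGroup F] [NormedSpace ℝ F] [CompleteSpace F]
    (ι : StrongDual ℝ F →ₗ[ℝ] (O →ₘ[CylLevy.controlMeasure γ S ν] ℝ))
    (hι : CylLevy.IsContinuousEmbedding γ S ν ι)
    (hdense : Dense {f : StrongDual ℝ F | ∃ s : CylLevy.SimpleB O,
      (ι f : O → ℝ) =ᵐ[CylLevy.controlMeasure γ S ν] s.toFun})
    (L : ℝ≥0 → StrongDual ℝ F → Ω →ₘ[P] ℝ)
    (hL : L = fun t f => CylLevy.mIntegral M (CylLevy.controlMeasure γ S ν) t univ (ι f)) :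
    -- `L` is well defined
    (∀ f, CylLevy.MIntegrable M (CylLevy.controlMeasure γ S ν) (ι f)) ∧
    (∀ t f Z, CylLevy.IsMIntegral M (CylLevy.controlMeasure γ S ν) t univ (ι f) Z ↔ Z = L t f) ∧
    -- `L` is a cylindrical Lévy process, and has cylindrical characteristics
    CylLevy.IsCylindricalLevyProcess L ∧
    (∃ a Q μ, CylLevy.IsCylindricalCharacteristics L a Q μ) ∧
    -- the characteristics are given by the stated formulas
    ∀ a Q μ, CylLevy.IsCylindricalCharacteristics L a Q μ → ∀ f : StrongDual ℝ F,
      (Integrable (fun x => CylLevy.U γ S ν (ι f x) x) (CylLevy.controlMeasure γ S ν) ∧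
        a f = ∫ x, CylLevy.U γ S ν (ι f x) x ∂CylLevy.controlMeasure γ S ν) ∧
      (Integrable (ι f) γ.totalVariation →
        Integrable (fun z : O × ℝ => ι f z.1 * z.2 *
          (CylLevy.ballInd (ι f z.1 * z.2) - CylLevy.ballInd z.2)) ν →
        a f = γ.integral (ι f) + ∫ z : O × ℝ, ι f z.1 * z.2 *
          (CylLevy.ballInd (ι f z.1 * z.2) - CylLevy.ballInd z.2) ∂ν) ∧
      (Integrable (fun x => (ι f x) ^ 2) S ∧ Q f f = ∫ x, (ι f x) ^ 2 ∂S) ∧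
      (∀ B : Set ℝ, MeasurableSet B → 0 ∉ B →
        μ.content {g : F | f g ∈ B} = ν {z : O × ℝ | ι f z.1 * z.2 ∈ B}) := by
  have hsig := hchar.sigmaFinite_control
  have hsig' := hchar.sigmaFinite_nu
  have hle : CylLevy.controlMeasure γ S ν ≤ CylLevy.controlMeasure γ S ν + ν.map Prod.fst :=
    Measure.le_add_right le_rfl
  -- The marginal of ν is added because its absolute continuity with respect to λ is not yet known:
  -- that needs ν to have no mass at y = 0, which this exhaustion provides.
  obtain ⟨K, hK'⟩ := CylLevy.exists_isExhaustion hO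
    (CylLevy.controlMeasure γ S ν + ν.map Prod.fst)
  have hK := hK'.mono_measure hle
  have h0 := CylLevy.measure_snd_eq_zero (hK'.mono_measure (Measure.le_add_left le_rfl))
    hchar.levyMeasure
  have hdis : CylLevy.IsDisintegration ν (CylLevy.controlMeasure γ S ν)
      (CylLevy.disint ν (CylLevy.controlMeasure γ S ν)) := by
    have hex := CylLevy.exists_isDisintegration h0
      (CylLevy.levy_le_controlMeasure (γ := γ) (S := S) (ν := ν))
    rw [CylLevy.disint, dif_pos hex]
    exact hex.choose_spec
  -- The kernel in U and Φ_M is an arbitrary choice; it agrees almost everywhere with an s-finite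
  -- version, for which product measures and Fubini are available.
  obtain ⟨ρ, hρs, hρ, hae, hν⟩ := hdis.exists_good h0 CylLevy.levy_le_controlMeasure
  have hdr := hchar.isDriven hM hρ hν
  have hsc := hι.isSizeContinuous hρ hae
  have hU : ∀ f, (fun x => CylLevy.U γ S ν (ι f x) x) =ᵐ[CylLevy.controlMeasure γ S ν]
      fun x => CylLevy.scaledDrift (CylLevy.driftDensity γ (CylLevy.controlMeasure γ S ν) x) (ρ x)
        (ι f x) := fun f => by
    filter_upwards [hae] with x hx
    rw [CylLevy.U, hx]
    rfl
  have hm : ∀ f, Measurable (ι f) := fun f => AEEqFun.measurable _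
  have hS : S ≪ CylLevy.controlMeasure γ S ν :=
    Measure.absolutelyContinuous_of_le CylLevy.gauss_le_controlMeasure
  have hsq : ∀ f, Integrable (fun x => ι f x ^ 2) S := fun f =>
    CylLevy.integrable_mul_gaussDensity_iff.1
      (hdr.triplet.integrable_sq_mul_gauss (hm f) (hsc.integrable f))
  subst hL
  refine ⟨fun f => ⟨hm f, ?_⟩, fun t f Z => hdr.isMIntegral_iff hK hsc t f Z,
    hdr.isCylindricalLevyProcess_mIntegral hK hsc, ?_, fun a Q μ hc f => ?_⟩
  · obtain ⟨s, hs, -⟩ := hdr.exists_isApprox hK (hm f) (hsc.integrable f)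
    exact ⟨s, hs⟩
  -- The variance is part of the size, so it is small near the origin; by homogeneity this makes the
  -- covariance form continuous.
  · have hbdd : ∀ᶠ f in 𝓝 0, ∫ x, ι f x ^ 2 ∂S ≤ 1 := by
      filter_upwards [hsc.tendsto.eventually_lt_const one_pos] with f hf
      rw [← CylLevy.integral_mul_gaussDensity (γ := γ) (ν := ν)]
      exact (integral_mono (hdr.triplet.integrable_sq_mul_gauss (hm f) (hsc.integrable f))
        (hsc.integrable f) fun x => CylLevy.IsLocalTriplet.sq_mul_gauss_le_size x _).trans hf.le
    obtain ⟨Q, hQ⟩ := CylLevy.exists_covariance ι hS hsq hbdd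
    have hfst : ν.map Prod.fst ≪ CylLevy.controlMeasure γ S ν := by
      refine Measure.AbsolutelyContinuous.mk fun N hN hN0 => ?_
      rw [Measure.map_apply measurable_fst hN, hν, ← Set.prod_univ,
        Measure.compProd_apply_prod hN MeasurableSet.univ]
      exact setLIntegral_measure_zero _ _ hN0
    refine ⟨_, Q, CylLevy.cylindricalMeasure hfst ι,
      hdr.isCylindricalCharacteristics hK hsc (fun f k => ?_) fun f => ?_⟩
    · rw [hQ, CylLevy.integral_mul_gaussDensity]
    · rw [CylLevy.proj_cylindricalMeasure, ← hν]
  -- Uniqueness of the triplet of L(·)f fixes all three characteristics; what remains is to rewrite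
  -- them in terms of γ, Σ and ν.
  · obtain ⟨hc1, hc2, hc3⟩ := hdr.eq_of_isCylindricalCharacteristics hK hsc hc f
    rw [← hν] at hc3
    refine ⟨⟨(hdr.triplet.integrable_scaledDrift (hm f) (hsc.integrable f)).congr (hU f).symm,
      hc1.trans (integral_congr_ae (hU f)).symm⟩, fun hf1 hf2 => ?_, ⟨hsq f, ?_⟩,
      fun B hB hB0 => ?_⟩
    · obtain ⟨hi, he⟩ := CylLevy.integral_mul_driftDensity (S := S) (ν := ν) hf1
      have hf3 : Integrable (fun z : O × ℝ => ι f z.1 * z.2 *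
          (CylLevy.ballInd (ι f z.1 * z.2) - CylLevy.ballInd z.2))
          (CylLevy.controlMeasure γ S ν ⊗ₘ ρ) := by rwa [← hν]
      have hf4 : ∫ z : O × ℝ, ι f z.1 * z.2 *
          (CylLevy.ballInd (ι f z.1 * z.2) - CylLevy.ballInd z.2) ∂ν
          = ∫ x, ∫ y, ι f x * y * (CylLevy.ballInd (ι f x * y) - CylLevy.ballInd y) ∂ρ x
            ∂CylLevy.controlMeasure γ S ν :=
        (congrArg (fun m => ∫ z : O × ℝ, ι f z.1 * z.2 *
          (CylLevy.ballInd (ι f z.1 * z.2) - CylLevy.ballInd z.2) ∂m) hν).trans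
          (Measure.integral_compProd hf3)
      have hf5 : Integrable (fun x => ∫ y, ι f x * y *
          (CylLevy.ballInd (ι f x * y) - CylLevy.ballInd y) ∂ρ x) (CylLevy.controlMeasure γ S ν) :=
        Integrable.integral_compProd (κ := Kernel.const Unit (CylLevy.controlMeasure γ S ν))
          (η := Kernel.prodMkLeft Unit ρ) (a := ()) hf3
      rw [hc1, hf4, ← he, ← integral_add hi hf5]
      simp only [CylLevy.scaledDrift_eq]
    · rw [hc2, CylLevy.integral_mul_gaussDensity]
    · have h1 : B \ {0} = B := sdiff_singleton_eq_self hB0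
      have h2 := CylLevy.imageMeasure_apply (ν := ν) (hm f) hB
      rw [← hc3, CylLevy.CylindricalMeasure.proj_apply _ _ hB, h1] at h2
      exact h2
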